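/- Let $\alpha,\beta\in\mathbb R$ with $\beta\neq 0$, and consider for real-valued $u$ the Cauchy problem of the Kawahara equation $$u_t+\alpha u_{xxx}+\beta u_{xxxxx}+uu_x=0,\qquad u(x,0)=u_0(x),\qquad x\in\mathbb R .$$ Let $H^s(\mathbb R)$ be the Sobolev space of real-valued tempered distributions $f$ with $\|f\|_{H^s}=\|(1+|\xi|^2)^{s/2}\widehat f\,\|_{L^2}<\infty$, and give $C([0,T];H^s(\mathbb R))$ the norm $\sup_{t\in[0,T]}\|u(t)\|_{H^s}$. For $T>0$, call $\Phi:H^s(\mathbb R)\to C([0,T];H^s(\mathbb R))$ a solution map near zero if there is $r>0$ such that for every real-valued Schwartz function $u_0$ with $\|u_0\|_{H^s}<r$, the function $\Phi(u_0)$ is a classical solution on $[0,T]$ of the Cauchy problem with initial value $u_0$ that belongs to $C([0,T];H^k(\mathbb R))$ for all $k\ge 0$. (Nothing is required of $\Phi$ at other initial data.) If $s<-\frac94$, then the solution map is not $C^3$ at zero: there is no $T>0$ for which some solution map near zero $\Phi:H^s(\mathbb R)\to C([0,T];H^s(\mathbb R))$, $u_0\mapsto u$, is of class $C^3$ (in the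 Fréchet sense, over $\mathbb R$) in a neighbourhood of $0$. -/

import Mathlib

open MeasureTheory Set Filter Topology
open scoped SchwartzMap ContDiff

noncomputable section

namespace Kawahara

/-- A tempered distribution on `ℝ` is real-valued if it takes real values on real-valued Schwartz
functions. -/
def IsRealDistribution (f : 𝓢'(ℝ, ℂ)) : Prop :=
  ∀ φ : 𝓢(ℝ, ℂ), (∀ x, (φ x).im = 0) → (f φ).im = 0

/-- The real-valued tempered distributions in the `L²`-based Sobolev space of order `s`, as a real
subspace of the space of tempered distributions. -/
def sobolevSubmodule (s : ℝ) : Submodule ℝ 𝓢'(ℝ, ℂ) where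
  carrier := {f | TemperedDistribution.MemSobolev s 2 f ∧ IsRealDistribution f}
  zero_mem' := ⟨TemperedDistribution.memSobolev_fun_zero ℝ ℂ s 2, fun _ _ => rfl⟩
  add_mem' := by
    rintro f g ⟨hf, hf'⟩ ⟨hg, hg'⟩
    refine ⟨hf.add hg, fun φ hφ => ?_⟩
    have h : (f + g) φ = f φ + g φ := rfl
    rw [h, Complex.add_im, hf' φ hφ, hg' φ hφ, add_zero]
  smul_mem' := by
    rintro c f ⟨hf, hf'⟩
    have h : c • f = (c : ℂ) • f := by
      ext φ
      exact (Complex.coe_smul c (f φ)).symm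
    refine ⟨h ▸ hf.smul (c : ℂ), fun φ hφ => ?_⟩
    have h' : (c • f) φ = c • f φ := rfl
    rw [h', Complex.smul_im, hf' φ hφ, smul_zero]

/-- The Sobolev space `H^s(ℝ)` of real-valued distributions. It is made a type of its own, so that
it carries the topology of its norm and not the one of pointwise convergence on Schwartz
functions. -/
def Sobolev (s : ℝ) : Type := sobolevSubmodule s

namespace Sobolev

variable {s : ℝ}

instance : AddCommGroup (Sobolev s) := inferInstanceAs (AddCommGroup (sobolevSubmodule s))

instance : Module ℝ (Sobolev s) := inferInstanceAs (Module ℝ (sobolevSubmodule s))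

/-- The underlying tempered distribution of an element of `H^s(ℝ)`. -/
def toDistribution : Sobolev s →ₗ[ℝ] 𝓢'(ℝ, ℂ) := (sobolevSubmodule s).subtype

theorem toDistribution_injective :
    Function.Injective (toDistribution : Sobolev s → 𝓢'(ℝ, ℂ)) :=
  Subtype.val_injective

theorem memSobolev (f : Sobolev s) : TemperedDistribution.MemSobolev s 2 f.toDistribution :=
  f.2.1

theorem isRealDistribution (f : Sobolev s) : IsRealDistribution f.toDistribution :=
  f.2.2

theorem toTemperedDistribution_injective : Function.Injective
    (Lp.toTemperedDistributionCLM ℂ (volume : Measure ℝ) 2) :=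
  LinearMap.ker_eq_bot.mp Lp.ker_toTemperedDistributionCLM_eq_bot

/-- The `L²` function that is the Bessel potential of order `s` of an element of `H^s(ℝ)`. -/
def besselFun (f : Sobolev s) : Lp ℂ 2 (volume : Measure ℝ) := f.memSobolev.choose

theorem besselFun_spec (f : Sobolev s) :
    Lp.toTemperedDistributionCLM ℂ (volume : Measure ℝ) 2 f.besselFun =
      TemperedDistribution.besselPotential ℝ ℂ s f.toDistribution :=
  f.memSobolev.choose_spec.symm

/-- The Bessel potential of order `s` as a linear map from `H^s(ℝ)` to `L²`. -/
def toL2 : Sobolev s →ₗ[ℝ] Lp ℂ 2 (volume : Measure ℝ) where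
  toFun := besselFun
  map_add' f g := by
    apply toTemperedDistribution_injective
    rw [map_add, besselFun_spec, besselFun_spec, besselFun_spec, map_add, map_add]
  map_smul' c f := by
    apply toTemperedDistribution_injective
    rw [RingHom.id_apply, besselFun_spec, map_smul, ContinuousLinearMap.map_smul_of_tower,
      ContinuousLinearMap.map_smul_of_tower, besselFun_spec]

theorem toL2_injective : Function.Injective (toL2 : Sobolev s → Lp ℂ 2 (volume : Measure ℝ)) := by
  intro f g hfg
  apply toDistribution_injective
  have h := congrArg (Lp.toTemperedDistributionCLM ℂ (volume : Measure ℝ) 2) hfg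
  have h' : TemperedDistribution.besselPotential ℝ ℂ s f.toDistribution =
      TemperedDistribution.besselPotential ℝ ℂ s g.toDistribution :=
    (besselFun_spec f).symm.trans (h.trans (besselFun_spec g))
  have h2 := congrArg (TemperedDistribution.besselPotential ℝ ℂ (-s)) h'
  simpa using h2

/-- The Sobolev norm `‖f‖_{H^s} = ‖(1 + |ξ|²)^{s/2} 𝓕 f‖_{L²}`, written, by Plancherel, as the
`L²` norm of the inverse Fourier transform of `(1 + |ξ|²)^{s/2} 𝓕 f`. -/
instance : NormedAddCommGroup (Sobolev s) :=
  NormedAddCommGroup.induced (Sobolev s) (Lp ℂ 2 (volume : Measure ℝ)) toL2 toL2_injective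

instance : NormedSpace ℝ (Sobolev s) := NormedSpace.induced ℝ (Sobolev s) _ toL2

/-- The element `f` of `H^s(ℝ)` is given by integration against the function `v`. -/
def Represents (f : Sobolev s) (v : ℝ → ℝ) : Prop :=
  ∀ φ : 𝓢(ℝ, ℂ), f.toDistribution φ = ∫ x, φ x * (v x : ℂ)

end Sobolev

/-- The function `u t x` is a classical solution of
`u_t + α u_xxx + β u_xxxxx + u u_x = 0` on `[0, T]` with initial value `u₀`, in the class
`C([0, T]; H^∞(ℝ))`: each `u t` is smooth, and all its derivatives lie in `L²(ℝ)` and depend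
continuously on `t` in the `L²` norm. -/
structure IsSmoothSolution (α β T : ℝ) (u₀ : ℝ → ℝ) (u : ℝ → ℝ → ℝ) : Prop where
  initial : u 0 = u₀
  smooth : ∀ t ∈ Icc 0 T, ContDiff ℝ ∞ (u t)
  memLp : ∀ t ∈ Icc 0 T, ∀ k : ℕ, MemLp (iteratedDeriv k (u t)) 2 volume
  continuous : ∀ t ∈ Icc 0 T, ∀ k : ℕ,
    Tendsto (fun τ => eLpNorm (iteratedDeriv k (u τ) - iteratedDeriv k (u t)) 2 volume)
      (𝓝[Icc 0 T] t) (𝓝 0)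
  equation : ∀ t ∈ Icc 0 T, ∀ x : ℝ,
    HasDerivWithinAt (fun τ => u τ x)
      (-(α * iteratedDeriv 3 (u t) x + β * iteratedDeriv 5 (u t) x + u t x * deriv (u t) x))
      (Icc 0 T) t

/-- `Φ` is, near zero, a solution map `H^s(ℝ) → C([0, T]; H^s(ℝ))` of the Kawahara equation: it
sends all Schwartz initial data that are small in `H^s(ℝ)` to smooth solutions with these data.
For other data of low regularity, where the product `u u_x` need not have a meaning, nothing is
required. -/
def IsSolutionMap (α β s T : ℝ) (Φ : Sobolev s → C(Icc (0 : ℝ) T, Sobolev s)) : Prop :=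
  ∀ᶠ f in 𝓝 (0 : Sobolev s), ∀ u₀ : 𝓢(ℝ, ℝ), f.Represents u₀ →
    ∃ u : ℝ → ℝ → ℝ, IsSmoothSolution α β T u₀ u ∧
      ∀ t : Icc (0 : ℝ) T, (Φ f t).Represents (u t)

end Kawahara

end

/-! Suppose the solution map were C³ at zero. Taylor's formula along a ray gives `Φ(εf) = a₀ + εa₁ +
ε²a₂ + O(‖f‖³ε³)` for small ε, with a constant that does not depend on `f` (`exists_cubic_bound`).
For smooth data the same curve, paired with a linear evolution with profile `H`, has an explicit
expansion whose ε³ coefficient is `J/2`, where `J` is an integral over three frequencies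
(`exists_expansion`). Comparison by a divided difference and the duality of `H^s` and `H^{-s}` give
`|J| ≤ C ‖F‖_s³ ‖H‖_{-s}` for all profiles and all times up to `T` (`exists_cubicInteraction_le`).
The rest of the proof refutes this inequality.

The expansion needs no well-posedness theory. Let `w` be the linear evolution of `F` and `v = u -
εw`. Conservation of mass and the weak Duhamel formula give `‖v(t)‖² = -ε ∫∫ u² w_x`. Bounding the
right side by mass yields `‖v‖² = O(ε³)`. Since `∫ w² w_x = 0`, reinserting this bound yields `‖v‖²
= O(ε^{7/2})` (`exists_remainder_bound`). The quadratic term in `v` is therefore negligible at third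
order, and one more use of Duhamel on the term linear in `v` produces `J`. All constants depend only
on `F`, `H`, `T` and the equation, not on the solution.

To make `J` large, take `F` with bumps of width γ at `±N`, and let `H` select output frequencies
slightly below `N`, so that the inputs are close to `N, N, -N`. The total resonance factors through
`(x+y)(y+z)(z+x)` and has size at most a multiple of `N³γ²`, so it causes no oscillation if `γ =
N^{-3/2}`. The intermediate resonances have size at least a multiple of `γN⁴` and oscillate away,
leaving a kernel of size `t/N⁴` (`interactionKernel_eq`). The three cyclic contributions are close
to multiples of `1/15`, `-1/5` and `-1/5`, so they do not cancel (`cyclic_interactionKernel_le`).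
Hence `|J| ≳ tNγ³/N⁴` (`le_norm_cubicInteraction`), while `‖F‖_s³ ‖H‖_{-s} ≲ N^{2s}γ²`. Together
these force `t ≲ N^{2s+9/2}`, which is false for large `N` when `s < -9/4`. -/

noncomputable section

namespace Kawahara

open FourierTransform

/-! ### The linear evolution on the Fourier side. -/

section

/-- Smooth compactly supported functions. -/
structure IsTest (H : ℝ → ℂ) : Prop where
  smooth : ContDiff ℝ ∞ H
  supp : HasCompactSupport H

namespace IsTest

variable {H G : ℝ → ℂ}

theorem smul (hH : IsTest H) {f : ℝ → ℂ} (hf : ContDiff ℝ ∞ f) : IsTest fun ξ => f ξ * H ξ :=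
  ⟨hf.mul hH.smooth, hH.supp.mul_left⟩

theorem add (hH : IsTest H) (hG : IsTest G) : IsTest fun ξ => H ξ + G ξ :=
  ⟨hH.smooth.add hG.smooth, hH.supp.add hG.supp⟩

theorem continuous (hH : IsTest H) : Continuous H := hH.smooth.continuous

theorem integrable (hH : IsTest H) : Integrable H :=
  hH.continuous.integrable_of_hasCompactSupport hH.supp

/-- A test function as a Schwartz function. -/
def toSchwartz (hH : IsTest H) : 𝓢(ℝ, ℂ) := hH.supp.toSchwartzMap hH.smooth

@[simp] theorem toSchwartz_apply (hH : IsTest H) (x : ℝ) : hH.toSchwartz x = H x := rfl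

end IsTest

/-- The dispersion relation of the linear Kawahara equation. -/
def symbol (α β ξ : ℝ) : ℝ := β * (2 * Real.pi * ξ) ^ 5 - α * (2 * Real.pi * ξ) ^ 3

theorem contDiff_symbol (α β : ℝ) : ContDiff ℝ ∞ (symbol α β) := by
  unfold symbol; fun_prop

theorem continuous_symbol (α β : ℝ) : Continuous (symbol α β) := (contDiff_symbol α β).continuous

@[simp] theorem symbol_neg (α β ξ : ℝ) : symbol α β (-ξ) = -symbol α β ξ := by
  unfold symbol; ring

/-- The unimodular factor by which the linear evolution acts on the Fourier side. -/
def phase (α β τ ξ : ℝ) : ℂ := Complex.exp ((τ * symbol α β ξ : ℝ) * Complex.I)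

theorem contDiff_phase (α β τ : ℝ) : ContDiff ℝ ∞ (phase α β τ) := by
  have h : ContDiff ℝ ∞ fun ξ => ((τ * symbol α β ξ : ℝ) : ℂ) :=
    Complex.ofRealCLM.contDiff.comp (contDiff_const.mul (contDiff_symbol α β))
  exact Complex.contDiff_exp.comp (h.mul contDiff_const)

@[simp] theorem norm_phase (α β τ ξ : ℝ) : ‖phase α β τ ξ‖ = 1 :=
  Complex.norm_exp_ofReal_mul_I _

theorem phase_mul_phase_neg (α β τ ξ : ℝ) : phase α β τ ξ * phase α β τ (-ξ) = 1 := by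
  rw [phase, phase, ← Complex.exp_add, symbol_neg]
  simp

theorem phase_neg_mul_phase (α β τ ξ : ℝ) : phase α β (-τ) ξ * phase α β τ ξ = 1 := by
  rw [phase, phase, ← Complex.exp_add]
  simp

theorem hasDerivAt_phase (α β τ ξ : ℝ) : HasDerivAt (fun τ => phase α β τ ξ)
    (Complex.I * symbol α β ξ * phase α β τ ξ) τ := by
  unfold phase
  have h : HasDerivAt (fun τ : ℝ => ((τ * symbol α β ξ : ℝ) : ℂ) * Complex.I)
      (((1 * symbol α β ξ : ℝ) : ℂ) * Complex.I) τ :=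
    (((hasDerivAt_id τ).mul_const _).ofReal_comp).mul_const _
  convert h.cexp using 1
  push_cast; ring

/-- The solution of the linear (adjoint) Kawahara equation whose Fourier transform is transported
by the `phase`. -/
def flow (α β : ℝ) (H : ℝ → ℂ) (τ : ℝ) : ℝ → ℂ := 𝓕 fun ξ => phase α β τ ξ * H ξ

/-- The Fourier side of differentiation in space. -/
def dHat (H : ℝ → ℂ) (ξ : ℝ) : ℂ := (-2 * Real.pi * Complex.I * ξ) * H ξ

variable {α β : ℝ} {H F : ℝ → ℂ}

theorem IsTest.phase_mul (hH : IsTest H) (τ : ℝ) : IsTest fun ξ => phase α β τ ξ * H ξ :=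
  hH.smul (contDiff_phase α β τ)

theorem IsTest.dx (hH : IsTest H) : IsTest (dHat H) := by
  refine hH.smul ?_
  have : ContDiff ℝ ∞ fun ξ : ℝ => (ξ : ℂ) := Complex.ofRealCLM.contDiff
  fun_prop

theorem IsTest.symbol_mul (hH : IsTest H) : IsTest fun ξ => Complex.I * symbol α β ξ * H ξ := by
  refine hH.smul ?_
  have : ContDiff ℝ ∞ fun ξ : ℝ => ((symbol α β ξ : ℝ) : ℂ) :=
    Complex.ofRealCLM.contDiff.comp (contDiff_symbol α β)
  fun_prop

/-- The linear evolution of a test function, as a Schwartz function. -/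
def IsTest.flowS (α β : ℝ) (hH : IsTest H) (τ : ℝ) : 𝓢(ℝ, ℂ) :=
  𝓕 (hH.phase_mul (α := α) (β := β) τ).toSchwartz

theorem IsTest.coe_flowS (hH : IsTest H) (τ : ℝ) : ⇑(hH.flowS α β τ) = flow α β H τ := rfl

theorem flow_eq_integral (H : ℝ → ℂ) (τ x : ℝ) : flow α β H τ x =
    ∫ ξ : ℝ, Complex.exp ((-2 * Real.pi * ξ * x : ℝ) * Complex.I) * (phase α β τ ξ * H ξ) := by
  rw [flow, Real.fourier_real_eq_integral_exp_smul]
  rfl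

/-- The phase is unimodular, so the bound is uniform in time. This is the only sup-norm control of
test functions in the quantitative estimates. -/
theorem norm_flow_le (H : ℝ → ℂ) (τ x : ℝ) : ‖flow α β H τ x‖ ≤ ∫ ξ, ‖H ξ‖ := by
  rw [flow_eq_integral]
  refine (norm_integral_le_integral_norm _).trans_eq ?_
  simp only [norm_mul, Complex.norm_exp_ofReal_mul_I, norm_phase, one_mul]

theorem IsTest.continuous_flow (hH : IsTest H) (τ : ℝ) : Continuous (flow α β H τ) :=
  (hH.flowS α β τ).continuous

theorem IsTest.memLp_flow (hH : IsTest H) (τ : ℝ) : MemLp (flow α β H τ) 2 := by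
  rw [← hH.coe_flowS]
  exact (hH.flowS α β τ).memLp 2

theorem IsTest.hasDerivAt_flow_space (hH : IsTest H) (τ x : ℝ) :
    HasDerivAt (flow α β H τ) (flow α β (dHat H) τ x) x := by
  have h := (hH.phase_mul (α := α) (β := β) τ)
  have h2 := Real.hasDerivAt_fourier (f := fun ξ => phase α β τ ξ * H ξ) h.integrable
    (by
      refine (h.dx.integrable.const_mul (-2 * Real.pi * Complex.I)⁻¹).congr ?_
      refine Eventually.of_forall fun ξ => ?_
      have : (Real.pi : ℂ) ≠ 0 := by exact_mod_cast Real.pi_ne_zero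
      simp only [dHat, Complex.real_smul]
      field_simp [Complex.I_ne_zero]) x
  have h3 : (fun ξ => phase α β τ ξ * dHat H ξ) =
      fun ξ : ℝ => (-2 * Real.pi * Complex.I * ξ) • (phase α β τ ξ * H ξ) := by
    ext ξ
    simp only [dHat, smul_eq_mul]
    ring
  rw [flow, flow, h3]
  exact h2

theorem IsTest.hasDerivAt_flow_time (hH : IsTest H) (τ x : ℝ) :
    HasDerivAt (fun τ => flow α β H τ x)
      (flow α β (fun ξ => Complex.I * symbol α β ξ * H ξ) τ x) τ := by
  simp only [flow_eq_integral]
  have hs := hH.symbol_mul (α := α) (β := β)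
  have hc : ∀ {K : ℝ → ℂ}, IsTest K → ∀ s, Continuous fun ξ : ℝ =>
      Complex.exp ((-2 * Real.pi * ξ * x : ℝ) * Complex.I) * (phase α β s ξ * K ξ) := by
    intro K hK s
    have h1 := hK.continuous
    have h2 := (contDiff_phase α β s).continuous
    fun_prop
  refine (hasDerivAt_integral_of_dominated_loc_of_deriv_le
    (F' := fun s ξ => Complex.exp ((-2 * Real.pi * ξ * x : ℝ) * Complex.I) *
      (phase α β s ξ * (Complex.I * symbol α β ξ * H ξ)))
    (bound := fun ξ => ‖Complex.I * symbol α β ξ * H ξ‖) (s := univ) univ_mem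
    (Eventually.of_forall fun s => (hc hH s).aestronglyMeasurable) ?_
    (hc hs τ).aestronglyMeasurable (Eventually.of_forall fun ξ s _ => ?_) hs.integrable.norm
    (Eventually.of_forall fun ξ s _ => ?_)).2
  · refine (hH.integrable.norm).mono (hc hH τ).aestronglyMeasurable
      (Eventually.of_forall fun ξ => ?_)
    simp only [norm_mul, Complex.norm_exp_ofReal_mul_I, norm_phase, one_mul, norm_norm]
    exact le_rfl
  · simp only [norm_mul, Complex.norm_exp_ofReal_mul_I, norm_phase, one_mul]
    exact le_rfl
  · refine (((hasDerivAt_phase α β s ξ).mul_const (H ξ)).const_mul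
      (Complex.exp ((-2 * Real.pi * ξ * x : ℝ) * Complex.I))).congr_deriv ?_
    ring

theorem IsTest.continuous_flow_time (hH : IsTest H) (x : ℝ) :
    Continuous fun τ => flow α β H τ x :=
  continuous_iff_continuousAt.2 fun τ => (hH.hasDerivAt_flow_time τ x).continuousAt

/-- The linear equation satisfied by the flow, in the form of its time derivative. -/
theorem IsTest.flow_symbol (hH : IsTest H) (τ x : ℝ) :
    flow α β (fun ξ => Complex.I * symbol α β ξ * H ξ) τ x =
      -α * flow α β (dHat (dHat (dHat H))) τ x - β * flow α β (dHat (dHat (dHat (dHat (dHat H))))) τ x := by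
  have h3 := hH.dx.dx.dx
  have h5 := h3.dx.dx
  unfold flow
  have key : (fun ξ => phase α β τ ξ * (Complex.I * symbol α β ξ * H ξ)) =
      fun ξ => (-α : ℂ) * (phase α β τ ξ * dHat (dHat (dHat H)) ξ) -
        β * (phase α β τ ξ * dHat (dHat (dHat (dHat (dHat H)))) ξ) := by
    ext ξ
    simp only [dHat, symbol]
    push_cast
    have h2 := Complex.I_sq
    have h3 : Complex.I ^ 3 = -Complex.I := by rw [pow_succ, h2]; ring
    have h5 : Complex.I ^ 5 = Complex.I := by
      rw [show (5 : ℕ) = 2 + 3 from rfl, pow_add, h2, h3]; ring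
    linear_combination -phase α β τ ξ * H ξ * 8 * Real.pi ^ 3 * α * ξ ^ 3 * h3 - phase α β τ ξ * H ξ * 32 * Real.pi ^ 5 * β * ξ ^ 5 * h5
  rw [key]
  have a := (h3.phase_mul (α := α) (β := β) τ)
  have b := (h5.phase_mul (α := α) (β := β) τ)
  have s3 : IsTest fun ξ => (-α : ℂ) * (phase α β τ ξ * dHat (dHat (dHat H)) ξ) := a.smul contDiff_const
  have s5 : IsTest fun ξ => (β : ℂ) * (phase α β τ ξ * dHat (dHat (dHat (dHat (dHat H)))) ξ) :=
    b.smul contDiff_const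
  have := congrArg (fun f : 𝓢(ℝ, ℂ) => f x)
    ((SchwartzMap.fourierTransformCLM ℂ : 𝓢(ℝ, ℂ) →L[ℂ] 𝓢(ℝ, ℂ)).map_sub ((-α : ℂ) • a.toSchwartz) ((β : ℂ) • b.toSchwartz))
  rw [map_smul, map_smul] at this
  exact this

/-- The symbol is odd, so the phases at `ξ` and `-ξ` cancel in the bilinear pairing, which has no
conjugate. The same flow therefore serves both as linear solution and as adjoint test function. -/
theorem IsTest.integral_flow_mul (hF : IsTest F) (hH : IsTest H) (τ : ℝ) :
    ∫ x, flow α β F τ x * flow α β H τ x = ∫ ξ, F ξ * H (-ξ) := by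
  have h := SchwartzMap.integral_fourier_mul_eq (hF.phase_mul (α := α) (β := β) τ).toSchwartz
    (hH.flowS α β τ)
  refine h.trans (integral_congr_ae (Eventually.of_forall fun ξ => ?_))
  have h2 : 𝓕 (hH.flowS α β τ) ξ = phase α β τ (-ξ) * H (-ξ) := by
    have h3 := SchwartzMap.fourierInv_apply_eq (hH.flowS α β τ)
    have h4 : 𝓕⁻ (hH.flowS α β τ) = (hH.phase_mul (α := α) (β := β) τ).toSchwartz :=
      FourierTransform.fourierInv_fourier_eq _
    have h5 := congrArg (fun f : 𝓢(ℝ, ℂ) => f (-ξ)) (h3.symm.trans h4)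
    simpa using h5
  simp only [IsTest.toSchwartz_apply]
  rw [h2]
  linear_combination F ξ * H (-ξ) * phase_mul_phase_neg α β τ ξ

theorem IsTest.integral_norm_sq_flow (hH : IsTest H) (τ : ℝ) :
    ∫ x, ‖flow α β H τ x‖ ^ 2 = ∫ ξ, ‖H ξ‖ ^ 2 := by
  have h := SchwartzMap.integral_norm_sq_fourier (hH.phase_mul (α := α) (β := β) τ).toSchwartz
  refine h.trans (integral_congr_ae (Eventually.of_forall fun ξ => ?_))
  simp

end

/-! ### Square-integrable calculus, mass conservation and the weak Duhamel formula. -/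

section

section L2

variable {E : Type*} [NormedAddCommGroup E] {f g : ℝ → E}

theorem sq_lpNorm_two (hf : MemLp f 2) : lpNorm f 2 volume ^ 2 = ∫ x, ‖f x‖ ^ 2 := by
  rw [lpNorm_eq_integral_norm_rpow_toReal (by norm_num) (by norm_num) hf.1]
  have h0 : 0 ≤ ∫ x, ‖f x‖ ^ 2 := integral_nonneg fun _ => by positivity
  simp only [ENNReal.toReal_ofNat, Real.rpow_ofNat]
  rw [← Real.rpow_natCast, ← Real.rpow_mul h0]
  norm_num

theorem integral_norm_mul_norm_le {E' : Type*} [NormedAddCommGroup E'] {g : ℝ → E'}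
    (hf : MemLp f 2) (hg : MemLp g 2) :
    ∫ x, ‖f x‖ * ‖g x‖ ≤ lpNorm f 2 volume * lpNorm g 2 volume := by
  have h := integral_mul_le_Lp_mul_Lq_of_nonneg (μ := volume) (f := fun x => ‖f x‖)
    (g := fun x => ‖g x‖) Real.HolderConjugate.two_two
    (Eventually.of_forall fun _ => norm_nonneg _) (Eventually.of_forall fun _ => norm_nonneg _)
    (by simpa using hf.norm) (by simpa using hg.norm)
  refine h.trans_eq ?_
  rw [lpNorm_eq_integral_norm_rpow_toReal (by norm_num) (by norm_num) hf.1,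
    lpNorm_eq_integral_norm_rpow_toReal (by norm_num) (by norm_num) hg.1]
  simp

theorem integrable_norm_mul_norm {E' : Type*} [NormedAddCommGroup E'] {g : ℝ → E'}
    (hf : MemLp f 2) (hg : MemLp g 2) : Integrable fun x => ‖f x‖ * ‖g x‖ :=
  hf.norm.integrable_mul hg.norm

end L2

/-- The one-dimensional Sobolev embedding of `H¹` into the bounded functions. -/
theorem abs_le_lpNorm_add_lpNorm {f f' : ℝ → ℝ} (hd : ∀ x, HasDerivAt f (f' x) x)
    (hf : MemLp f 2) (hf' : MemLp f' 2) (x : ℝ) :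
    |f x| ≤ lpNorm f 2 volume + lpNorm f' 2 volume := by
  have h2 : ∀ y, HasDerivAt (fun y => f y * f y) (f' y * f y + f y * f' y) y :=
    fun y => (hd y).mul (hd y)
  have i1 : Integrable fun y => f y * f y := hf.integrable_mul hf
  have i2 : Integrable fun y => f' y * f y + f y * f' y :=
    (hf'.integrable_mul hf).add (hf.integrable_mul hf')
  -- `f(x)²` is the integral of `(f²)'` over `(-∞, x]`; the boundary term vanishes because `f²` and
  -- its derivative are both integrable.
  have h3 := integral_Iic_of_hasDerivAt_of_tendsto' (a := x) (fun y _ => h2 y) i2.integrableOn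
    (tendsto_zero_of_hasDerivAt_of_integrableOn_Iic (fun y (_ : y ∈ Iic x) => h2 y)
      i2.integrableOn i1.integrableOn)
  have h4 : f x * f x ≤ 2 * (lpNorm f 2 volume * lpNorm f' 2 volume) := by
    have : f x * f x ≤ ∫ y, 2 * (‖f y‖ * ‖f' y‖) := by
      rw [sub_zero] at h3
      rw [← h3]
      refine (Real.le_norm_self _).trans ((norm_integral_le_integral_norm _).trans ?_)
      refine (setIntegral_le_integral i2.norm (Eventually.of_forall fun _ => norm_nonneg _)).trans ?_
      refine integral_mono i2.norm ((integrable_norm_mul_norm hf hf').const_mul 2) fun y => ?_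
      refine (norm_add_le _ _).trans_eq ?_
      simp only [norm_mul]; ring
    rw [integral_const_mul] at this
    linarith [integral_norm_mul_norm_le hf hf']
  have a0 : 0 ≤ lpNorm f 2 volume := lpNorm_nonneg
  have b0 : 0 ≤ lpNorm f' 2 volume := lpNorm_nonneg
  refine abs_le_of_sq_le_sq ?_ (by positivity)
  nlinarith

/-- Integration by parts for square integrable functions. -/
theorem integral_mul_deriv_of_memLp {f f' g g' : ℝ → ℂ} (hf : ∀ x, HasDerivAt f (f' x) x)
    (hg : ∀ x, HasDerivAt g (g' x) x) (mf : MemLp f 2) (mf' : MemLp f' 2) (mg : MemLp g 2)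
    (mg' : MemLp g' 2) : ∫ x, f' x * g x = -∫ x, f x * g' x := by
  rw [integral_mul_deriv_eq_deriv_mul_of_integrable (fun x _ => hf x) (fun x _ => hg x)
    (mf.integrable_mul mg') (mf'.integrable_mul mg) (mf.integrable_mul mg), neg_neg]

theorem integral_mul_deriv_of_memLp_real {f f' g g' : ℝ → ℝ} (hf : ∀ x, HasDerivAt f (f' x) x)
    (hg : ∀ x, HasDerivAt g (g' x) x) (mf : MemLp f 2) (mf' : MemLp f' 2) (mg : MemLp g 2)
    (mg' : MemLp g' 2) : ∫ x, f' x * g x = -∫ x, f x * g' x := by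
  rw [integral_mul_deriv_eq_deriv_mul_of_integrable (fun x _ => hf x) (fun x _ => hg x)
    (mf.integrable_mul mg') (mf'.integrable_mul mg) (mf.integrable_mul mg), neg_neg]

/-- The change in time of a spatial integral is the time integral of the spatial integral of the
time derivative. -/
theorem integral_sub_integral_eq {E : Type*} [NormedAddCommGroup E] [NormedSpace ℝ E]
    [CompleteSpace E] [SecondCountableTopology E]
    {g g' : ℝ → ℝ → E} {t M : ℝ} (ht : 0 ≤ t)
    (hd : ∀ τ ∈ Icc 0 t, ∀ x, HasDerivWithinAt (fun τ => g τ x) (g' τ x) (Icc 0 t) τ)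
    (hc : ∀ x, ContinuousOn (fun τ => g' τ x) (Icc 0 t)) (hm : ∀ τ ∈ Icc 0 t, Continuous (g' τ))
    (hi : ∀ τ ∈ Icc 0 t, Integrable (g' τ)) (hM : ∀ τ ∈ Icc 0 t, ∫ x, ‖g' τ x‖ ≤ M)
    (h0 : Integrable (g 0)) (h1 : Integrable (g t)) :
    IntervalIntegrable (fun τ => ∫ x, g' τ x) volume 0 t ∧
      (∫ x, g t x) - ∫ x, g 0 x = ∫ τ in (0 : ℝ)..t, ∫ x, g' τ x := by
  -- Extending by constants in time outside `[0, t]` makes the integrand continuous in `τ` for every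
  -- `x`. With measurability in `x` this gives the joint measurability that Fubini requires.
  set G : ℝ → ℝ → E := fun τ => g' (projIcc 0 t ht τ) with hG
  have hGg : ∀ τ ∈ Icc 0 t, G τ = g' τ := fun τ hτ => by rw [hG]; simp [projIcc_of_mem ht hτ]
  have hGc : ∀ x, Continuous fun τ => G τ x := fun x =>
    (continuousOn_iff_continuous_domRestrict.1 (hc x)).comp continuous_projIcc
  have hGm : StronglyMeasurable (Function.uncurry G) := by
    have h := stronglyMeasurable_uncurry_of_continuous_of_stronglyMeasurable
      (u := fun (τ x : ℝ) => G τ x) hGc fun τ =>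
        (hm _ (projIcc 0 t ht τ).2).stronglyMeasurable
    exact h
  have hmem : ∀ᵐ τ ∂(volume.restrict (Ioc 0 t)), τ ∈ Icc 0 t :=
    (ae_restrict_mem measurableSet_Ioc).mono fun τ hτ => Ioc_subset_Icc_self hτ
  have hGi : Integrable (Function.uncurry G) ((volume.restrict (Ioc 0 t)).prod volume) := by
    refine (integrable_prod_iff hGm.aestronglyMeasurable).2 ⟨?_, ?_⟩
    · filter_upwards [hmem] with τ hτ
      exact (hi _ (projIcc 0 t ht τ).2)
    · refine Integrable.of_bound (C := M)
        hGm.norm.integral_prod_right.aestronglyMeasurable ?_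
      refine Eventually.of_forall fun τ => ?_
      rw [Real.norm_eq_abs, abs_of_nonneg (integral_nonneg fun _ => norm_nonneg _)]
      exact hM _ (projIcc 0 t ht τ).2
  have hII : IntervalIntegrable (fun τ => ∫ x, G τ x) volume 0 t :=
    (intervalIntegrable_iff_integrableOn_Ioc_of_le ht).2 hGi.integral_prod_left
  refine ⟨hII.congr_uIoo ?_, ?_⟩
  · rw [uIoo_of_le ht]
    intro τ hτ
    simp only
    rw [hGg τ (Ioo_subset_Icc_self hτ)]
  · have e1 : ∀ x, g t x - g 0 x = ∫ τ in Ioc 0 t, G τ x := by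
      intro x
      rw [← intervalIntegral.integral_of_le ht]
      refine (intervalIntegral.integral_eq_sub_of_hasDerivAt_of_le ht
        (f := fun τ => g τ x) (fun τ hτ => (hd τ hτ x).continuousWithinAt) (fun τ hτ => ?_)
        ((hGc x).intervalIntegrable _ _)).symm
      rw [hGg τ (Ioo_subset_Icc_self hτ)]
      exact (hd τ (Ioo_subset_Icc_self hτ) x).hasDerivAt (Icc_mem_nhds hτ.1 hτ.2)
    rw [← integral_sub h1 h0]
    simp_rw [e1]
    rw [integral_integral_swap (f := fun x τ => G τ x) hGi.swap, intervalIntegral.integral_of_le ht]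
    refine setIntegral_congr_fun measurableSet_Ioc fun τ hτ => ?_
    rw [hGg τ (Ioc_subset_Icc_self hτ)]

namespace IsSmoothSolution

variable {α β T : ℝ} {u₀ : ℝ → ℝ} {u : ℝ → ℝ → ℝ}

theorem hasDerivAt (h : IsSmoothSolution α β T u₀ u) {τ : ℝ} (hτ : τ ∈ Icc 0 T) (k : ℕ) (x : ℝ) :
    HasDerivAt (iteratedDeriv k (u τ)) (iteratedDeriv (k + 1) (u τ) x) x := by
  rw [iteratedDeriv_succ]
  exact ((h.smooth τ hτ).differentiable_iteratedDeriv k (by exact_mod_cast WithTop.coe_lt_top _)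
    x).hasDerivAt

theorem continuous_iteratedDeriv (h : IsSmoothSolution α β T u₀ u) {τ : ℝ} (hτ : τ ∈ Icc 0 T)
    (k : ℕ) : Continuous (iteratedDeriv k (u τ)) :=
  continuous_iff_continuousAt.2 fun x => (h.hasDerivAt hτ k x).continuousAt

theorem tendsto_lpNorm (h : IsSmoothSolution α β T u₀ u) {t : ℝ} (ht : t ∈ Icc 0 T) (k : ℕ) :
    Tendsto (fun τ => lpNorm (iteratedDeriv k (u τ) - iteratedDeriv k (u t)) 2 volume)
      (𝓝[Icc 0 T] t) (𝓝 0) := by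
  have h1 := (ENNReal.tendsto_toReal ENNReal.zero_ne_top).comp (h.continuous t ht k)
  refine h1.congr' ?_
  filter_upwards [self_mem_nhdsWithin] with τ hτ
  exact toReal_eLpNorm ((h.memLp τ hτ k).sub (h.memLp t ht k)).1

/-- A continuous function on a compact interval is bounded. The bound depends on the solution, so it
serves only to justify Fubini and integration by parts and never enters the final constants. -/
theorem exists_lpNorm_le (h : IsSmoothSolution α β T u₀ u) (k : ℕ) :
    ∃ M, ∀ τ ∈ Icc 0 T, lpNorm (iteratedDeriv k (u τ)) 2 volume ≤ M := by
  have hc : ContinuousOn (fun τ => lpNorm (iteratedDeriv k (u τ)) 2 volume) (Icc 0 T) := by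
    intro t ht
    refine tendsto_iff_dist_tendsto_zero.2 ?_
    refine squeeze_zero' (Eventually.of_forall fun _ => dist_nonneg) ?_ (h.tendsto_lpNorm ht k)
    filter_upwards [self_mem_nhdsWithin] with τ hτ
    rw [Real.dist_eq, abs_sub_le_iff]
    have a := lpNorm_le_lpNorm_add_lpNorm_sub' (f := iteratedDeriv k (u τ))
      (h.memLp t ht k) one_le_two
    have b := lpNorm_le_lpNorm_add_lpNorm_sub (f := iteratedDeriv k (u t))
      (h.memLp τ hτ k) one_le_two
    constructor <;> linarith
  obtain ⟨M, hM⟩ := isCompact_Icc.exists_bound_of_continuousOn hc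
  exact ⟨M, fun τ hτ => (le_abs_self _).trans (hM τ hτ)⟩

theorem exists_abs_le (h : IsSmoothSolution α β T u₀ u) (k : ℕ) :
    ∃ M, ∀ τ ∈ Icc 0 T, ∀ x, |iteratedDeriv k (u τ) x| ≤ M := by
  obtain ⟨M, hM⟩ := h.exists_lpNorm_le k
  obtain ⟨M', hM'⟩ := h.exists_lpNorm_le (k + 1)
  exact ⟨M + M', fun τ hτ x => (abs_le_lpNorm_add_lpNorm (h.hasDerivAt hτ k) (h.memLp τ hτ k)
    (h.memLp τ hτ (k + 1)) x).trans (add_le_add (hM τ hτ) (hM' τ hτ))⟩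

theorem continuousOn_iteratedDeriv (h : IsSmoothSolution α β T u₀ u) (k : ℕ) (x : ℝ) :
    ContinuousOn (fun τ => iteratedDeriv k (u τ) x) (Icc 0 T) := by
  intro t ht
  refine tendsto_iff_dist_tendsto_zero.2 ?_
  refine squeeze_zero' (Eventually.of_forall fun _ => dist_nonneg) ?_
    (by simpa using (h.tendsto_lpNorm ht k).add (h.tendsto_lpNorm ht (k + 1)))
  filter_upwards [self_mem_nhdsWithin] with τ hτ
  exact abs_le_lpNorm_add_lpNorm (fun y => (h.hasDerivAt hτ k y).sub (h.hasDerivAt ht k y))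
    ((h.memLp τ hτ k).sub (h.memLp t ht k)) ((h.memLp τ hτ (k + 1)).sub (h.memLp t ht (k + 1))) x

theorem hasDerivWithinAt_time (h : IsSmoothSolution α β T u₀ u) {t : ℝ} (ht : t ∈ Icc 0 T) (x : ℝ) :
    HasDerivWithinAt (fun τ => iteratedDeriv 0 (u τ) x)
      (-(α * iteratedDeriv 3 (u t) x + β * iteratedDeriv 5 (u t) x +
        iteratedDeriv 0 (u t) x * iteratedDeriv 1 (u t) x)) (Icc 0 T) t := by
  simpa only [iteratedDeriv_zero, iteratedDeriv_one] using h.equation t ht x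

theorem memLp_mul (h : IsSmoothSolution α β T u₀ u) {τ : ℝ} (hτ : τ ∈ Icc 0 T) (j k : ℕ) :
    MemLp (fun x => iteratedDeriv j (u τ) x * iteratedDeriv k (u τ) x) 2 := by
  obtain ⟨M, hM⟩ := h.exists_abs_le j
  refine ((h.memLp τ hτ k).const_mul M).mono
    ((h.continuous_iteratedDeriv hτ j).mul (h.continuous_iteratedDeriv hτ k)).aestronglyMeasurable
    (Eventually.of_forall fun x => ?_)
  simp only [norm_mul, Real.norm_eq_abs]
  exact mul_le_mul_of_nonneg_right ((hM τ hτ x).trans (le_abs_self _)) (abs_nonneg _)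

/-- The time derivative of a solution is bounded in `L²`. -/
theorem exists_timeDeriv_le (h : IsSmoothSolution α β T u₀ u) :
    ∃ M, ∀ τ ∈ Icc 0 T, MemLp (fun x => -(α * iteratedDeriv 3 (u τ) x +
        β * iteratedDeriv 5 (u τ) x + iteratedDeriv 0 (u τ) x * iteratedDeriv 1 (u τ) x)) 2 ∧
      lpNorm (fun x => -(α * iteratedDeriv 3 (u τ) x + β * iteratedDeriv 5 (u τ) x +
        iteratedDeriv 0 (u τ) x * iteratedDeriv 1 (u τ) x)) 2 volume ≤ M := by
  obtain ⟨M, hM⟩ := h.exists_abs_le 0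
  obtain ⟨M1, hM1⟩ := h.exists_lpNorm_le 1
  obtain ⟨M3, hM3⟩ := h.exists_lpNorm_le 3
  obtain ⟨M5, hM5⟩ := h.exists_lpNorm_le 5
  refine ⟨|α| * M3 + |β| * M5 + |M| * M1, fun τ hτ => ?_⟩
  have m3 := (h.memLp τ hτ 3).const_mul α
  have m5 := (h.memLp τ hτ 5).const_mul β
  have m1 := h.memLp_mul hτ 0 1
  refine ⟨((m3.add m5).add m1).neg, ?_⟩
  have e : lpNorm (fun x => -(α * iteratedDeriv 3 (u τ) x + β * iteratedDeriv 5 (u τ) x +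
      iteratedDeriv 0 (u τ) x * iteratedDeriv 1 (u τ) x)) 2 volume =
      lpNorm ((fun x => α * iteratedDeriv 3 (u τ) x) + (fun x => β * iteratedDeriv 5 (u τ) x) +
        fun x => iteratedDeriv 0 (u τ) x * iteratedDeriv 1 (u τ) x) 2 volume :=
    lpNorm_fun_neg _ _ _
  rw [e]
  refine (lpNorm_add_le (m3.add m5) one_le_two).trans (add_le_add
    ((lpNorm_add_le m3 one_le_two).trans (add_le_add ?_ ?_)) ?_)
  · have := lpNorm_const_smul (p := 2) α (iteratedDeriv 3 (u τ)) (volume : Measure ℝ)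
    refine this.trans_le ?_
    rw [coe_nnnorm, Real.norm_eq_abs]
    exact mul_le_mul_of_nonneg_left (hM3 τ hτ) (abs_nonneg _)
  · have := lpNorm_const_smul (p := 2) β (iteratedDeriv 5 (u τ)) (volume : Measure ℝ)
    refine this.trans_le ?_
    rw [coe_nnnorm, Real.norm_eq_abs]
    exact mul_le_mul_of_nonneg_left (hM5 τ hτ) (abs_nonneg _)
  · have h1 : lpNorm (fun x => iteratedDeriv 0 (u τ) x * iteratedDeriv 1 (u τ) x) 2 volume ≤
        lpNorm (fun x => |M| * ‖iteratedDeriv 1 (u τ) x‖) 2 volume := by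
      refine lpNorm_mono_real ((h.memLp τ hτ 1).norm.const_mul _) fun x => ?_
      rw [norm_mul, Real.norm_eq_abs]
      exact mul_le_mul_of_nonneg_right ((hM τ hτ x).trans (le_abs_self _)) (norm_nonneg _)
    refine h1.trans ?_
    have := lpNorm_const_smul (p := 2) |M| (fun x => ‖iteratedDeriv 1 (u τ) x‖)
      (volume : Measure ℝ)
    refine this.trans_le ?_
    rw [coe_nnnorm, Real.norm_eq_abs, abs_abs]
    refine mul_le_mul_of_nonneg_left ?_ (abs_nonneg _)
    have h2 := lpNorm_norm (h.memLp τ hτ 1).1 2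
    exact h2.trans_le (hM1 τ hτ)

theorem continuousOn_timeDeriv (h : IsSmoothSolution α β T u₀ u) (x : ℝ) :
    ContinuousOn (fun τ => -(α * iteratedDeriv 3 (u τ) x +
        β * iteratedDeriv 5 (u τ) x + iteratedDeriv 0 (u τ) x * iteratedDeriv 1 (u τ) x))
      (Icc 0 T) :=
  (((continuousOn_const.mul (h.continuousOn_iteratedDeriv 3 x)).add
    (continuousOn_const.mul (h.continuousOn_iteratedDeriv 5 x))).add
    ((h.continuousOn_iteratedDeriv 0 x).mul (h.continuousOn_iteratedDeriv 1 x))).neg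

theorem continuous_timeDeriv (h : IsSmoothSolution α β T u₀ u) {τ : ℝ} (hτ : τ ∈ Icc 0 T) :
    Continuous fun x => -(α * iteratedDeriv 3 (u τ) x +
        β * iteratedDeriv 5 (u τ) x + iteratedDeriv 0 (u τ) x * iteratedDeriv 1 (u τ) x) :=
  (((continuous_const.mul (h.continuous_iteratedDeriv hτ 3)).add
    (continuous_const.mul (h.continuous_iteratedDeriv hτ 5))).add
    ((h.continuous_iteratedDeriv hτ 0).mul (h.continuous_iteratedDeriv hτ 1))).neg

/-- Derivatives of odd order are skew-adjoint, and `u · u u_x` is the derivative of `u³/3`. -/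
theorem integral_mul_timeDeriv (h : IsSmoothSolution α β T u₀ u) {τ : ℝ} (hτ : τ ∈ Icc 0 T) :
    ∫ x, iteratedDeriv 0 (u τ) x * -(α * iteratedDeriv 3 (u τ) x +
        β * iteratedDeriv 5 (u τ) x + iteratedDeriv 0 (u τ) x * iteratedDeriv 1 (u τ) x) = 0 := by
  have ibp : ∀ j k, ∫ x, iteratedDeriv (j + 1) (u τ) x * iteratedDeriv k (u τ) x =
      -∫ x, iteratedDeriv j (u τ) x * iteratedDeriv (k + 1) (u τ) x := fun j k =>
    integral_mul_deriv_of_memLp_real (h.hasDerivAt hτ j) (h.hasDerivAt hτ k) (h.memLp τ hτ j)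
      (h.memLp τ hτ (j + 1)) (h.memLp τ hτ k) (h.memLp τ hτ (k + 1))
  have comm : ∀ j k, ∫ x, iteratedDeriv j (u τ) x * iteratedDeriv k (u τ) x =
      ∫ x, iteratedDeriv k (u τ) x * iteratedDeriv j (u τ) x := fun j k =>
    integral_congr_ae (Eventually.of_forall fun x => mul_comm _ _)
  have e3 : ∫ x, iteratedDeriv 0 (u τ) x * iteratedDeriv 3 (u τ) x = 0 := by
    linarith [ibp 0 2, ibp 1 1, comm 1 2]
  have e5 : ∫ x, iteratedDeriv 0 (u τ) x * iteratedDeriv 5 (u τ) x = 0 := by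
    linarith [ibp 0 4, ibp 1 3, ibp 2 2, comm 2 3]
  have i3 : Integrable fun x => iteratedDeriv 0 (u τ) x * iteratedDeriv 3 (u τ) x :=
    (h.memLp τ hτ 0).integrable_mul (h.memLp τ hτ 3)
  have i5 : Integrable fun x => iteratedDeriv 0 (u τ) x * iteratedDeriv 5 (u τ) x :=
    (h.memLp τ hτ 0).integrable_mul (h.memLp τ hτ 5)
  have i1 : Integrable fun x => iteratedDeriv 0 (u τ) x *
      (iteratedDeriv 0 (u τ) x * iteratedDeriv 1 (u τ) x) :=
    (h.memLp τ hτ 0).integrable_mul (h.memLp_mul hτ 0 1)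
  have ic : Integrable fun x => iteratedDeriv 0 (u τ) x *
      (iteratedDeriv 0 (u τ) x * iteratedDeriv 0 (u τ) x) :=
    (h.memLp τ hτ 0).integrable_mul (h.memLp_mul hτ 0 0)
  have e1 : ∫ x, 3 * (iteratedDeriv 0 (u τ) x *
      (iteratedDeriv 0 (u τ) x * iteratedDeriv 1 (u τ) x)) = 0 := by
    refine integral_eq_zero_of_hasDerivAt_of_integrable (f := fun x => iteratedDeriv 0 (u τ) x *
      (iteratedDeriv 0 (u τ) x * iteratedDeriv 0 (u τ) x)) (fun x => ?_) (i1.const_mul 3) ic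
    have d := h.hasDerivAt hτ 0 x
    exact (d.fun_mul (d.fun_mul d)).congr_deriv (by ring)
  rw [integral_const_mul] at e1
  have e : (fun x => iteratedDeriv 0 (u τ) x * -(α * iteratedDeriv 3 (u τ) x +
        β * iteratedDeriv 5 (u τ) x + iteratedDeriv 0 (u τ) x * iteratedDeriv 1 (u τ) x)) =
      fun x => (-α * (iteratedDeriv 0 (u τ) x * iteratedDeriv 3 (u τ) x) +
        -β * (iteratedDeriv 0 (u τ) x * iteratedDeriv 5 (u τ) x)) + -1 * (iteratedDeriv 0 (u τ) x *
      (iteratedDeriv 0 (u τ) x * iteratedDeriv 1 (u τ) x)) := by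
    ext x; ring
  have j3 := i3.const_mul (-α)
  have j5 := i5.const_mul (-β)
  have j35 : Integrable fun x => -α * (iteratedDeriv 0 (u τ) x * iteratedDeriv 3 (u τ) x) +
      -β * (iteratedDeriv 0 (u τ) x * iteratedDeriv 5 (u τ) x) := j3.add j5
  rw [e, integral_add j35 (i1.const_mul _), integral_add j3 j5, integral_const_mul, integral_const_mul,
    integral_const_mul, e3, e5]
  linarith

/-- Conservation of the `L²` norm. -/
theorem integral_sq_eq (h : IsSmoothSolution α β T u₀ u) {t : ℝ} (ht : t ∈ Icc 0 T) :
    ∫ x, u t x ^ 2 = ∫ x, u₀ x ^ 2 := by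
  obtain ⟨M, hM⟩ := h.exists_lpNorm_le 0
  obtain ⟨M', hM'⟩ := h.exists_timeDeriv_le
  have hsub : Icc 0 t ⊆ Icc 0 T := Icc_subset_Icc_right ht.2
  have hint : ∀ τ ∈ Icc 0 T, Integrable fun x => iteratedDeriv 0 (u τ) x * iteratedDeriv 0 (u τ) x :=
    fun τ hτ => (h.memLp τ hτ 0).integrable_mul (h.memLp τ hτ 0)
  have key := integral_sub_integral_eq (t := t) (M := 2 * (M * M'))
    (g := fun τ x => iteratedDeriv 0 (u τ) x * iteratedDeriv 0 (u τ) x)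
    (g' := fun τ x => 2 * (iteratedDeriv 0 (u τ) x * -(α * iteratedDeriv 3 (u τ) x +
        β * iteratedDeriv 5 (u τ) x + iteratedDeriv 0 (u τ) x * iteratedDeriv 1 (u τ) x)))
    ht.1 (fun τ hτ x => ?_) (fun x => ?_) (fun τ hτ => ?_) (fun τ hτ => ?_) (fun τ hτ => ?_)
    (hint 0 ⟨le_rfl, ht.1.trans ht.2⟩) (hint t ht)
  · have h2 : ∫ τ in (0 : ℝ)..t, ∫ x, 2 * (iteratedDeriv 0 (u τ) x *
        -(α * iteratedDeriv 3 (u τ) x + β * iteratedDeriv 5 (u τ) x +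
          iteratedDeriv 0 (u τ) x * iteratedDeriv 1 (u τ) x)) = ∫ τ in (0 : ℝ)..t, (0 : ℝ) := by
      refine intervalIntegral.integral_congr fun τ hτ => ?_
      rw [uIcc_of_le ht.1] at hτ
      rw [integral_const_mul, h.integral_mul_timeDeriv (hsub hτ), mul_zero]
    rw [h2, intervalIntegral.integral_zero, sub_eq_zero] at key
    simpa only [iteratedDeriv_zero, ← pow_two, h.initial] using key.2
  · have d := (h.hasDerivWithinAt_time (hsub hτ) x).mono hsub
    exact (d.fun_mul d).congr_deriv (by ring)
  · exact ((continuousOn_const.mul ((h.continuousOn_iteratedDeriv 0 x).mul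
      (h.continuousOn_timeDeriv x))).mono hsub)
  · exact continuous_const.mul ((h.continuous_iteratedDeriv (hsub hτ) 0).mul
      (h.continuous_timeDeriv (hsub hτ)))
  · exact ((h.memLp τ (hsub hτ) 0).integrable_mul (hM' τ (hsub hτ)).1).const_mul 2
  · have b := integral_norm_mul_norm_le (h.memLp τ (hsub hτ) 0) (hM' τ (hsub hτ)).1
    have e : ∀ x, ‖2 * (iteratedDeriv 0 (u τ) x * -(α * iteratedDeriv 3 (u τ) x +
        β * iteratedDeriv 5 (u τ) x + iteratedDeriv 0 (u τ) x * iteratedDeriv 1 (u τ) x))‖ =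
        2 * (‖iteratedDeriv 0 (u τ) x‖ * ‖-(α * iteratedDeriv 3 (u τ) x +
        β * iteratedDeriv 5 (u τ) x + iteratedDeriv 0 (u τ) x * iteratedDeriv 1 (u τ) x)‖) :=
      fun x => by rw [norm_mul, norm_mul, Real.norm_ofNat]
    simp_rw [e]
    rw [integral_const_mul]
    have := mul_le_mul (hM τ (hsub hτ)) (hM' τ (hsub hτ)).2 lpNorm_nonneg
      (lpNorm_nonneg.trans (hM τ (hsub hτ)))
    linarith

/-- The test function solves the linear equation and the third and fifth derivatives are skew for
the bilinear pairing, so all linear terms cancel. What survives is `u u_x = (u²)_x / 2`, with its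
derivative moved onto the test function; the solution then enters only through `u²`. -/
theorem integral_mul_flow_deriv (h : IsSmoothSolution α β T u₀ u) {H : ℝ → ℂ} (hH : IsTest H)
    {τ : ℝ} (hτ : τ ∈ Icc 0 T) :
    ∫ x, (((-(α * iteratedDeriv 3 (u τ) x + β * iteratedDeriv 5 (u τ) x +
        iteratedDeriv 0 (u τ) x * iteratedDeriv 1 (u τ) x) : ℝ) : ℂ) * flow α β H τ x +
      ((iteratedDeriv 0 (u τ) x : ℝ) : ℂ) *
        flow α β (fun ξ => Complex.I * symbol α β ξ * H ξ) τ x) =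
      (1 / 2) * ∫ x, (u τ x : ℂ) ^ 2 * flow α β (dHat H) τ x := by
  have cd : ∀ k x, HasDerivAt (fun x => ((iteratedDeriv k (u τ) x : ℝ) : ℂ))
      ((iteratedDeriv (k + 1) (u τ) x : ℝ) : ℂ) x := fun k x => (h.hasDerivAt hτ k x).ofReal_comp
  have cm : ∀ k, MemLp (fun x => ((iteratedDeriv k (u τ) x : ℝ) : ℂ)) 2 := fun k =>
    (h.memLp τ hτ k).ofReal
  have ibp : ∀ j {K : ℝ → ℂ}, IsTest K →
      ∫ x, ((iteratedDeriv (j + 1) (u τ) x : ℝ) : ℂ) * flow α β K τ x =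
      -∫ x, ((iteratedDeriv j (u τ) x : ℝ) : ℂ) * flow α β (dHat K) τ x := fun j K hK =>
    integral_mul_deriv_of_memLp (cd j) (hK.hasDerivAt_flow_space τ) (cm j) (cm (j + 1))
      (hK.memLp_flow τ) (hK.dx.memLp_flow τ)
  have int : ∀ j {K : ℝ → ℂ}, IsTest K →
      Integrable fun x => ((iteratedDeriv j (u τ) x : ℝ) : ℂ) * flow α β K τ x := fun j K hK =>
    (cm j).integrable_mul (hK.memLp_flow τ)
  have e3 : ∫ x, ((iteratedDeriv 3 (u τ) x : ℝ) : ℂ) * flow α β H τ x =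
      -∫ x, ((iteratedDeriv 0 (u τ) x : ℝ) : ℂ) * flow α β (dHat (dHat (dHat H))) τ x := by
    rw [ibp 2 hH, ibp 1 hH.dx, ibp 0 hH.dx.dx, neg_neg]
  have e5 : ∫ x, ((iteratedDeriv 5 (u τ) x : ℝ) : ℂ) * flow α β H τ x =
      -∫ x, ((iteratedDeriv 0 (u τ) x : ℝ) : ℂ) *
        flow α β (dHat (dHat (dHat (dHat (dHat H))))) τ x := by
    rw [ibp 4 hH, ibp 3 hH.dx, ibp 2 hH.dx.dx, ibp 1 hH.dx.dx.dx, ibp 0 hH.dx.dx.dx.dx,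
      neg_neg, neg_neg]
  have m1 : MemLp (fun x => ((iteratedDeriv 0 (u τ) x * iteratedDeriv 1 (u τ) x : ℝ) : ℂ)) 2 :=
    (h.memLp_mul hτ 0 1).ofReal
  have m0 : MemLp (fun x => ((iteratedDeriv 0 (u τ) x * iteratedDeriv 0 (u τ) x : ℝ) : ℂ)) 2 :=
    (h.memLp_mul hτ 0 0).ofReal
  have m1' : MemLp (fun x => ((2 * (iteratedDeriv 0 (u τ) x * iteratedDeriv 1 (u τ) x) : ℝ) : ℂ))
    2 := ((h.memLp_mul hτ 0 1).const_mul 2).ofReal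
  have e1 : ∫ x, ((2 * (iteratedDeriv 0 (u τ) x * iteratedDeriv 1 (u τ) x) : ℝ) : ℂ) *
      flow α β H τ x = -∫ x, (u τ x : ℂ) ^ 2 * flow α β (dHat H) τ x := by
    rw [integral_mul_deriv_of_memLp (f := fun x =>
      ((iteratedDeriv 0 (u τ) x * iteratedDeriv 0 (u τ) x : ℝ) : ℂ)) (fun x => ?_)
      (hH.hasDerivAt_flow_space τ) m0 m1' (hH.memLp_flow τ) (hH.dx.memLp_flow τ)]
    · simp only [iteratedDeriv_zero, pow_two, Complex.ofReal_mul]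
    · have d := h.hasDerivAt hτ 0 x
      exact (HasDerivAt.ofReal_comp ((d.fun_mul d).congr_deriv (by ring)))
  have key : (fun x => (((-(α * iteratedDeriv 3 (u τ) x + β * iteratedDeriv 5 (u τ) x +
        iteratedDeriv 0 (u τ) x * iteratedDeriv 1 (u τ) x) : ℝ) : ℂ) * flow α β H τ x +
      ((iteratedDeriv 0 (u τ) x : ℝ) : ℂ) *
        flow α β (fun ξ => Complex.I * symbol α β ξ * H ξ) τ x)) = fun x =>
      ((-α * (((iteratedDeriv 3 (u τ) x : ℝ) : ℂ) * flow α β H τ x) +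
      -β * (((iteratedDeriv 5 (u τ) x : ℝ) : ℂ) * flow α β H τ x)) +
      (-α * (((iteratedDeriv 0 (u τ) x : ℝ) : ℂ) * flow α β (dHat (dHat (dHat H))) τ x) +
      -β * (((iteratedDeriv 0 (u τ) x : ℝ) : ℂ) * flow α β (dHat (dHat (dHat (dHat (dHat H))))) τ x))) +
      (-1 / 2 : ℂ) * (((2 * (iteratedDeriv 0 (u τ) x * iteratedDeriv 1 (u τ) x) : ℝ) : ℂ) *
      flow α β H τ x) := by
    ext x
    rw [hH.flow_symbol]
    push_cast
    ring
  have i3 := (int 3 hH).const_mul (-α : ℂ)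
  have i5 := (int 5 hH).const_mul (-β : ℂ)
  have i3' := (int 0 hH.dx.dx.dx).const_mul (-α : ℂ)
  have i5' := (int 0 hH.dx.dx.dx.dx.dx).const_mul (-β : ℂ)
  have i1 := (m1'.integrable_mul (hH.memLp_flow τ (α := α) (β := β))).const_mul (-1 / 2 : ℂ)
  simp only [Pi.mul_apply] at i1
  have i35 := i3.add i5
  have i35' := i3'.add i5'
  have i := i35.add i35'
  simp only [Pi.add_def] at i35 i35' i
  rw [key, integral_add i i1, integral_add i35 i35', integral_add i3 i5, integral_add i3' i5',
    integral_const_mul, integral_const_mul, integral_const_mul, integral_const_mul,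
    integral_const_mul, e1, e3, e5]
  ring

theorem lpNorm_flow_le {H : ℝ → ℂ} (hH : IsTest H) (τ : ℝ) :
    lpNorm (flow α β H τ) 2 volume ≤ Real.sqrt (∫ ξ, ‖H ξ‖ ^ 2) := by
  refine Real.le_sqrt_of_sq_le ?_
  rw [sq_lpNorm_two (hH.memLp_flow τ), hH.integral_norm_sq_flow]

/-- Duhamel's formula in weak form. -/
theorem integral_mul_flow (h : IsSmoothSolution α β T u₀ u) {H : ℝ → ℂ} (hH : IsTest H)
    {t : ℝ} (ht : t ∈ Icc 0 T) :
    IntervalIntegrable (fun τ => ∫ x, (u τ x : ℂ) ^ 2 * flow α β (dHat H) τ x) volume 0 t ∧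
    (∫ x, (u t x : ℂ) * flow α β H t x) - ∫ x, (u₀ x : ℂ) * flow α β H 0 x =
      (1 / 2) * ∫ τ in (0 : ℝ)..t, ∫ x, (u τ x : ℂ) ^ 2 * flow α β (dHat H) τ x := by
  obtain ⟨M, hM⟩ := h.exists_lpNorm_le 0
  obtain ⟨M', hM'⟩ := h.exists_timeDeriv_le
  have hsub : Icc 0 t ⊆ Icc 0 T := Icc_subset_Icc_right ht.2
  have hs := hH.symbol_mul (α := α) (β := β)
  have cm : ∀ τ ∈ Icc 0 T, MemLp (fun x => ((iteratedDeriv 0 (u τ) x : ℝ) : ℂ)) 2 := fun τ hτ =>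
    (h.memLp τ hτ 0).ofReal
  have hint : ∀ τ ∈ Icc 0 T, Integrable fun x => ((iteratedDeriv 0 (u τ) x : ℝ) : ℂ) * flow α β H τ x :=
    fun τ hτ => (cm τ hτ).integrable_mul (hH.memLp_flow τ)
  have key := integral_sub_integral_eq (t := t)
    (M := M' * Real.sqrt (∫ ξ, ‖H ξ‖ ^ 2) +
      M * Real.sqrt (∫ ξ, ‖Complex.I * symbol α β ξ * H ξ‖ ^ 2))
    (g := fun τ x => ((iteratedDeriv 0 (u τ) x : ℝ) : ℂ) * flow α β H τ x)
    (g' := fun τ x => (((-(α * iteratedDeriv 3 (u τ) x + β * iteratedDeriv 5 (u τ) x +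
        iteratedDeriv 0 (u τ) x * iteratedDeriv 1 (u τ) x) : ℝ) : ℂ) * flow α β H τ x +
      ((iteratedDeriv 0 (u τ) x : ℝ) : ℂ) *
        flow α β (fun ξ => Complex.I * symbol α β ξ * H ξ) τ x))
    ht.1 (fun τ hτ x => ?_) (fun x => ?_) (fun τ hτ => ?_) (fun τ hτ => ?_) (fun τ hτ => ?_)
    (hint 0 ⟨le_rfl, ht.1.trans ht.2⟩) (hint t ht)
  · have h2 : ∀ τ ∈ Icc 0 t, _ := fun τ hτ => h.integral_mul_flow_deriv hH (hsub hτ)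
    refine ⟨?_, ?_⟩
    · refine (key.1.const_mul (2 : ℂ)).congr_uIoo ?_
      rw [uIoo_of_le ht.1]
      intro τ hτ
      simp only
      rw [h2 τ (Ioo_subset_Icc_self hτ)]
      ring
    · rw [← intervalIntegral.integral_const_mul]
      rw [intervalIntegral.integral_congr (g := fun τ =>
        (1 / 2) * ∫ x, (u τ x : ℂ) ^ 2 * flow α β (dHat H) τ x) (fun τ hτ => ?_)] at key
      · simpa only [iteratedDeriv_zero, h.initial] using key.2
      · rw [uIcc_of_le ht.1] at hτ
        exact h2 τ hτ
  · have d := (h.hasDerivWithinAt_time (hsub hτ) x).mono hsub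
    exact (d.ofReal_comp.fun_mul (hH.hasDerivAt_flow_time τ x).hasDerivWithinAt)
  · exact ((Complex.continuous_ofReal.comp_continuousOn ((h.continuousOn_timeDeriv x).mono hsub)).mul
      (hH.continuous_flow_time x).continuousOn).add ((Complex.continuous_ofReal.comp_continuousOn
      ((h.continuousOn_iteratedDeriv 0 x).mono hsub)).mul (hs.continuous_flow_time x).continuousOn)
  · exact ((Complex.continuous_ofReal.comp (h.continuous_timeDeriv (hsub hτ))).mul
      (hH.continuous_flow τ)).add ((Complex.continuous_ofReal.comp
      (h.continuous_iteratedDeriv (hsub hτ) 0)).mul (hs.continuous_flow τ))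
  · exact ((hM' τ (hsub hτ)).1.ofReal.integrable_mul (hH.memLp_flow τ)).add
      ((cm τ (hsub hτ)).integrable_mul (hs.memLp_flow τ))
  · have b1 := integral_norm_mul_norm_le (hM' τ (hsub hτ)).1 (hH.memLp_flow τ (α := α) (β := β))
    have b2 := integral_norm_mul_norm_le (h.memLp τ (hsub hτ) 0)
      (hs.memLp_flow τ (α := α) (β := β))
    have i1 := integrable_norm_mul_norm (hM' τ (hsub hτ)).1 (hH.memLp_flow τ (α := α) (β := β))
    have i2 := integrable_norm_mul_norm (h.memLp τ (hsub hτ) 0)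
      (hs.memLp_flow τ (α := α) (β := β))
    have c1 := mul_le_mul (hM' τ (hsub hτ)).2 (lpNorm_flow_le hH τ (α := α) (β := β))
      lpNorm_nonneg (lpNorm_nonneg.trans (hM' τ (hsub hτ)).2)
    have c2 := mul_le_mul (hM τ (hsub hτ)) (lpNorm_flow_le hs τ (α := α) (β := β))
      lpNorm_nonneg (lpNorm_nonneg.trans (hM τ (hsub hτ)))
    refine le_trans ?_ (add_le_add (b1.trans c1) (b2.trans c2))
    rw [← integral_add i1 i2]
    refine integral_mono_of_nonneg (Eventually.of_forall fun _ => norm_nonneg _) (i1.add i2)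
      (Eventually.of_forall fun x => (norm_add_le _ _).trans_eq ?_)
    simp only [norm_mul, Complex.norm_real]

end IsSmoothSolution

end

/-! ### The remainder after subtracting the linear evolution. -/

section

theorem norm_integral_mul_le {f g : ℝ → ℂ} {K : ℝ} (hf : Integrable f) (hg : ∀ x, ‖g x‖ ≤ K) :
    ‖∫ x, f x * g x‖ ≤ (∫ x, ‖f x‖) * K := by
  rw [← integral_mul_const]
  refine norm_integral_le_of_norm_le (hf.norm.mul_const K) (Eventually.of_forall fun x => ?_)
  rw [norm_mul]
  exact mul_le_mul_of_nonneg_left (hg x) (norm_nonneg _)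

variable {α β : ℝ} {F H : ℝ → ℂ}

/-- Functions whose Fourier transform is real. -/
def IsHermitian (F : ℝ → ℂ) : Prop := ∀ ξ, F (-ξ) = starRingEnd ℂ (F ξ)

theorem IsHermitian.conj_flow (hF : IsHermitian F) (τ x : ℝ) :
    starRingEnd ℂ (flow α β F τ x) = flow α β F τ x := by
  rw [flow_eq_integral, ← integral_conj,
    ← integral_neg_eq_self (fun ξ : ℝ => Complex.exp ((-2 * Real.pi * ξ * x : ℝ) * Complex.I) *
      (phase α β τ ξ * F ξ)) volume]
  refine integral_congr_ae (Eventually.of_forall fun ξ => ?_)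
  simp only [map_mul, phase, ← Complex.exp_conj, Complex.conj_ofReal, Complex.conj_I, hF ξ,
    symbol_neg]
  congr 2
  · push_cast; ring_nf
  · push_cast; ring_nf

theorem IsHermitian.flow_eq_re (hF : IsHermitian F) (τ x : ℝ) :
    flow α β F τ x = ((flow α β F τ x).re : ℂ) :=
  (Complex.conj_eq_iff_re.1 (hF.conj_flow τ x)).symm

theorem IsTest.integrable_flow_mul (hF : IsTest F) (hH : IsTest H) (τ σ : ℝ) :
    Integrable fun x => flow α β F τ x * flow α β H σ x :=
  (hF.memLp_flow τ).integrable_mul (hH.memLp_flow σ)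

theorem IsTest.integrable_mul_flow (hF : IsTest F) {f : ℝ → ℂ} (hf : Integrable f) (τ : ℝ) :
    Integrable fun x => f x * flow α β F τ x :=
  hf.mul_bdd (c := ∫ ξ, ‖F ξ‖) (hF.continuous_flow τ).aestronglyMeasurable
    (Eventually.of_forall fun x => norm_flow_le F τ x)

/-- The integrand is a third of the derivative of the cube. This cancellation removes the leading
term of the energy identity and improves the remainder bound from `ε³` to `ε^{7/2}`. -/
theorem IsTest.integral_sq_mul_flow_dHat (hF : IsTest F) (τ : ℝ) :
    ∫ x, flow α β F τ x ^ 2 * flow α β (dHat F) τ x = 0 := by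
  have h : ∫ x, 3 * (flow α β F τ x ^ 2 * flow α β (dHat F) τ x) = 0 := by
    refine integral_eq_zero_of_hasDerivAt_of_integrable (f := fun x => flow α β F τ x ^ 3)
      (fun x => ?_) ?_ ?_
    · exact ((hF.hasDerivAt_flow_space τ x).fun_pow 3).congr_deriv (by push_cast; ring)
    · refine (hF.dx.integrable_mul_flow ?_ τ).const_mul 3
      simpa only [pow_two] using hF.integrable_flow_mul hF τ τ
    · have := hF.integrable_mul_flow (α := α) (β := β) (hF.integrable_flow_mul (α := α) (β := β) hF τ τ) τ
      refine this.congr (Eventually.of_forall fun x => ?_)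
      simp only; ring
  rw [integral_const_mul] at h
  simpa using h

/-- The difference between a solution and the linear evolution of its initial value. -/
def remainder (α β ε : ℝ) (F : ℝ → ℂ) (u : ℝ → ℝ → ℝ) (τ x : ℝ) : ℂ :=
  (u τ x : ℂ) - ε * flow α β F τ x

/-- A solution with initial value `ε` times the Fourier transform of `F`. -/
def IsSolutionFrom (α β T ε : ℝ) (F : ℝ → ℂ) (u : ℝ → ℝ → ℝ) : Prop :=
  IsSmoothSolution α β T (fun x => ε * (flow α β F 0 x).re) u

namespace IsSolutionFrom

variable {T ε : ℝ} {u : ℝ → ℝ → ℝ}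

theorem memLp_ofReal (h : IsSolutionFrom α β T ε F u) {τ : ℝ} (hτ : τ ∈ Icc 0 T) :
    MemLp (fun x => (u τ x : ℂ)) 2 := by
  have : MemLp (fun x => ((iteratedDeriv 0 (u τ) x : ℝ) : ℂ)) 2 := (h.memLp τ hτ 0).ofReal
  simpa only [iteratedDeriv_zero] using this

theorem memLp_remainder (h : IsSolutionFrom α β T ε F u) (hF : IsTest F) {τ : ℝ}
    (hτ : τ ∈ Icc 0 T) : MemLp (remainder α β ε F u τ) 2 :=
  (h.memLp_ofReal hτ).sub ((hF.memLp_flow τ).const_mul _)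

theorem integrable_sq (h : IsSolutionFrom α β T ε F u) {τ : ℝ} (hτ : τ ∈ Icc 0 T) :
    Integrable fun x => (u τ x : ℂ) ^ 2 := by
  have : Integrable fun x => (u τ x : ℂ) * (u τ x : ℂ) :=
    (h.memLp_ofReal hτ).integrable_mul (h.memLp_ofReal hτ)
  simpa only [pow_two] using this

theorem conj_remainder (hF : IsHermitian F) (τ x : ℝ) :
    starRingEnd ℂ (remainder α β ε F u τ x) = remainder α β ε F u τ x := by
  simp only [remainder, map_sub, map_mul, Complex.conj_ofReal, hF.conj_flow]

theorem sq_eq_norm_sq {z : ℂ} (h : starRingEnd ℂ z = z) : z ^ 2 = ((‖z‖ ^ 2 : ℝ) : ℂ) := by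
  rw [pow_two]
  nth_rewrite 2 [← h]
  rw [Complex.mul_conj, Complex.normSq_eq_norm_sq]

/-- The mass of a solution. -/
theorem integral_sq_ofReal (h : IsSolutionFrom α β T ε F u) (hF : IsTest F) (hr : IsHermitian F)
    {t : ℝ} (ht : t ∈ Icc 0 T) :
    ∫ x, (u t x : ℂ) ^ 2 = ((ε ^ 2 * ∫ ξ, ‖F ξ‖ ^ 2 : ℝ) : ℂ) := by
  have h1 := h.integral_sq_eq ht
  have h2 : ∫ x, (u t x : ℂ) ^ 2 = ((∫ x, u t x ^ 2 : ℝ) : ℂ) := by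
    rw [← integral_complex_ofReal]
    push_cast
    rfl
  rw [h2, h1]
  congr 1
  simp_rw [mul_pow]
  rw [integral_const_mul, ← hF.integral_norm_sq_flow (α := α) (β := β) 0]
  congr 2
  ext x
  rw [← sq_abs, ← Real.norm_eq_abs, ← Complex.norm_real, ← hr.flow_eq_re]

theorem integral_norm_sq (h : IsSolutionFrom α β T ε F u) (hF : IsTest F) (hr : IsHermitian F)
    {t : ℝ} (ht : t ∈ Icc 0 T) :
    ∫ x, ‖(u t x : ℂ) ^ 2‖ = ε ^ 2 * ∫ ξ, ‖F ξ‖ ^ 2 := by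
  have h1 := h.integral_sq_ofReal hF hr ht
  have h2 : ∀ x, (u t x : ℂ) ^ 2 = ((‖(u t x : ℂ) ^ 2‖ : ℝ) : ℂ) := fun x => by
    rw [norm_pow]; exact sq_eq_norm_sq (Complex.conj_ofReal _)
  rw [integral_congr_ae (Eventually.of_forall h2), integral_complex_ofReal] at h1
  have h3 := Complex.ofReal_injective h1
  exact h3

/-- Duhamel's formula for the remainder, in weak form. -/
theorem integral_remainder_mul_flow (h : IsSolutionFrom α β T ε F u) (hF : IsTest F)
    (hr : IsHermitian F) (hH : IsTest H) {t : ℝ} (ht : t ∈ Icc 0 T) :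
    ∫ x, remainder α β ε F u t x * flow α β H t x =
      (1 / 2) * ∫ τ in (0 : ℝ)..t, ∫ x, (u τ x : ℂ) ^ 2 * flow α β (dHat H) τ x := by
  rw [← (h.integral_mul_flow hH ht).2]
  have i1 : Integrable fun x => (u t x : ℂ) * flow α β H t x :=
    (h.memLp_ofReal ht).integrable_mul (hH.memLp_flow t)
  have i2 : Integrable fun x => (ε : ℂ) * (flow α β F t x * flow α β H t x) :=
    (hF.integrable_flow_mul hH t t).const_mul _
  simp only [remainder, sub_mul, mul_assoc]
  rw [integral_sub i1 i2]
  congr 1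
  rw [integral_const_mul, hF.integral_flow_mul hH, ← hF.integral_flow_mul (α := α) (β := β) hH 0,
    ← integral_const_mul]
  refine integral_congr_ae (Eventually.of_forall fun x => ?_)
  simp only
  rw [Complex.ofReal_mul, ← hr.flow_eq_re, mul_assoc]

/-- The energy identity for the remainder. -/
theorem integral_remainder_sq (h : IsSolutionFrom α β T ε F u) (hF : IsTest F)
    (hr : IsHermitian F) {t : ℝ} (ht : t ∈ Icc 0 T) :
    ∫ x, remainder α β ε F u t x ^ 2 =
      -ε * ∫ τ in (0 : ℝ)..t, ∫ x, (u τ x : ℂ) ^ 2 * flow α β (dHat F) τ x := by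
  have h1 := h.integral_remainder_mul_flow hF hr hF ht
  have i2 := hF.integrable_flow_mul (α := α) (β := β) hF t t
  have i1 : Integrable fun x => remainder α β ε F u t x * flow α β F t x :=
    (h.memLp_remainder hF ht).integrable_mul (hF.memLp_flow t)
  have i0 := h.integrable_sq ht
  -- After integration the terms `u²` and `ε²w²` have the same mass and cancel; only the cross term,
  -- given by Duhamel tested with `F` itself, is left.
  have e : (fun x => remainder α β ε F u t x ^ 2) = fun x => ((u t x : ℂ) ^ 2 -
      2 * ε * (remainder α β ε F u t x * flow α β F t x)) -
      ε ^ 2 * (flow α β F t x * flow α β F t x) := by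
    ext x
    simp only [remainder]
    ring
  have n : ∫ x, flow α β F t x * flow α β F t x = ((∫ ξ, ‖F ξ‖ ^ 2 : ℝ) : ℂ) := by
    rw [← hF.integral_norm_sq_flow (α := α) (β := β) t, ← integral_complex_ofReal]
    refine integral_congr_ae (Eventually.of_forall fun x => ?_)
    simp only
    rw [← pow_two, sq_eq_norm_sq (hr.conj_flow t x)]
  have i01 := i0.sub (i1.const_mul (2 * ε : ℂ))
  simp only [Pi.sub_def] at i01
  rw [e, integral_sub i01 (i2.const_mul _), integral_sub i0 (i1.const_mul _), integral_const_mul,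
    integral_const_mul, h1, n, h.integral_sq_ofReal hF hr ht]
  push_cast
  ring

theorem integral_norm_remainder_sq (h : IsSolutionFrom α β T ε F u) (hF : IsTest F)
    (hr : IsHermitian F) {t : ℝ} (ht : t ∈ Icc 0 T) :
    ∫ x, ‖remainder α β ε F u t x‖ ^ 2 =
      ‖(ε : ℂ) * ∫ τ in (0 : ℝ)..t, ∫ x, (u τ x : ℂ) ^ 2 * flow α β (dHat F) τ x‖ := by
  have h1 := h.integral_remainder_sq hF hr ht
  have h2 : ∀ x, remainder α β ε F u t x ^ 2 = ((‖remainder α β ε F u t x‖ ^ 2 : ℝ) : ℂ) :=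
    fun x => sq_eq_norm_sq (conj_remainder hr t x)
  rw [integral_congr_ae (Eventually.of_forall h2), integral_complex_ofReal] at h1
  rw [← norm_neg, ← neg_mul, ← h1, Complex.norm_real, Real.norm_eq_abs,
    abs_of_nonneg (integral_nonneg fun _ => by positivity)]

/-- A bound `C` on the flux at each time becomes a bound on the remainder with one additional factor
`ε`. It is applied twice, first with the crude flux bound from mass and then with the improved one.
-/
theorem integral_norm_remainder_sq_le (h : IsSolutionFrom α β T ε F u) (hF : IsTest F)
    (hr : IsHermitian F) (hε : 0 ≤ ε) {t C : ℝ} (ht : t ∈ Icc 0 T)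
    (hC : ∀ τ ∈ Icc 0 T, ‖∫ x, (u τ x : ℂ) ^ 2 * flow α β (dHat F) τ x‖ ≤ C) :
    ∫ x, ‖remainder α β ε F u t x‖ ^ 2 ≤ ε * (C * T) := by
  rw [h.integral_norm_remainder_sq hF hr ht, norm_mul, Complex.norm_real, Real.norm_eq_abs,
    abs_of_nonneg hε]
  refine mul_le_mul_of_nonneg_left ?_ hε
  have hC0 : 0 ≤ C := (norm_nonneg _).trans (hC t ht)
  refine (intervalIntegral.norm_integral_le_of_norm_le_const (C := C) fun τ hτ => ?_).trans ?_
  · rw [uIoc_of_le ht.1] at hτ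
    exact hC τ ⟨hτ.1.le, hτ.2.trans ht.2⟩
  · rw [sub_zero, abs_of_nonneg ht.1]
    exact mul_le_mul_of_nonneg_left ht.2 hC0

/-- With `u = εw + v` the difference is `v² + 2εvw`, and Cauchy–Schwarz handles the cross term. -/
theorem integral_norm_sub_sq_le (h : IsSolutionFrom α β T ε F u) (hF : IsTest F) (hε : 0 ≤ ε)
    {τ r : ℝ} (hτ : τ ∈ Icc 0 T) (hr0 : 0 ≤ r)
    (hr : ∫ x, ‖remainder α β ε F u τ x‖ ^ 2 ≤ r ^ 2) :
    Integrable (fun x => (u τ x : ℂ) ^ 2 - ε ^ 2 * flow α β F τ x ^ 2) ∧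
    ∫ x, ‖(u τ x : ℂ) ^ 2 - ε ^ 2 * flow α β F τ x ^ 2‖ ≤
      r ^ 2 + 2 * ε * (r * Real.sqrt (∫ ξ, ‖F ξ‖ ^ 2)) := by
  have m := h.memLp_remainder hF hτ
  have mw := hF.memLp_flow (α := α) (β := β) τ
  have i2 : Integrable fun x => flow α β F τ x ^ 2 := by
    simpa only [pow_two] using hF.integrable_flow_mul (α := α) (β := β) hF τ τ
  have i1 := integrable_norm_mul_norm m mw
  have i0 : Integrable fun x => ‖remainder α β ε F u τ x‖ ^ 2 := by
    simpa only [pow_two] using integrable_norm_mul_norm m m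
  have hi := (h.integrable_sq hτ).sub (i2.const_mul ((ε : ℂ) ^ 2))
  refine ⟨hi, ?_⟩
  have b1 := integral_norm_mul_norm_le m mw
  have l1 : lpNorm (remainder α β ε F u τ) 2 volume ≤ r :=
    le_of_sq_le_sq ((sq_lpNorm_two m).trans_le hr) hr0
  have l2 := IsSmoothSolution.lpNorm_flow_le hF τ (α := α) (β := β)
  have b2 := b1.trans (mul_le_mul l1 l2 lpNorm_nonneg hr0)
  calc ∫ x, ‖(u τ x : ℂ) ^ 2 - ε ^ 2 * flow α β F τ x ^ 2‖
      ≤ ∫ x, (‖remainder α β ε F u τ x‖ ^ 2 +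
          2 * ε * (‖remainder α β ε F u τ x‖ * ‖flow α β F τ x‖)) := by
        refine integral_mono hi.norm (i0.add (i1.const_mul _)) fun x => ?_
        have : (u τ x : ℂ) ^ 2 - ε ^ 2 * flow α β F τ x ^ 2 = remainder α β ε F u τ x ^ 2 +
            2 * ε * (remainder α β ε F u τ x * flow α β F τ x) := by
          simp only [remainder]; ring
        simp only [this]
        refine (norm_add_le _ _).trans_eq ?_
        simp only [norm_mul, norm_pow, Complex.norm_real, Complex.norm_ofNat, Real.norm_eq_abs,
          abs_of_nonneg hε]
    _ = _ := by rw [integral_add i0 (i1.const_mul _), integral_const_mul]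
    _ ≤ _ := add_le_add hr (mul_le_mul_of_nonneg_left b2 (by positivity))

/-- The `L¹` bound on `u² - ε²w²` is paired with the sup bound on the test function. Only `∫ ‖H‖ ≤
K` matters, so the estimate is uniform over families of tests with a common `K`. -/
theorem norm_integral_sq_mul_flow_sub_le (h : IsSolutionFrom α β T ε F u) (hF : IsTest F)
    (hε : 0 ≤ ε) {τ r K : ℝ} (hτ : τ ∈ Icc 0 T) (hr0 : 0 ≤ r)
    (hr : ∫ x, ‖remainder α β ε F u τ x‖ ^ 2 ≤ r ^ 2) (hH : IsTest H) (hK : ∫ ξ, ‖H ξ‖ ≤ K) :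
    ‖(∫ x, (u τ x : ℂ) ^ 2 * flow α β H τ x) -
      ε ^ 2 * ∫ x, flow α β F τ x ^ 2 * flow α β H τ x‖ ≤
      (r ^ 2 + 2 * ε * (r * Real.sqrt (∫ ξ, ‖F ξ‖ ^ 2))) * K := by
  obtain ⟨i, b⟩ := h.integral_norm_sub_sq_le hF hε hτ hr0 hr
  have i2 : Integrable fun x => flow α β F τ x ^ 2 := by
    simpa only [pow_two] using hF.integrable_flow_mul (α := α) (β := β) hF τ τ
  rw [← integral_const_mul, ← integral_sub (hH.integrable_mul_flow (h.integrable_sq hτ) τ)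
    ((hH.integrable_mul_flow i2 τ).const_mul _)]
  have e := norm_integral_mul_le i (fun x => (norm_flow_le (α := α) (β := β) H τ x).trans hK)
  refine le_trans (le_of_eq ?_) (e.trans (mul_le_mul_of_nonneg_right b
    ((integral_nonneg fun _ => norm_nonneg _).trans hK)))
  congr 2
  ext x
  ring

end IsSolutionFrom

/-- The remainder is small in `L²`, uniformly over all solutions. -/
theorem exists_remainder_bound (α β : ℝ) {T : ℝ} (hT : 0 ≤ T) (hF : IsTest F)
    (hr : IsHermitian F) : ∃ C, 0 ≤ C ∧ ∀ δ ∈ Icc (0 : ℝ) 1, ∀ u,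
      IsSolutionFrom α β T (δ ^ 2) F u → ∀ τ ∈ Icc 0 T,
        ∫ x, ‖remainder α β (δ ^ 2) F u τ x‖ ^ 2 ≤ (C * δ ^ 3) ^ 2 ∧
        ∫ x, ‖remainder α β (δ ^ 2) F u τ x‖ ^ 2 ≤ C * δ ^ 7 := by
  set K0 := ∫ ξ, ‖F ξ‖ ^ 2 with hK0
  set K1 := ∫ ξ, ‖dHat F ξ‖ with hK1
  have k0 : 0 ≤ K0 := integral_nonneg fun _ => by positivity
  have k1 : 0 ≤ K1 := integral_nonneg fun _ => by positivity
  set C1 := Real.sqrt (K0 * K1 * T) with hC1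
  have c1 : 0 ≤ C1 := Real.sqrt_nonneg _
  set C2 := (C1 ^ 2 + 2 * (C1 * Real.sqrt K0)) * K1 * T with hC2
  have c2 : 0 ≤ C2 := by positivity
  refine ⟨C1 + C2, by positivity, fun δ hδ u h => ?_⟩
  have hδ2 : 0 ≤ δ ^ 2 := by positivity
  have d0 := hδ.1
  -- With `ε = δ²` the half-integer powers of `ε` become integer powers of `δ`. The crude flux bound
  -- is `ε²` times constants, so `‖v‖²` is at most a multiple of `ε³ = δ⁶`.
  have first : ∀ τ ∈ Icc 0 T, ∫ x, ‖remainder α β (δ ^ 2) F u τ x‖ ^ 2 ≤ (C1 * δ ^ 3) ^ 2 := by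
    intro τ hτ
    refine (h.integral_norm_remainder_sq_le hF hr hδ2 hτ (C := (δ ^ 2) ^ 2 * K0 * K1)
      fun σ hσ => ?_).trans_eq ?_
    · rw [← h.integral_norm_sq hF hr hσ]
      exact norm_integral_mul_le (h.integrable_sq hσ) (norm_flow_le _ σ)
    · rw [mul_pow, hC1, Real.sq_sqrt (by positivity)]
      ring
  intro τ hτ
  constructor
  · refine (first τ hτ).trans ?_
    gcongr
    linarith
  -- Since `w²` contributes nothing to the flux, only `u² - ε²w²` remains. It has size `δ⁵`, from
  -- the cross term `δ² · δ³`, and the outer factor `ε` makes `δ⁷`.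
  · refine (h.integral_norm_remainder_sq_le hF hr hδ2 hτ
      (C := δ ^ 5 * ((C1 ^ 2 + 2 * (C1 * Real.sqrt K0)) * K1)) fun σ hσ => ?_).trans ?_
    · have b := h.norm_integral_sq_mul_flow_sub_le hF hδ2 hσ (by positivity) (first σ hσ) hF.dx
        le_rfl
      rw [hF.integral_sq_mul_flow_dHat, mul_zero, sub_zero] at b
      refine b.trans ?_
      have : (C1 * δ ^ 3) ^ 2 ≤ δ ^ 5 * C1 ^ 2 := by
        rw [mul_pow, mul_comm]
        refine mul_le_mul_of_nonneg_right ?_ (by positivity)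
        rw [← pow_mul]
        exact pow_le_pow_of_le_one d0 hδ.2 (by norm_num)
      calc _ ≤ (δ ^ 5 * C1 ^ 2 + 2 * δ ^ 2 * (C1 * δ ^ 3 * Real.sqrt K0)) * K1 := by
            gcongr
        _ = _ := by ring
    · have : δ ^ 2 * (δ ^ 5 * ((C1 ^ 2 + 2 * (C1 * Real.sqrt K0)) * K1) * T) = C2 * δ ^ 7 := by
        rw [hC2]; ring
      rw [this]
      gcongr
      linarith

end

/-! ### The cubic interaction as a frequency integral. -/

section

variable {α β : ℝ} {F G H : ℝ → ℂ}

theorem IsTest.convolution (hF : IsTest F) (hG : IsTest G) :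
    IsTest fun η => ∫ x, F x * G (η - x) :=
  ⟨hG.supp.contDiff_convolution_right (ContinuousLinearMap.mul ℝ ℂ)
      hF.integrable.locallyIntegrable hG.smooth,
    HasCompactSupport.convolution (ContinuousLinearMap.mul ℝ ℂ) hF.supp hG.supp⟩

theorem IsTest.fourier_convolution (hF : IsTest F) (hG : IsTest G) (x : ℝ) :
    𝓕 (fun η => ∫ x, F x * G (η - x)) x = 𝓕 F x * 𝓕 G x :=
  Real.fourier_mul_convolution_eq hF.integrable hG.integrable x

/-- The test function whose evolution at time `τ` is the product of those of `F` and `G`. -/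
def twisted (α β : ℝ) (F G : ℝ → ℂ) (τ η : ℝ) : ℂ :=
  phase α β (-τ) η * ∫ x, (phase α β τ x * F x) * (phase α β τ (η - x) * G (η - x))

theorem IsTest.isTest_twisted (hF : IsTest F) (hG : IsTest G) (τ : ℝ) : IsTest (twisted α β F G τ) :=
  ((hF.phase_mul τ).convolution (hG.phase_mul τ)).phase_mul (-τ)

/-- The Duhamel formula can only be tested with linear evolutions. A product at the single time `τ`
becomes one after its convolution is transported back by `phase α β (-τ)`; at other times the
evolution is not the product. -/
theorem IsTest.flow_twisted (hF : IsTest F) (hG : IsTest G) (τ x : ℝ) :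
    flow α β (twisted α β F G τ) τ x = flow α β F τ x * flow α β G τ x := by
  have h : (fun ξ => phase α β τ ξ * twisted α β F G τ ξ) =
      fun ξ => ∫ x, (phase α β τ x * F x) * (phase α β τ (ξ - x) * G (ξ - x)) := by
    ext ξ
    rw [twisted, ← mul_assoc, mul_comm (phase α β τ ξ), phase_neg_mul_phase, one_mul]
  rw [flow, h, (hF.phase_mul τ).fourier_convolution (hG.phase_mul τ)]
  rfl

/-- Taking absolute values inside the convolution removes every phase, so one compactly supported
majorant works for all `τ`. -/
theorem exists_integral_norm_dHat_twisted_le (hF : IsTest F) (hG : IsTest G) :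
    ∃ K, ∀ τ, ∫ ξ, ‖dHat (twisted α β F G τ) ξ‖ ≤ K := by
  set k : ℝ → ℝ := fun η => ∫ x, ‖F x‖ * ‖G (η - x)‖ with hk
  have kc : Continuous (MeasureTheory.convolution (fun x => ‖F x‖) (fun x => ‖G x‖)
      (ContinuousLinearMap.mul ℝ ℝ) volume) :=
    HasCompactSupport.continuous_convolution_right _ hG.supp.norm
      hF.integrable.norm.locallyIntegrable hG.continuous.norm
  have ks : HasCompactSupport (MeasureTheory.convolution (fun x => ‖F x‖) (fun x => ‖G x‖)
      (ContinuousLinearMap.mul ℝ ℝ) volume) :=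
    HasCompactSupport.convolution (ContinuousLinearMap.mul ℝ ℝ) hF.supp.norm hG.supp.norm
  change Continuous k at kc
  change HasCompactSupport k at ks
  refine ⟨∫ ξ : ℝ, ‖(-2 * Real.pi * Complex.I * ξ : ℂ)‖ * k ξ, fun τ => ?_⟩
  refine integral_mono (hF.isTest_twisted hG τ).dx.integrable.norm ?_ fun ξ => ?_
  · refine Continuous.integrable_of_hasCompactSupport ?_ ks.mul_left
    fun_prop
  · simp only [dHat]
    rw [norm_mul]
    refine mul_le_mul_of_nonneg_left ?_ (norm_nonneg _)
    rw [twisted, norm_mul, norm_phase, one_mul]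
    refine (norm_integral_le_integral_norm _).trans_eq ?_
    simp only [norm_mul, norm_phase, one_mul, hk]

theorem IsTest.exists_radius (hF : IsTest F) : ∃ R, 0 ≤ R ∧ ∀ x, F x ≠ 0 → |x| ≤ R := by
  obtain ⟨R, hR⟩ := hF.supp.isCompact.isBounded.exists_norm_le
  refine ⟨max R 0, le_max_right _ _, fun x hx => (hR x ?_).trans (le_max_left _ _)⟩
  exact subset_tsupport F hx

/-- The time-independent factor in the cubic interaction. -/
def cubicWeight (F H : ℝ → ℂ) (z : ℝ × ℝ × ℝ) : ℂ :=
  F z.1 * F z.2.1 * F z.2.2 * H (-(z.1 + z.2.1 + z.2.2)) *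
    ((-4 * Real.pi ^ 2 * ((z.1 + z.2.1) * (z.1 + z.2.1 + z.2.2)) : ℝ) : ℂ)

/-- The resonance function of the interaction of two waves. -/
def resonance (α β x y : ℝ) : ℝ := symbol α β x + symbol α β y - symbol α β (x + y)

theorem continuous_resonance (α β : ℝ) : Continuous fun p : ℝ × ℝ => resonance α β p.1 p.2 := by
  unfold resonance
  have := continuous_symbol α β
  fun_prop

theorem IsTest.continuous_cubicWeight (hF : IsTest F) (hH : IsTest H) :
    Continuous (cubicWeight F H) := by
  unfold cubicWeight
  have := hF.continuous
  have := hH.continuous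
  fun_prop

theorem IsTest.integrable_cubicWeight (hF : IsTest F) (hH : IsTest H) :
    Integrable (cubicWeight F H) := by
  obtain ⟨R, hR0, hR⟩ := hF.exists_radius
  refine (hF.continuous_cubicWeight hH).integrable_of_hasCompactSupport
    (HasCompactSupport.intro (K := Icc (-R) R ×ˢ Icc (-R) R ×ˢ Icc (-R) R)
      (isCompact_Icc.prod (isCompact_Icc.prod isCompact_Icc)) fun z hz => ?_)
  by_contra h
  apply hz
  simp only [cubicWeight, mul_eq_zero, not_or] at h
  exact ⟨abs_le.1 (hR _ h.1.1.1.1), abs_le.1 (hR _ h.1.1.1.2), abs_le.1 (hR _ h.1.1.2)⟩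

theorem phase_mul_phase_mul_phase (α β σ x y : ℝ) :
    phase α β (-σ) (x + y) * phase α β σ x * phase α β σ y =
      Complex.exp ((σ * resonance α β x y : ℝ) * Complex.I) := by
  rw [phase, phase, phase, ← Complex.exp_add, ← Complex.exp_add, resonance]
  congr 1
  push_cast
  ring

theorem phase_mul_phase_mul_phase_neg (α β τ x y : ℝ) :
    phase α β (-τ) (-x) * phase α β τ y * phase α β τ (-(x + y)) =
      Complex.exp ((τ * resonance α β x y : ℝ) * Complex.I) := by
  rw [phase, phase, phase, ← Complex.exp_add, ← Complex.exp_add, resonance, symbol_neg, symbol_neg]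
  congr 1
  push_cast
  ring

/-- The spatial integral of the cubic interaction, as a Fourier integral. -/
theorem IsTest.integral_interaction (hF : IsTest F) (hH : IsTest H) (τ σ : ℝ) :
    ∫ x, flow α β F σ x ^ 2 * flow α β (dHat (twisted α β F (dHat H) τ)) σ x =
      ∫ z : ℝ × ℝ × ℝ, cubicWeight F H z *
        (Complex.exp ((τ * resonance α β (z.1 + z.2.1) z.2.2 : ℝ) * Complex.I) *
          Complex.exp ((σ * resonance α β z.1 z.2.1 : ℝ) * Complex.I)) := by
  set Y : ℝ → ℂ := dHat (twisted α β F (dHat H) τ) with hY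
  have tY : IsTest Y := (hF.isTest_twisted hH.dx τ).dx
  have cF := hF.continuous
  have cp : ∀ s, Continuous (phase α β s) := fun s => (contDiff_phase α β s).continuous
  obtain ⟨R, hR0, hR⟩ := hF.exists_radius
  set g : ℝ → ℝ → ℂ := fun η x => phase α β (-σ) η * ((phase α β σ x * F x) *
    (phase α β σ (η - x) * F (η - x))) * Y (-η) with hg
  have gc : Continuous (Function.uncurry g) := by
    have := cp σ
    have := cp (-σ)
    have := tY.continuous
    simp only [hg, Function.uncurry_def]
    fun_prop
  have gs : HasCompactSupport (Function.uncurry g) := by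
    refine HasCompactSupport.intro (K := Icc (-(2 * R)) (2 * R) ×ˢ Icc (-R) R)
      (isCompact_Icc.prod isCompact_Icc) fun z hz => ?_
    by_contra h
    apply hz
    simp only [hg, Function.uncurry_def, mul_eq_zero, not_or] at h
    have h1 := hR _ h.1.2.1.2
    have h2 := hR _ h.1.2.2.2
    rw [abs_le] at h1 h2
    refine ⟨⟨?_, ?_⟩, h1⟩ <;> linarith
  -- The square at time `σ` is itself the evolution of `twisted α β F F σ`, so the spatial integral
  -- is the conserved pairing of two profiles.
  have e1 : ∫ x, flow α β F σ x ^ 2 * flow α β Y σ x = ∫ η, ∫ x, g η x := by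
    have h1 := (hF.isTest_twisted hF σ (α := α) (β := β)).integral_flow_mul tY σ
      (α := α) (β := β)
    simp only [hF.flow_twisted hF, ← pow_two] at h1
    rw [h1]
    refine integral_congr_ae (Eventually.of_forall fun η => ?_)
    simp only [hg, twisted]
    rw [integral_mul_const, integral_const_mul]
  -- Shifting `η = x + x'` turns the variables into the two input frequencies of the first
  -- interaction.
  have e2 : ∫ η, ∫ x, g η x = ∫ x, ∫ x', g (x + x') x := by
    rw [integral_integral_swap_of_hasCompactSupport gc gs]
    refine integral_congr_ae (Eventually.of_forall fun x => ?_)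
    exact (integral_add_left_eq_self (fun η => g η x) x).symm
  set M : ℝ × ℝ × ℝ → ℂ := fun z => cubicWeight F H z *
        (Complex.exp ((τ * resonance α β (z.1 + z.2.1) z.2.2 : ℝ) * Complex.I) *
          Complex.exp ((σ * resonance α β z.1 z.2.1 : ℝ) * Complex.I)) with hM
  have Mc : Continuous M := by
    have h1 := hF.continuous_cubicWeight hH
    have h2 := continuous_resonance α β
    have h3 : Continuous fun z : ℝ × ℝ × ℝ => resonance α β (z.1 + z.2.1) z.2.2 :=
      h2.comp (f := fun z : ℝ × ℝ × ℝ => (z.1 + z.2.1, z.2.2)) (by fun_prop)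
    have h4 : Continuous fun z : ℝ × ℝ × ℝ => resonance α β z.1 z.2.1 :=
      h2.comp (f := fun z : ℝ × ℝ × ℝ => (z.1, z.2.1)) (by fun_prop)
    fun_prop
  have M0 : ∀ z, M z ≠ 0 → z.1 ∈ Icc (-R) R ∧ z.2.1 ∈ Icc (-R) R ∧ z.2.2 ∈ Icc (-R) R := by
    intro z h
    simp only [hM, cubicWeight, mul_eq_zero, not_or, ne_eq] at h
    exact ⟨abs_le.1 (hR _ h.1.1.1.1.1), abs_le.1 (hR _ h.1.1.1.1.2), abs_le.1 (hR _ h.1.1.1.2)⟩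
  have Mi : Integrable M := Mc.integrable_of_hasCompactSupport
    (HasCompactSupport.intro (K := Icc (-R) R ×ˢ Icc (-R) R ×ˢ Icc (-R) R)
      (isCompact_Icc.prod (isCompact_Icc.prod isCompact_Icc)) fun z hz => by
        by_contra h; exact hz (M0 z h))
  have Mi2 : ∀ x, Integrable fun p => M (x, p) := fun x =>
    (Mc.comp (by fun_prop : Continuous fun p : ℝ × ℝ => (x, p))).integrable_of_hasCompactSupport
    (HasCompactSupport.intro (K := Icc (-R) R ×ˢ Icc (-R) R)
      (isCompact_Icc.prod isCompact_Icc) fun z hz => by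
        by_contra h; exact hz (M0 _ h).2)
  have e3 : ∫ z, M z = ∫ x, ∫ x', ∫ y, M (x, x', y) := by
    refine (integral_prod _ Mi).trans ?_
    refine integral_congr_ae (Eventually.of_forall fun x => ?_)
    exact integral_prod _ (Mi2 x)
  rw [e1, e2, e3]
  refine integral_congr_ae (Eventually.of_forall fun x => integral_congr_ae
    (Eventually.of_forall fun x' => ?_))
  simp only [hg, hY, dHat, twisted, add_sub_cancel_left]
  simp only [← mul_assoc]
  rw [← integral_const_mul]
  refine integral_congr_ae (Eventually.of_forall fun y => ?_)
  have p1 := phase_mul_phase_mul_phase α β σ x x'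
  have p2 := phase_mul_phase_mul_phase_neg α β τ (x + x') y
  have ea : -(x + x') - y = -(x + x' + y) := by ring
  simp only [hM, cubicWeight, ← p1, ← p2, ea]
  push_cast
  -- The two spatial derivatives contribute `(2πi)²`, so `i² = -1` is all that is needed beyond ring
  -- identities.
  linear_combination (4 * Real.pi ^ 2 * (x + x') * (x + x' + y) * phase α β (-σ) (x + x') *
    phase α β σ x * F x * phase α β σ x' * F x' * phase α β (-τ) (-(x + x')) * phase α β τ y * F y *
    phase α β τ (-(x + x' + y)) * H (-(x + x' + y))) * Complex.I_sq

end

/-! ### Time integration and the third-order expansion of solutions. -/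

section

/-- Interchange of a time integral with an integral against a fixed integrable weight. -/
theorem intervalIntegral_integral_mul {m : ℝ × ℝ × ℝ → ℂ} (hm : Integrable m)
    {k : ℝ → ℝ × ℝ × ℝ → ℂ} (hk : Continuous (Function.uncurry k)) {t C : ℝ} (ht : 0 ≤ t)
    (hC : ∀ τ ∈ Icc 0 t, ∀ z, ‖k τ z‖ ≤ C) :
    IntervalIntegrable (fun τ => ∫ z, m z * k τ z) volume 0 t ∧
    ∫ τ in (0 : ℝ)..t, ∫ z, m z * k τ z = ∫ z, m z * ∫ τ in (0 : ℝ)..t, k τ z := by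
  have hi : Integrable (Function.uncurry fun τ z => m z * k τ z)
      ((volume.restrict (Ioc 0 t)).prod volume) := by
    have h1 : Integrable (fun p : ℝ × ℝ × ℝ × ℝ => m p.2)
      ((volume.restrict (Ioc 0 t)).prod volume) := hm.comp_snd _
    refine h1.mul_bdd (c := C) hk.aestronglyMeasurable ?_
    have hmem : ∀ᵐ τ ∂(volume.restrict (Ioc 0 t)), τ ∈ Icc 0 t :=
      (ae_restrict_mem measurableSet_Ioc).mono fun τ hτ => Ioc_subset_Icc_self hτ
    have h2 : ∀ᵐ p : ℝ × ℝ × ℝ × ℝ ∂((volume.restrict (Ioc 0 t)).prod volume), p.1 ∈ Icc 0 t :=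
      Measure.quasiMeasurePreserving_fst.ae hmem
    filter_upwards [h2] with p hp
    exact hC p.1 hp p.2
  refine ⟨(intervalIntegrable_iff_integrableOn_Ioc_of_le ht).2 hi.integral_prod_left, ?_⟩
  simp_rw [intervalIntegral.integral_of_le ht]
  rw [integral_integral_swap hi]
  refine integral_congr_ae (Eventually.of_forall fun z => ?_)
  exact integral_const_mul _ _

variable {α β : ℝ} {F H : ℝ → ℂ}

/-- The time integral in the cubic interaction. -/
def timeKernel (t a b : ℝ) : ℂ :=
  ∫ τ in (0 : ℝ)..t, ∫ σ in (0 : ℝ)..τ,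
    Complex.exp ((τ * b : ℝ) * Complex.I) * Complex.exp ((σ * a : ℝ) * Complex.I)

/-- Fubini is applied twice against the same integrable weight: the oscillating factors are bounded
by `1`, and the inner time integral by `t`. -/
theorem integral_interaction_time (hF : IsTest F) (hH : IsTest H) {t : ℝ} (ht : 0 ≤ t) :
    (∀ τ, 0 ≤ τ → IntervalIntegrable (fun σ => ∫ x, flow α β F σ x ^ 2 *
        flow α β (dHat (twisted α β F (dHat H) τ)) σ x) volume 0 τ) ∧
    IntervalIntegrable (fun τ => ∫ σ in (0 : ℝ)..τ, ∫ x, flow α β F σ x ^ 2 *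
        flow α β (dHat (twisted α β F (dHat H) τ)) σ x) volume 0 t ∧
    ∫ τ in (0 : ℝ)..t, ∫ σ in (0 : ℝ)..τ, ∫ x, flow α β F σ x ^ 2 *
        flow α β (dHat (twisted α β F (dHat H) τ)) σ x =
      ∫ z : ℝ × ℝ × ℝ, cubicWeight F H z *
        timeKernel t (resonance α β z.1 z.2.1) (resonance α β (z.1 + z.2.1) z.2.2) := by
  have hm := hF.integrable_cubicWeight hH
  have h2 := continuous_resonance α β
  have h3 : Continuous fun z : ℝ × ℝ × ℝ => resonance α β (z.1 + z.2.1) z.2.2 :=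
    h2.comp (f := fun z : ℝ × ℝ × ℝ => (z.1 + z.2.1, z.2.2)) (by fun_prop)
  have h4 : Continuous fun z : ℝ × ℝ × ℝ => resonance α β z.1 z.2.1 :=
    h2.comp (f := fun z : ℝ × ℝ × ℝ => (z.1, z.2.1)) (by fun_prop)
  simp only [hF.integral_interaction hH]
  have inner := fun (τ : ℝ) (hτ : 0 ≤ τ) => intervalIntegral_integral_mul hm
    (k := fun σ z => Complex.exp ((τ * resonance α β (z.1 + z.2.1) z.2.2 : ℝ) * Complex.I) *
          Complex.exp ((σ * resonance α β z.1 z.2.1 : ℝ) * Complex.I))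
    (by simp only [Function.uncurry_def]; fun_prop) hτ (C := 1) (fun σ _ z => by
      rw [norm_mul, Complex.norm_exp_ofReal_mul_I, Complex.norm_exp_ofReal_mul_I, one_mul])
  have outer := intervalIntegral_integral_mul hm
    (k := fun τ z => ∫ σ in (0 : ℝ)..τ,
      Complex.exp ((τ * resonance α β (z.1 + z.2.1) z.2.2 : ℝ) * Complex.I) *
          Complex.exp ((σ * resonance α β z.1 z.2.1 : ℝ) * Complex.I))
    (by
      simp only [Function.uncurry_def]
      exact intervalIntegral.continuous_parametric_intervalIntegral_of_continuous
        (f := fun (p : ℝ × ℝ × ℝ × ℝ) (σ : ℝ) =>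
          Complex.exp ((p.1 * resonance α β (p.2.1 + p.2.2.1) p.2.2.2 : ℝ) * Complex.I) *
          Complex.exp ((σ * resonance α β p.2.1 p.2.2.1 : ℝ) * Complex.I))
        (by
          have h3' := h3.comp (f := fun q : (ℝ × ℝ × ℝ × ℝ) × ℝ => q.1.2) (by fun_prop)
          have h4' := h4.comp (f := fun q : (ℝ × ℝ × ℝ × ℝ) × ℝ => q.1.2) (by fun_prop)
          simp only [Function.comp_def] at h3' h4'
          simp only [Function.uncurry_def]
          fun_prop) continuous_fst) ht (C := t) (fun τ hτ z => by
      refine (intervalIntegral.norm_integral_le_of_norm_le_const (C := 1) fun σ _ => ?_).trans ?_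
      · rw [norm_mul, Complex.norm_exp_ofReal_mul_I, Complex.norm_exp_ofReal_mul_I, one_mul]
      · rw [sub_zero, one_mul, abs_of_nonneg hτ.1]; exact hτ.2)
  refine ⟨fun τ hτ => (inner τ hτ).1, ?_, ?_⟩
  · refine outer.1.congr_uIoo ?_
    rw [uIoo_of_le ht]
    intro τ hτ
    exact (inner τ hτ.1.le).2.symm
  · refine (intervalIntegral.integral_congr fun τ hτ => ?_).trans outer.2
    rw [uIcc_of_le ht] at hτ
    exact (inner τ hτ.1).2

theorem IsTest.intervalIntegrable_sq_mul_flow (hF : IsTest F) (hH : IsTest H) (t : ℝ) :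
    IntervalIntegrable (fun τ => ∫ x, flow α β F τ x ^ 2 * flow α β H τ x) volume 0 t := by
  have hm : StronglyMeasurable (Function.uncurry fun τ x =>
      flow α β F τ x ^ 2 * flow α β H τ x) :=
    stronglyMeasurable_uncurry_of_continuous_of_stronglyMeasurable
      (fun x => ((hF.continuous_flow_time x).pow 2).mul (hH.continuous_flow_time x))
      fun τ => (((hF.continuous_flow τ).pow 2).mul (hH.continuous_flow τ)).stronglyMeasurable
  have hb : ∀ τ, ‖∫ x, flow α β F τ x ^ 2 * flow α β H τ x‖ ≤
      (∫ ξ, ‖F ξ‖ ^ 2) * ∫ ξ, ‖H ξ‖ := by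
    intro τ
    have i2 : Integrable fun x => flow α β F τ x ^ 2 := by
      simpa only [pow_two] using hF.integrable_flow_mul (α := α) (β := β) hF τ τ
    refine (norm_integral_mul_le i2 (norm_flow_le H τ)).trans_eq ?_
    simp only [norm_pow]
    rw [hF.integral_norm_sq_flow]
  have h2 : AEStronglyMeasurable (fun τ => ∫ x, flow α β F τ x ^ 2 * flow α β H τ x)
      (volume : Measure ℝ) := hm.integral_prod_right.aestronglyMeasurable
  exact (intervalIntegrable_const (c := (∫ ξ, ‖F ξ‖ ^ 2) * ∫ ξ, ‖H ξ‖)).mono_fun h2.restrict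
    (Eventually.of_forall fun τ => (hb τ).trans (le_abs_self _))

/-- The expansion of a solution with respect to the size of its initial value, tested against a
linear evolution, up to and including the third order. -/
theorem exists_expansion (α β : ℝ) {T t : ℝ} (ht : t ∈ Icc 0 T) (hF : IsTest F)
    (hr : IsHermitian F) (hH : IsTest H) : ∃ d₁ d₂ : ℂ, ∃ C : ℝ, 0 ≤ C ∧
      ∀ δ ∈ Icc (0 : ℝ) 1, ∀ u, IsSolutionFrom α β T (δ ^ 2) F u →
        ‖(∫ x, (u t x : ℂ) * flow α β H t x) - (((δ ^ 2 : ℝ) : ℂ) * d₁ + ((δ ^ 2 : ℝ) : ℂ) ^ 2 * d₂ +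
          ((δ ^ 2 : ℝ) : ℂ) ^ 3 * (1 / 2 * ∫ z : ℝ × ℝ × ℝ, cubicWeight F H z *
            timeKernel t (resonance α β z.1 z.2.1) (resonance α β (z.1 + z.2.1) z.2.2)))‖ ≤
          C * δ ^ 7 := by
  have hT : 0 ≤ T := ht.1.trans ht.2
  obtain ⟨C, hC0, hC⟩ := exists_remainder_bound α β hT hF hr
  obtain ⟨K, hK⟩ := exists_integral_norm_dHat_twisted_le (α := α) (β := β) hF hH.dx
  have hK0 : 0 ≤ K := (integral_nonneg fun _ => norm_nonneg _).trans (hK 0)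
  set K1 := ∫ ξ, ‖dHat H ξ‖ with hK1
  have k1 : 0 ≤ K1 := integral_nonneg fun _ => norm_nonneg _
  set S := Real.sqrt (∫ ξ, ‖F ξ‖ ^ 2) with hS
  have s0 : 0 ≤ S := Real.sqrt_nonneg _
  obtain ⟨iE, iEE, eE⟩ := integral_interaction_time (α := α) (β := β) hF hH ht.1
  rw [← eE]
  set E : ℝ → ℝ → ℂ := fun τ σ => ∫ x, flow α β F σ x ^ 2 *
    flow α β (dHat (twisted α β F (dHat H) τ)) σ x with hE
  set A : ℝ → ℂ := fun τ => ∫ x, flow α β F τ x ^ 2 * flow α β (dHat H) τ x with hA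
  have iA : IntervalIntegrable A volume 0 t := hF.intervalIntegrable_sq_mul_flow hH.dx t
  set C' := T * ((C ^ 2 + 2 * (C * S)) * K) + C * K1 with hC'
  have hC'0 : 0 ≤ C' := by positivity
  -- The first two coefficients are explicit, but later only their independence of `δ` and `u` is
  -- used.
  refine ⟨∫ x, flow α β F 0 x * flow α β H 0 x, 1 / 2 * ∫ τ in (0 : ℝ)..t, A τ,
    C' * T, by positivity, fun δ hδ u h => ?_⟩
  have d0 := hδ.1
  have e0 : (0 : ℝ) ≤ δ ^ 2 := by positivity
  have rem := hC δ hδ u h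
  obtain ⟨iB, eB⟩ := IsSmoothSolution.integral_mul_flow h hH ht
  set B : ℝ → ℂ := fun τ => ∫ x, (u τ x : ℂ) ^ 2 * flow α β (dHat H) τ x with hB
  set c : ℂ := ((δ ^ 2 : ℝ) : ℂ) with hc
  have nc : ‖c‖ = δ ^ 2 := by rw [hc, Complex.norm_real, Real.norm_eq_abs, abs_of_nonneg e0]
  -- pointwise in time
  have pt : ∀ τ ∈ Icc 0 t, ‖B τ - (c ^ 2 * A τ + c ^ 3 * ∫ σ in (0 : ℝ)..τ, E τ σ)‖ ≤
      C' * δ ^ 7 := by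
    intro τ hτ
    have hτT : τ ∈ Icc 0 T := ⟨hτ.1, hτ.2.trans ht.2⟩
    have tG := hF.isTest_twisted (α := α) (β := β) hH.dx τ
    have m := h.memLp_remainder hF hτT
    -- the linear term in the remainder
    have l1 := h.integral_remainder_mul_flow hF hr tG hτT
    have iE' := iE τ hτ.1
    have iD := (IsSmoothSolution.integral_mul_flow h tG hτT).1
    have l2 : ‖(∫ σ in (0 : ℝ)..τ, ∫ x, (u σ x : ℂ) ^ 2 *
        flow α β (dHat (twisted α β F (dHat H) τ)) σ x) - c ^ 2 * ∫ σ in (0 : ℝ)..τ, E τ σ‖ ≤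
        T * (((C ^ 2 + 2 * (C * S)) * K) * δ ^ 5) := by
      rw [← intervalIntegral.integral_const_mul, ← intervalIntegral.integral_sub iD
        (iE'.const_mul _)]
      refine (intervalIntegral.norm_integral_le_of_norm_le_const
        (C := ((C ^ 2 + 2 * (C * S)) * K) * δ ^ 5) fun σ hσ => ?_).trans ?_
      · rw [uIoc_of_le hτ.1] at hσ
        have hσT : σ ∈ Icc 0 T := ⟨hσ.1.le, hσ.2.trans hτT.2⟩
        refine (h.norm_integral_sq_mul_flow_sub_le hF e0 hσT (by positivity) (rem σ hσT).1 tG.dx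
          (hK τ)).trans ?_
        have : (C * δ ^ 3) ^ 2 ≤ C ^ 2 * δ ^ 5 := by
          rw [mul_pow, ← pow_mul]
          exact mul_le_mul_of_nonneg_left (pow_le_pow_of_le_one d0 hδ.2 (by norm_num))
            (by positivity)
        calc _ ≤ (C ^ 2 * δ ^ 5 + 2 * δ ^ 2 * (C * δ ^ 3 * S)) * K := by gcongr
          _ = _ := by ring
      · rw [sub_zero, abs_of_nonneg hτ.1, mul_comm]
        exact mul_le_mul_of_nonneg_right hτT.2 (by positivity)
    -- the quadratic term in the remainder
    have i2 : Integrable fun x => remainder α β (δ ^ 2) F u τ x ^ 2 := by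
      have : Integrable fun x => remainder α β (δ ^ 2) F u τ x * remainder α β (δ ^ 2) F u τ x :=
        m.integrable_mul m
      simpa only [pow_two] using this
    have q : ‖∫ x, remainder α β (δ ^ 2) F u τ x ^ 2 * flow α β (dHat H) τ x‖ ≤ C * δ ^ 7 * K1 := by
      refine (norm_integral_mul_le i2 (norm_flow_le _ τ)).trans ?_
      refine mul_le_mul_of_nonneg_right ?_ k1
      simp only [norm_pow]
      exact (rem τ hτT).2
    have iw : Integrable fun x => flow α β F τ x ^ 2 * flow α β (dHat H) τ x := by
      refine hH.dx.integrable_mul_flow ?_ τ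
      simpa only [pow_two] using hF.integrable_flow_mul (α := α) (β := β) hF τ τ
    have iv : Integrable fun x => remainder α β (δ ^ 2) F u τ x *
        flow α β (twisted α β F (dHat H) τ) τ x := m.integrable_mul (tG.memLp_flow τ)
    have iq := hH.dx.integrable_mul_flow (α := α) (β := β) i2 τ
    -- Squaring `u = cw + v` gives three terms. In the middle one `v` meets the product of `w` and
    -- the differentiated test, an evolution of `twisted` at time `τ`, so Duhamel for the remainder
    -- applies again.
    have split : B τ = c ^ 2 * A τ + 2 * c * (∫ x, remainder α β (δ ^ 2) F u τ x *
        flow α β (twisted α β F (dHat H) τ) τ x) +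
        ∫ x, remainder α β (δ ^ 2) F u τ x ^ 2 * flow α β (dHat H) τ x := by
      have iwv := (iw.const_mul (c ^ 2)).add (iv.const_mul (2 * c))
      simp only [Pi.add_def] at iwv
      rw [hA, ← integral_const_mul, ← integral_const_mul,
        ← integral_add (iw.const_mul _) (iv.const_mul _), ← integral_add iwv iq]
      refine integral_congr_ae (Eventually.of_forall fun x => ?_)
      simp only [hF.flow_twisted hH.dx, remainder, ← hc]
      ring
    rw [split, l1]
    have e : ∀ I J Q : ℂ, c ^ 2 * A τ + 2 * c * (1 / 2 * I) + Q - (c ^ 2 * A τ + c ^ 3 * J) =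
        c * (I - c ^ 2 * J) + Q := by intros; ring
    rw [e]
    refine (norm_add_le _ _).trans ?_
    rw [norm_mul, nc]
    calc _ ≤ δ ^ 2 * (T * (((C ^ 2 + 2 * (C * S)) * K) * δ ^ 5)) + C * δ ^ 7 * K1 := by gcongr
      _ = C' * δ ^ 7 := by rw [hC']; ring
  have data : ∫ x, (((δ ^ 2 * (flow α β F 0 x).re : ℝ)) : ℂ) * flow α β H 0 x =
      c * ∫ x, flow α β F 0 x * flow α β H 0 x := by
    rw [← integral_const_mul]
    refine integral_congr_ae (Eventually.of_forall fun x => ?_)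
    simp only
    rw [Complex.ofReal_mul, ← hr.flow_eq_re, mul_assoc]
  rw [data] at eB
  have fin : (∫ x, (u t x : ℂ) * flow α β H t x) -
      (c * (∫ x, flow α β F 0 x * flow α β H 0 x) + c ^ 2 * (1 / 2 * ∫ τ in (0 : ℝ)..t, A τ) +
        c ^ 3 * (1 / 2 * ∫ τ in (0 : ℝ)..t, ∫ σ in (0 : ℝ)..τ, E τ σ)) =
      1 / 2 * ∫ τ in (0 : ℝ)..t, (B τ - (c ^ 2 * A τ + c ^ 3 * ∫ σ in (0 : ℝ)..τ, E τ σ)) := by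
    rw [intervalIntegral.integral_sub iB ((iA.const_mul _).add (iEE.const_mul _)),
      intervalIntegral.integral_add (iA.const_mul _) (iEE.const_mul _),
      intervalIntegral.integral_const_mul, intervalIntegral.integral_const_mul]
    linear_combination eB
  rw [fin, norm_mul]
  have b := intervalIntegral.norm_integral_le_of_norm_le_const (a := 0) (b := t)
    (f := fun τ => B τ - (c ^ 2 * A τ + c ^ 3 * ∫ σ in (0 : ℝ)..τ, E τ σ)) (C := C' * δ ^ 7)
    fun τ hτ => by
      rw [uIoc_of_le ht.1] at hτ
      exact pt τ ⟨hτ.1.le, hτ.2⟩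
  rw [sub_zero, abs_of_nonneg ht.1] at b
  have n2 : ‖(1 / 2 : ℂ)‖ ≤ 1 := by norm_num
  calc _ ≤ 1 * (C' * δ ^ 7 * t) := by gcongr
    _ ≤ 1 * (C' * δ ^ 7 * T) := by gcongr; exact ht.2
    _ = _ := by ring

end

/-! ### Sobolev norms, Taylor's formula, and the inequality forced by differentiability. -/

section

variable {α β : ℝ} {F H : ℝ → ℂ}

/-- The Bessel weight of order `s`. -/
def weight (s ξ : ℝ) : ℝ := (1 + ‖ξ‖ ^ 2) ^ (s / 2)

theorem weight_nonneg (s ξ : ℝ) : 0 ≤ weight s ξ := by unfold weight; positivity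

theorem hasTemperateGrowth_weight (s : ℝ) :
    Function.HasTemperateGrowth fun ξ => ((weight s ξ : ℝ) : ℂ) := by
  unfold weight; fun_prop

/-- The norm in `H^s` of a function with Fourier transform `H`. -/
def weightedNorm (s : ℝ) (H : ℝ → ℂ) : ℝ := Real.sqrt (∫ ξ, (weight s ξ * ‖H ξ‖) ^ 2)

theorem norm_toLp_two (f : 𝓢(ℝ, ℂ)) : ‖f.toLp 2‖ = Real.sqrt (∫ x, ‖f x‖ ^ 2) := by
  rw [SchwartzMap.norm_toLp' (by norm_num) (by norm_num), Real.sqrt_eq_rpow]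
  simp

theorem norm_smul_fourier_toLp (s : ℝ) (f : 𝓢(ℝ, ℂ))
    (hf : ∀ ξ, ‖f ξ‖ = ‖H ξ‖) :
    ‖(𝓕 (SchwartzMap.smulLeftCLM ℂ (fun ξ => ((weight s ξ : ℝ) : ℂ)) f)).toLp 2‖ =
      weightedNorm s H := by
  rw [SchwartzMap.norm_fourier_toL2_eq, norm_toLp_two, weightedNorm]
  congr 2
  ext ξ
  rw [SchwartzMap.smulLeftCLM_apply_apply (hasTemperateGrowth_weight s), smul_eq_mul, norm_mul,
    hf, Complex.norm_real, Real.norm_eq_abs, abs_of_nonneg (weight_nonneg s ξ)]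

namespace Sobolev

variable {s : ℝ}

theorem norm_eq (f : Sobolev s) : ‖f‖ = ‖f.besselFun‖ := rfl

/-- The duality between `H^s` and `H^{-s}`. -/
theorem norm_toDistribution_flow_le (f : Sobolev s) (hH : IsTest H) (t : ℝ) :
    ‖f.toDistribution (hH.flowS α β t)‖ ≤ ‖f‖ * weightedNorm (-s) H := by
  -- Writing the distribution as the potential of order `-s` of an `L²` function moves the weight
  -- onto the test function, and Cauchy–Schwarz finishes.
  have h1 : f.toDistribution = TemperedDistribution.besselPotential ℝ ℂ (-s)
      (Lp.toTemperedDistributionCLM ℂ (volume : Measure ℝ) 2 f.besselFun) := by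
    rw [f.besselFun_spec]
    simp
  set p := (hH.phase_mul (α := α) (β := β) t).toSchwartz with hp
  set χ : 𝓢(ℝ, ℂ) := 𝓕 (SchwartzMap.smulLeftCLM ℂ (fun ξ => ((weight (-s) ξ : ℝ) : ℂ)) p) with hχ
  have h2 : f.toDistribution (hH.flowS α β t) = ∫ x, χ x * f.besselFun x := by
    have h3 : 𝓕⁻ (hH.flowS α β t) = p := FourierTransform.fourierInv_fourier_eq _
    rw [h1, TemperedDistribution.besselPotential,
      TemperedDistribution.fourierMultiplierCLM_apply_apply, h3,
      Lp.toTemperedDistributionCLM_apply, Lp.toTemperedDistribution_apply]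
    rfl
  have hn : ‖χ.toLp 2‖ = weightedNorm (-s) H :=
    norm_smul_fourier_toLp (-s) p fun ξ => by simp [hp]
  have m1 : MemLp χ 2 volume := χ.memLp 2
  have m2 : MemLp f.besselFun 2 volume := Lp.memLp _
  have b := integral_norm_mul_norm_le m1 m2
  rw [← toReal_eLpNorm m1.1, ← toReal_eLpNorm m2.1, ← SchwartzMap.norm_toLp, ← Lp.norm_def, hn,
    ← norm_eq] at b
  rw [h2]
  refine (norm_integral_le_integral_norm _).trans ?_
  simp only [norm_mul]
  rw [mul_comm]
  exact b

end Sobolev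

theorem IsTest.flowS_distribution_apply (hF : IsTest F) (φ : 𝓢(ℝ, ℂ)) :
    (hF.flowS α β 0 : 𝓢'(ℝ, ℂ)) φ = ∫ x, φ x * flow α β F 0 x :=
  SchwartzMap.toTemperedDistributionCLM_apply_apply volume (hF.flowS α β 0) φ

theorem IsTest.isRealDistribution (hF : IsTest F) (hr : IsHermitian F) :
    IsRealDistribution (hF.flowS α β 0 : 𝓢'(ℝ, ℂ)) := by
  intro φ hφ
  rw [hF.flowS_distribution_apply]
  have h : ∀ x, φ x * flow α β F 0 x = (((φ x).re * (flow α β F 0 x).re : ℝ) : ℂ) := by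
    intro x
    rw [Complex.ofReal_mul, ← hr.flow_eq_re]
    congr 1
    exact Complex.ext rfl (by simp [hφ x])
  simp_rw [h]
  rw [integral_complex_ofReal, Complex.ofReal_im]

/-- A Schwartz function given by its Fourier transform, as an element of `H^s`. -/
def IsTest.toSobolev (s : ℝ) (hF : IsTest F) (hr : IsHermitian F) (α β : ℝ) : Sobolev s :=
  ⟨(hF.flowS α β 0 : 𝓢'(ℝ, ℂ)), (hF.flowS α β 0).memSobolev, hF.isRealDistribution hr⟩

theorem IsTest.toDistribution_toSobolev (s : ℝ) (hF : IsTest F) (hr : IsHermitian F) :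
    (hF.toSobolev s hr α β).toDistribution = (hF.flowS α β 0 : 𝓢'(ℝ, ℂ)) := rfl

/-- The datum is a forward transform, so its own Fourier transform is `F` reflected, up to a
unimodular phase; the weight is even, so the reflection does not affect the norm. -/
theorem IsTest.norm_toSobolev (s : ℝ) (hF : IsTest F) (hr : IsHermitian F) :
    ‖hF.toSobolev s hr α β‖ = weightedNorm s F := by
  set φ := hF.flowS α β 0 with hφ
  have h1 : (hF.toSobolev s hr α β).besselFun =
      (SchwartzMap.fourierMultiplierCLM ℂ (fun ξ => ((weight s ξ : ℝ) : ℂ)) φ).toLp 2 := by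
    apply Sobolev.toTemperedDistribution_injective
    rw [Sobolev.besselFun_spec, hF.toDistribution_toSobolev, Lp.toTemperedDistributionCLM_apply,
      Lp.toTemperedDistribution_toLp_eq, TemperedDistribution.besselPotential]
    exact TemperedDistribution.fourierMultiplierCLM_toTemperedDistributionCLM_eq
      (hasTemperateGrowth_weight s) φ
  rw [Sobolev.norm_eq, h1, ← SchwartzMap.norm_fourier_toL2_eq, SchwartzMap.fourierMultiplierCLM_apply,
    FourierTransform.fourier_fourierInv_eq, norm_toLp_two, weightedNorm,
    ← integral_neg_eq_self (fun ξ => (weight s ξ * ‖F ξ‖) ^ 2) volume]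
  congr 2
  ext ξ
  have h2 : 𝓕 φ ξ = phase α β 0 (-ξ) * F (-ξ) := by
    have h3 := SchwartzMap.fourierInv_apply_eq φ
    have h4 : 𝓕⁻ φ = (hF.phase_mul (α := α) (β := β) 0).toSchwartz :=
      FourierTransform.fourierInv_fourier_eq _
    have h5 := congrArg (fun f : 𝓢(ℝ, ℂ) => f (-ξ)) (h3.symm.trans h4)
    simpa using h5
  rw [SchwartzMap.smulLeftCLM_apply_apply (hasTemperateGrowth_weight s), smul_eq_mul, norm_mul, h2,
    Complex.norm_real, Real.norm_eq_abs, abs_of_nonneg (weight_nonneg s ξ), norm_mul, norm_phase,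
    one_mul]
  simp [weight]

/-- The initial value with Fourier transform `F`, as a real-valued Schwartz function. -/
def IsTest.realData (hF : IsTest F) (α β : ℝ) : 𝓢(ℝ, ℝ) :=
  (hF.flowS α β 0).postcompCLM Complex.reCLM

theorem IsTest.coe_smul_realData (hF : IsTest F) (ε : ℝ) :
    ⇑(ε • hF.realData α β) = fun x => ε * (flow α β F 0 x).re := rfl

theorem IsTest.represents_smul (s : ℝ) (hF : IsTest F) (hr : IsHermitian F) (ε : ℝ) :
    (ε • hF.toSobolev s hr α β).Represents fun x => ε * (flow α β F 0 x).re := by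
  intro φ
  have h : (ε • hF.toSobolev s hr α β).toDistribution φ =
      ε • ((hF.toSobolev s hr α β).toDistribution φ) := by
    rw [map_smul]; rfl
  rw [h, hF.toDistribution_toSobolev, hF.flowS_distribution_apply, ← integral_smul]
  refine integral_congr_ae (Eventually.of_forall fun x => ?_)
  simp only [Complex.ofReal_mul, ← hr.flow_eq_re, Complex.real_smul]
  ring

section Taylor

variable {E G : Type*} [NormedAddCommGroup E] [NormedSpace ℝ E] [NormedAddCommGroup G]
  [NormedSpace ℝ G]

/-- A map of class `C³` is approximated along every line by a quadratic polynomial, up to a cubic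
remainder with a uniform constant. -/
theorem exists_cubic_bound {Φ : E → G} (hΦ : ContDiffAt ℝ 3 Φ 0) :
    ∃ C, 0 ≤ C ∧ ∀ f : E, ∃ ε₀ > 0, ∃ a₀ a₁ a₂ : G, ∀ ε ∈ Icc (0 : ℝ) ε₀,
      ‖Φ (ε • f) - (a₀ + ε • a₁ + ε ^ 2 • a₂)‖ ≤ C * ‖f‖ ^ 3 * ε ^ 3 := by
  have hc := (hΦ.continuousAt_iteratedFDeriv le_rfl).norm
  have h1 : ∀ᶠ y in 𝓝 (0 : E), ‖iteratedFDeriv ℝ 3 Φ y‖ < ‖iteratedFDeriv ℝ 3 Φ 0‖ + 1 :=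
    hc.eventually (gt_mem_nhds (lt_add_one _))
  obtain ⟨r, hr, hball⟩ := Metric.eventually_nhds_iff_ball.1 (h1.and (hΦ.eventually (by simp)))
  set C := ‖iteratedFDeriv ℝ 3 Φ 0‖ + 1 with hC
  refine ⟨C, by positivity, fun f => ?_⟩
  -- Restriction to the line reduces the claim to Taylor's formula in one variable. The chain rule
  -- bounds the third derivative by `C‖f‖³` with `C` fixed before `f`; only the length of the
  -- interval depends on `f`.
  set L : ℝ →L[ℝ] E := ContinuousLinearMap.toSpanSingleton ℝ f with hL
  have hLn : ‖L‖ = ‖f‖ := ContinuousLinearMap.norm_toSpanSingleton f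
  set S : Set ℝ := L ⁻¹' Metric.ball 0 r with hS
  have So : IsOpen S := Metric.isOpen_ball.preimage L.continuous
  have hΦb : ContDiffOn ℝ 3 Φ (Metric.ball 0 r) := fun y hy => (hball y hy).2.contDiffWithinAt
  have hg : ContDiffOn ℝ 3 (Φ ∘ L) S := hΦb.comp L.contDiff.contDiffOn fun x hx => hx
  have bound : ∀ y ∈ S, ‖iteratedDeriv 3 (Φ ∘ L) y‖ ≤ C * ‖f‖ ^ 3 := by
    intro y hy
    rw [← norm_iteratedFDeriv_eq_norm_iteratedDeriv, ← iteratedFDerivWithin_of_isOpen 3 So hy,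
      ContinuousLinearMap.iteratedFDerivWithin_comp_right L hΦb Metric.isOpen_ball.uniqueDiffOn
        So.uniqueDiffOn hy le_rfl, iteratedFDerivWithin_of_isOpen 3 Metric.isOpen_ball hy]
    refine (ContinuousMultilinearMap.norm_compContinuousLinearMap_le _ _).trans ?_
    rw [Finset.prod_const, hLn, Finset.card_univ, Fintype.card_fin]
    exact mul_le_mul_of_nonneg_right (hball _ hy).1.le (by positivity)
  obtain ⟨e, he, heS⟩ := Metric.isOpen_iff.1 So 0 (by simp [hS, hr])
  have hIcc : Icc 0 (e / 2) ⊆ S := fun x hx => heS (by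
    rw [Metric.mem_ball, Real.dist_eq, sub_zero, abs_of_nonneg hx.1]
    linarith [hx.2])
  have e2 : 0 < e / 2 := by positivity
  refine ⟨e / 2, e2, Φ 0, derivWithin (Φ ∘ L) (Icc 0 (e / 2)) 0,
    (2 : ℝ)⁻¹ • iteratedDerivWithin 2 (Φ ∘ L) (Icc 0 (e / 2)) 0, fun ε hε => ?_⟩
  have tb := taylor_mean_remainder_bound (n := 2) e2.le (f := Φ ∘ L) (C := C * ‖f‖ ^ 3)
    (by norm_num; exact hg.mono hIcc) hε fun y hy => by
      rw [iteratedDerivWithin_eq_iteratedDeriv (uniqueDiffOn_Icc e2)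
        (hg.contDiffAt (So.mem_nhds (hIcc hy))) hy]
      exact bound y (hIcc hy)
  rw [taylorWithinEval_succ, taylorWithinEval_succ, taylor_within_zero_eval] at tb
  have eL : (Φ ∘ L) ε = Φ (ε • f) := by simp [hL]
  have eL0 : (Φ ∘ L) 0 = Φ 0 := by simp
  rw [eL, eL0] at tb
  norm_num at tb
  refine le_trans (le_of_eq ?_) (tb.trans ?_)
  · congr 3
    rw [smul_smul]
    ring_nf
  · have : 0 ≤ C * ‖f‖ ^ 3 * ε ^ 3 := by have := hε.1; positivity
    linarith

end Taylor

/-- A cubic polynomial bounded by `A x³` up to higher order has a leading coefficient bounded by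
a multiple of `A`. -/
theorem norm_le_of_forall_cubic {c₀ c₁ c₂ c₃ : ℂ} {A B δ₀ : ℝ} (hδ₀ : 0 < δ₀)
    (h : ∀ δ ∈ Ioo (0 : ℝ) δ₀, ‖c₀ + ((δ ^ 2 : ℝ) : ℂ) * c₁ + ((δ ^ 2 : ℝ) : ℂ) ^ 2 * c₂ +
      ((δ ^ 2 : ℝ) : ℂ) ^ 3 * c₃‖ ≤ A * δ ^ 6 + B * δ ^ 7) : ‖c₃‖ ≤ 7 * A := by
  have key : ∀ δ ∈ Ioo (0 : ℝ) (δ₀ / 4), ‖c₃‖ ≤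
      (1 / 360 + 64 / 180 + 729 / 280 + 4096 / 1260) * A +
      (1 / 360 + 128 / 180 + 2187 / 280 + 16384 / 1260) * B * δ := by
    intro δ hδ
    have h1 := h δ ⟨hδ.1, by linarith [hδ.1, hδ.2]⟩
    have h2 := h (2 * δ) ⟨by linarith [hδ.1], by linarith [hδ.1, hδ.2]⟩
    have h3 := h (3 * δ) ⟨by linarith [hδ.1], by linarith [hδ.1, hδ.2]⟩
    have h4 := h (4 * δ) ⟨by linarith [hδ.1], by linarith [hδ.1, hδ.2]⟩
    set q : ℝ → ℂ := fun δ => c₀ + ((δ ^ 2 : ℝ) : ℂ) * c₁ + ((δ ^ 2 : ℝ) : ℂ) ^ 2 * c₂ +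
      ((δ ^ 2 : ℝ) : ℂ) ^ 3 * c₃ with hq
    -- This is the third divided difference at the nodes `δ², 4δ², 9δ², 16δ²`, which annihilates the
    -- lower coefficients. The weights are the reciprocals of `∏ (k² - j²)`: `-360`, `180`, `-280`,
    -- `1260`.
    have e : ((δ ^ 6 : ℝ) : ℂ) * c₃ = ((-1 / 360 : ℝ) : ℂ) * q δ + ((1 / 180 : ℝ) : ℂ) * q (2 * δ) +
        ((-1 / 280 : ℝ) : ℂ) * q (3 * δ) + ((1 / 1260 : ℝ) : ℂ) * q (4 * δ) := by
      simp only [hq]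
      push_cast
      ring
    have d6 : 0 < δ ^ 6 := by have := hδ.1; positivity
    have n : δ ^ 6 * ‖c₃‖ ≤ 1 / 360 * ‖q δ‖ + 1 / 180 * ‖q (2 * δ)‖ + 1 / 280 * ‖q (3 * δ)‖ +
        1 / 1260 * ‖q (4 * δ)‖ := by
      have : δ ^ 6 * ‖c₃‖ = ‖((δ ^ 6 : ℝ) : ℂ) * c₃‖ := by
        rw [norm_mul, Complex.norm_real, Real.norm_eq_abs, abs_of_pos d6]
      rw [this, e]
      refine (norm_add₄_le).trans_eq ?_
      simp only [norm_mul, Complex.norm_real, Real.norm_eq_abs]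
      norm_num
    refine le_of_mul_le_mul_left (n.trans ?_) d6
    calc _ ≤ 1 / 360 * (A * δ ^ 6 + B * δ ^ 7) + 1 / 180 * (A * (2 * δ) ^ 6 + B * (2 * δ) ^ 7) +
          1 / 280 * (A * (3 * δ) ^ 6 + B * (3 * δ) ^ 7) +
          1 / 1260 * (A * (4 * δ) ^ 6 + B * (4 * δ) ^ 7) := by gcongr
      _ = _ := by ring
  have lim : Tendsto (fun δ : ℝ => (1 / 360 + 64 / 180 + 729 / 280 + 4096 / 1260) * A +
      (1 / 360 + 128 / 180 + 2187 / 280 + 16384 / 1260) * B * δ) (𝓝[>] 0)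
      (𝓝 ((1 / 360 + 64 / 180 + 729 / 280 + 4096 / 1260) * A +
      (1 / 360 + 128 / 180 + 2187 / 280 + 16384 / 1260) * B * 0)) :=
    Tendsto.mono_left (Continuous.tendsto (by fun_prop) 0) nhdsWithin_le_nhds
  have fin := ge_of_tendsto lim (by
    filter_upwards [Ioo_mem_nhdsGT (show (0 : ℝ) < δ₀ / 4 by positivity)] with δ hδ
    exact key δ hδ)
  -- The constant in the limit is slightly above `6.2`; nonnegativity of the norm forces `A ≥ 0`, so
  -- it may be rounded up to `7`.
  have n0 := norm_nonneg c₃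
  norm_num at fin
  linarith

/-- If the solution map is three times continuously differentiable, then the cubic interaction is
bounded by the Sobolev norms. -/
theorem exists_cubicInteraction_le {s T : ℝ} {Φ : Sobolev s → C(Icc (0 : ℝ) T, Sobolev s)}
    (hΦ : IsSolutionMap α β s T Φ) (hd : ContDiffAt ℝ 3 Φ 0) :
    ∃ C, ∀ F H : ℝ → ℂ, IsTest F → IsHermitian F → IsTest H → ∀ t ∈ Icc 0 T,
      ‖∫ z : ℝ × ℝ × ℝ, cubicWeight F H z *
        timeKernel t (resonance α β z.1 z.2.1) (resonance α β (z.1 + z.2.1) z.2.2)‖ ≤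
      C * (weightedNorm s F ^ 3 * weightedNorm (-s) H) := by
  obtain ⟨C, hC0, hC⟩ := exists_cubic_bound hd
  -- The factor `7` from `norm_le_of_forall_cubic` is doubled because the cubic coefficient is
  -- `J/2`.
  refine ⟨14 * C, fun F H hF hr hH t ht => ?_⟩
  obtain ⟨d₁, d₂, B, hB0, hB⟩ := exists_expansion α β ht hF hr hH
  set f := hF.toSobolev s hr α β with hf
  obtain ⟨ε₀, hε₀, a₀, a₁, a₂, ha⟩ := hC f
  set J := ∫ z : ℝ × ℝ × ℝ, cubicWeight F H z *
    timeKernel t (resonance α β z.1 z.2.1) (resonance α β (z.1 + z.2.1) z.2.2) with hJ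
  set ψ := hH.flowS α β t with hψ
  set t' : Icc (0 : ℝ) T := ⟨t, ht⟩ with ht'
  -- small multiples of the initial value lie in the neighbourhood where `Φ` solves the equation
  have small : ∀ᶠ ε : ℝ in 𝓝 0, ∀ u₀ : 𝓢(ℝ, ℝ), (ε • f).Represents u₀ →
      ∃ u : ℝ → ℝ → ℝ, IsSmoothSolution α β T u₀ u ∧
        ∀ t : Icc (0 : ℝ) T, (Φ (ε • f) t).Represents (u t) := by
    have : Tendsto (fun ε : ℝ => ε • f) (𝓝 0) (𝓝 0) := by
      have := (ContinuousLinearMap.toSpanSingleton ℝ f).continuous.tendsto 0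
      rwa [map_zero] at this
    exact this.eventually hΦ
  obtain ⟨ε₁, hε₁, hsmall⟩ := Metric.eventually_nhds_iff_ball.1 small
  set m := min (min 1 ε₀) ε₁ with hm
  have m0 : 0 < m := by positivity
  -- Subtracting the two expansions leaves a cubic polynomial in `ε = δ²`. Nothing is known about
  -- its three lower coefficients, and there is no need to identify the Taylor coefficients of `Φ`.
  have main : ∀ δ ∈ Ioo (0 : ℝ) m, ‖((a₀ t').toDistribution ψ) + ((δ ^ 2 : ℝ) : ℂ) *
      ((a₁ t').toDistribution ψ - d₁) + ((δ ^ 2 : ℝ) : ℂ) ^ 2 * ((a₂ t').toDistribution ψ - d₂) +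
      ((δ ^ 2 : ℝ) : ℂ) ^ 3 * (-(1 / 2 * J))‖ ≤
      C * ‖f‖ ^ 3 * weightedNorm (-s) H * δ ^ 6 + B * δ ^ 7 := by
    intro δ hδ
    have d1 : δ ≤ 1 := hδ.2.le.trans ((min_le_left _ _).trans (min_le_left _ _))
    have dd : δ ^ 2 ≤ δ := by nlinarith [hδ.1]
    have de : δ ^ 2 ≤ ε₀ := dd.trans (hδ.2.le.trans ((min_le_left _ _).trans (min_le_right _ _)))
    have de1 : δ ^ 2 < ε₁ := dd.trans_lt (hδ.2.trans_le (min_le_right _ _))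
    have d20 : 0 ≤ δ ^ 2 := by positivity
    obtain ⟨u, hu, hrep⟩ := hsmall (δ ^ 2) (by
      rw [Metric.mem_ball, Real.dist_eq, sub_zero, abs_of_nonneg d20]; exact de1)
      ((δ ^ 2) • hF.realData α β) (by
        rw [hF.coe_smul_realData]; exact hF.represents_smul s hr _)
    rw [hF.coe_smul_realData] at hu
    have b1 := hB δ ⟨hδ.1.le, d1⟩ u hu
    have b2 := ha (δ ^ 2) ⟨d20, de⟩
    set R := Φ ((δ ^ 2) • f) - (a₀ + (δ ^ 2) • a₁ + (δ ^ 2) ^ 2 • a₂) with hR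
    have b3 : ‖(R t').toDistribution ψ‖ ≤ C * ‖f‖ ^ 3 * (δ ^ 2) ^ 3 * weightedNorm (-s) H :=
      ((R t').norm_toDistribution_flow_le hH t).trans
        (mul_le_mul_of_nonneg_right ((R.norm_coe_le_norm t').trans b2) (Real.sqrt_nonneg _))
    have e1 : (R t').toDistribution ψ = (∫ x, (u t x : ℂ) * flow α β H t x) -
        ((a₀ t').toDistribution ψ + ((δ ^ 2 : ℝ) : ℂ) * (a₁ t').toDistribution ψ +
          ((δ ^ 2 : ℝ) : ℂ) ^ 2 * (a₂ t').toDistribution ψ) := by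
      have h1 : (Φ ((δ ^ 2) • f) t').toDistribution ψ = ∫ x, (u t x : ℂ) * flow α β H t x := by
        rw [hrep t' ψ]
        exact integral_congr_ae (Eventually.of_forall fun x => mul_comm _ _)
      have h2 : R t' = Φ ((δ ^ 2) • f) t' - (a₀ t' + (δ ^ 2) • a₁ t' + (δ ^ 2) ^ 2 • a₂ t') := rfl
      have h3 : ∀ (c : ℝ) (g : Sobolev s), (c • g).toDistribution ψ = (c : ℂ) * g.toDistribution ψ := by
        intro c g
        rw [map_smul]
        exact Complex.real_smul
      have h4 : ∀ g k : Sobolev s, (g + k).toDistribution ψ =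
          g.toDistribution ψ + k.toDistribution ψ := by
        intro g k; rw [map_add]; rfl
      have h5 : ∀ g k : Sobolev s, (g - k).toDistribution ψ =
          g.toDistribution ψ - k.toDistribution ψ := by
        intro g k; rw [map_sub]; rfl
      rw [h2, h5, h4, h4, h3, h3, h1]
      push_cast
      ring
    rw [e1] at b3
    have := norm_sub_le_of_le b1 b3
    refine le_trans (le_of_eq ?_) (this.trans_eq ?_)
    · congr 1; ring
    · ring
  have fin := norm_le_of_forall_cubic m0 main
  rw [norm_neg, norm_mul, hF.norm_toSobolev] at fin
  norm_num at fin
  linarith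

end

/-! ### Resonance functions and the sign of the interaction kernel. -/

section

variable {α β : ℝ} {F H : ℝ → ℂ}

theorem continuous_timeKernel (t : ℝ) : Continuous fun p : ℝ × ℝ => timeKernel t p.1 p.2 := by
  unfold timeKernel
  refine intervalIntegral.continuous_parametric_intervalIntegral_of_continuous'
    (f := fun (p : ℝ × ℝ) (τ : ℝ) => ∫ σ in (0 : ℝ)..τ,
      Complex.exp ((τ * p.2 : ℝ) * Complex.I) * Complex.exp ((σ * p.1 : ℝ) * Complex.I)) ?_ 0 t
  simp only [Function.uncurry_def]
  refine intervalIntegral.continuous_parametric_intervalIntegral_of_continuous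
    (f := fun (q : (ℝ × ℝ) × ℝ) (σ : ℝ) =>
      Complex.exp ((q.2 * q.1.2 : ℝ) * Complex.I) * Complex.exp ((σ * q.1.1 : ℝ) * Complex.I))
    ?_ continuous_snd
  simp only [Function.uncurry_def]
  fun_prop

theorem norm_timeKernel_le {t : ℝ} (ht : 0 ≤ t) (a b : ℝ) : ‖timeKernel t a b‖ ≤ t * t := by
  refine (intervalIntegral.norm_integral_le_of_norm_le_const (C := t) fun τ hτ => ?_).trans ?_
  · rw [uIoc_of_le ht] at hτ
    refine (intervalIntegral.norm_integral_le_of_norm_le_const (C := 1) fun σ _ => ?_).trans ?_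
    · rw [norm_mul, Complex.norm_exp_ofReal_mul_I, Complex.norm_exp_ofReal_mul_I, one_mul]
    · rw [sub_zero, one_mul, abs_of_nonneg hτ.1.le]; exact hτ.2
  · rw [sub_zero, abs_of_nonneg ht]

theorem integrable_cubicWeight_mul_timeKernel (hF : IsTest F) (hH : IsTest H) {t : ℝ}
    (ht : 0 ≤ t) :
    Integrable fun z : ℝ × ℝ × ℝ => cubicWeight F H z *
      timeKernel t (resonance α β z.1 z.2.1) (resonance α β (z.1 + z.2.1) z.2.2) := by
  have h2 := continuous_resonance α β
  have h3 : Continuous fun z : ℝ × ℝ × ℝ => resonance α β (z.1 + z.2.1) z.2.2 :=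
    h2.comp (f := fun z : ℝ × ℝ × ℝ => (z.1 + z.2.1, z.2.2)) (by fun_prop)
  have h4 : Continuous fun z : ℝ × ℝ × ℝ => resonance α β z.1 z.2.1 :=
    h2.comp (f := fun z : ℝ × ℝ × ℝ => (z.1, z.2.1)) (by fun_prop)
  exact (hF.integrable_cubicWeight hH).mul_bdd (c := t * t)
    ((continuous_timeKernel t).comp (h4.prodMk h3)).aestronglyMeasurable
    (Eventually.of_forall fun z => norm_timeKernel_le ht _ _)

/-- The time integral of an oscillation of frequency `ν`. -/
def cosIntegral (t ν : ℝ) : ℝ := ∫ τ in (0 : ℝ)..t, Real.cos (τ * ν)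

theorem abs_cosIntegral_le (t : ℝ) {ν m : ℝ} (hm : 0 < m) (h : m ≤ |ν|) :
    |cosIntegral t ν| ≤ 1 / m := by
  have h0 : ν ≠ 0 := abs_pos.1 (hm.trans_le h)
  rw [cosIntegral, intervalIntegral.integral_comp_mul_right (fun x => Real.cos x) h0, integral_cos,
    zero_mul, Real.sin_zero, sub_zero, smul_eq_mul, abs_mul, abs_inv, one_div]
  exact (mul_le_mul (inv_anti₀ hm h) (Real.abs_sin_le_one _) (abs_nonneg _)
    (inv_nonneg.2 hm.le)).trans_eq (mul_one _)

theorem half_le_cosIntegral {t ν : ℝ} (ht : 0 ≤ t) (h : t * |ν| ≤ 1) :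
    t / 2 ≤ cosIntegral t ν := by
  have h1 : ∫ _ in (0 : ℝ)..t, (1 / 2 : ℝ) = t / 2 := by
    rw [intervalIntegral.integral_const, smul_eq_mul]; ring
  rw [← h1]
  refine intervalIntegral.integral_mono_on ht (by simp)
    (Continuous.intervalIntegrable (by fun_prop) _ _) fun τ hτ => ?_
  have h2 := Real.one_sub_sq_div_two_le_cos (x := τ * ν)
  have h3 : |τ * ν| ≤ 1 := by
    rw [abs_mul, abs_of_nonneg hτ.1]
    exact (mul_le_mul_of_nonneg_right hτ.2 (abs_nonneg ν)).trans h
  have h4 := (sq_le_one_iff_abs_le_one _).2 h3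
  linarith

/-- The inner time integral divides by `ia = -ikq`, and the prefactor `k` cancels the small factor
`k` of the resonance. What remains is `i/q` times a difference of two oscillatory integrals, whose
imaginary part involves only cosines. -/
theorem im_mul_timeKernel (t : ℝ) {k q a b : ℝ} (hk : k ≠ 0) (hq : q ≠ 0) (ha : a = -k * q) :
    ((k : ℂ) * timeKernel t a b).im = (cosIntegral t (a + b) - cosIntegral t b) / q := by
  have a0 : a ≠ 0 := by rw [ha]; exact mul_ne_zero (neg_ne_zero.2 hk) hq
  have hkC : (k : ℂ) ≠ 0 := Complex.ofReal_ne_zero.2 hk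
  have hqC : (q : ℂ) ≠ 0 := Complex.ofReal_ne_zero.2 hq
  have inner : ∀ τ : ℝ, (∫ σ in (0 : ℝ)..τ,
      Complex.exp ((τ * b : ℝ) * Complex.I) * Complex.exp ((σ * a : ℝ) * Complex.I)) =
      Complex.I / (k * q) * (Complex.exp ((τ * (a + b) : ℝ) * Complex.I) -
        Complex.exp ((τ * b : ℝ) * Complex.I)) := by
    intro τ
    have e : ∀ σ : ℝ, Complex.exp ((σ * a : ℝ) * Complex.I) = Complex.exp (a * Complex.I * σ) := by
      intro σ; congr 1; push_cast; ring
    have hc : (a : ℂ) * Complex.I ≠ 0 := mul_ne_zero (Complex.ofReal_ne_zero.2 a0) Complex.I_ne_zero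
    simp only [e]
    rw [intervalIntegral.integral_const_mul, integral_exp_mul_complex hc]
    have e2 : Complex.exp ((τ * (a + b) : ℝ) * Complex.I) =
        Complex.exp ((τ * b : ℝ) * Complex.I) * Complex.exp (a * Complex.I * τ) := by
      rw [← Complex.exp_add]; congr 1; push_cast; ring
    have e3 : (a : ℂ) = -k * q := by rw [ha]; push_cast; ring
    rw [e2, Complex.ofReal_zero, mul_zero, Complex.exp_zero, e3]
    field_simp
    rw [Complex.I_sq]
    ring
  have iexp : ∀ ν : ℝ, IntervalIntegrable
      (fun τ : ℝ => Complex.exp ((τ * ν : ℝ) * Complex.I)) volume 0 t :=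
    fun ν => Continuous.intervalIntegrable (by fun_prop) _ _
  have re : ∀ ν : ℝ, (∫ τ in (0 : ℝ)..t, Complex.exp ((τ * ν : ℝ) * Complex.I)).re =
      cosIntegral t ν := by
    intro ν
    rw [cosIntegral]
    have := Complex.reCLM.intervalIntegral_comp_comm (iexp ν)
    simp only [Complex.reCLM_apply, Complex.exp_ofReal_mul_I_re] at this
    exact this.symm
  rw [timeKernel]
  simp only [inner]
  rw [intervalIntegral.integral_const_mul, intervalIntegral.integral_sub (iexp _) (iexp _),
    ← re, ← re]
  set X := ∫ τ in (0 : ℝ)..t, Complex.exp ((τ * (a + b) : ℝ) * Complex.I)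
  set Y := ∫ τ in (0 : ℝ)..t, Complex.exp ((τ * b : ℝ) * Complex.I)
  have e4 : (k : ℂ) * (Complex.I / (k * q) * (X - Y)) = ((1 / q : ℝ) : ℂ) * (Complex.I * (X - Y)) := by
    push_cast
    field_simp
  rw [e4, Complex.im_ofReal_mul, Complex.I_mul_im, Complex.sub_re]
  ring

/-- The cofactor of `x + y` in the resonance function, for the symbol `b ξ⁵ - a ξ³`. -/
def cofactor (a b x y : ℝ) : ℝ := x * y * (5 * b * (x ^ 2 + x * y + y ^ 2) - 3 * a)

/-- Oddness of the symbol makes the resonance vanish at `x + y = 0`. That factor is isolated because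
it is the one cancelled in `im_mul_timeKernel`. -/
theorem resonance_eq (α β x y : ℝ) : resonance α β x y =
    -(x + y) * cofactor ((2 * Real.pi) ^ 3 * α) ((2 * Real.pi) ^ 5 * β) x y := by
  unfold resonance symbol cofactor
  ring

/-- The intermediate frequency drops out, so the sum is symmetric in `x, y, z` and vanishes when two
of them are opposite. Near `N, N, -N` two of the three linear factors are small. -/
theorem resonance_add_resonance (α β x y z : ℝ) :
    resonance α β x y + resonance α β (x + y) z = -((x + y) * (y + z) * (z + x)) *
      (5 / 2 * ((2 * Real.pi) ^ 5 * β) * (x ^ 2 + y ^ 2 + z ^ 2 + (x + y + z) ^ 2) -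
        3 * ((2 * Real.pi) ^ 3 * α)) := by
  unfold resonance symbol
  ring

/-- The part of the cubic interaction that is not symmetric in the three frequencies. -/
def interactionKernel (α β t x y z : ℝ) : ℝ :=
  (((x + y : ℝ) : ℂ) * timeKernel t (resonance α β x y) (resonance α β (x + y) z)).im

/-- Rescaling by `N` makes the third-order dispersion a perturbation of relative size `a / (b N²)`.
-/
theorem cofactor_scale {a b N : ℝ} (hb : b ≠ 0) (hN : N ≠ 0) (u v : ℝ) :
    cofactor a b (N * u) (N * v) = b * N ^ 4 * cofactor (a / (b * N ^ 2)) 1 u v := by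
  unfold cofactor
  field_simp

/-- The unperturbed value at `(1, 1)` is `15`. -/
theorem le_cofactor {κ u v : ℝ} (hκ : |κ| ≤ 1 / 100) (hu : |u - 1| ≤ 1 / 1000)
    (hv : |v - 1| ≤ 1 / 1000) : 14 ≤ cofactor κ 1 u v := by
  rw [abs_le] at hκ hu hv
  have h1 : 998 / 1000 ≤ u * v := by nlinarith
  have h2 : 998 / 1000 ≤ u ^ 2 := by nlinarith
  have h3 : 998 / 1000 ≤ v ^ 2 := by nlinarith
  unfold cofactor
  have h4 : 149 / 10 ≤ 5 * 1 * (u ^ 2 + u * v + v ^ 2) - 3 * κ := by linarith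
  nlinarith

/-- The unperturbed value at `(1, -1)` is `-5`: of opposite sign to that at `(1, 1)` and three times
smaller, so its reciprocal dominates. -/
theorem cofactor_mem {κ u v : ℝ} (hκ : |κ| ≤ 1 / 100) (hu : |u - 1| ≤ 1 / 1000)
    (hv : |v + 1| ≤ 1 / 1000) : cofactor κ 1 u v ∈ Icc (-6 : ℝ) (-4) := by
  rw [abs_le] at hκ hu hv
  have h1 : 998 / 1000 ≤ u * (-v) := by nlinarith
  have h1' : u * (-v) ≤ 1003 / 1000 := by nlinarith
  have h2 : 998 / 1000 ≤ u ^ 2 := by nlinarith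
  have h3 : 998 / 1000 ≤ v ^ 2 := by nlinarith
  have h2' : u ^ 2 ≤ 1003 / 1000 := by nlinarith
  have h3' : v ^ 2 ≤ 1003 / 1000 := by nlinarith
  set m := 5 * 1 * (u ^ 2 + u * v + v ^ 2) - 3 * κ with hm
  have h4 : 48 / 10 ≤ m := by rw [hm]; linarith
  have h5 : m ≤ 52 / 10 := by rw [hm]; linarith
  have h6 : cofactor κ 1 u v = -(u * (-v) * m) := by rw [hm]; unfold cofactor; ring
  rw [h6]
  constructor <;> nlinarith

/-- Here `im_mul_timeKernel` applies with `q = b N⁴ Q`, `Q` being the rescaled cofactor. The first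
resonance is at least `25/t` and the total `Ψ` at most `1/t`, so the second resonance is at least
`24/t` and its cosine integral is the error `e`. -/
theorem interactionKernel_eq {t N γ b x y z Ψ : ℝ} (hb : b = (2 * Real.pi) ^ 5 * β)
    (hb0 : b ≠ 0) (ht : 0 < t) (hN : 0 < N) (hγ : 0 < γ)
    (hlarge : 25 ≤ 4 * (t * γ * |b| * N ^ 4)) (hxy : γ ≤ |x + y|)
    (hQ : 4 ≤ |cofactor ((2 * Real.pi) ^ 3 * α / (b * N ^ 2)) 1 (x / N) (y / N)|)
    (hΨ : Ψ = resonance α β x y + resonance α β (x + y) z) (hsmall : t * |Ψ| ≤ 1) :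
    ∃ e, |e| ≤ t / 24 ∧ b * N ^ 4 * interactionKernel α β t x y z =
      (cosIntegral t Ψ - e) / cofactor ((2 * Real.pi) ^ 3 * α / (b * N ^ 2)) 1 (x / N) (y / N) := by
  set Q := cofactor ((2 * Real.pi) ^ 3 * α / (b * N ^ 2)) 1 (x / N) (y / N) with hQdef
  have hQ0 : Q ≠ 0 := abs_pos.1 (by linarith)
  have k0 : x + y ≠ 0 := abs_pos.1 (hγ.trans_le hxy)
  have hc : cofactor ((2 * Real.pi) ^ 3 * α) ((2 * Real.pi) ^ 5 * β) x y = b * N ^ 4 * Q := by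
    rw [hQdef, ← cofactor_scale hb0 hN.ne', mul_div_cancel₀ _ hN.ne', mul_div_cancel₀ _ hN.ne', hb]
  have hres : resonance α β x y = -(x + y) * (b * N ^ 4 * Q) := by rw [resonance_eq, hc]
  have hN4 : b * N ^ 4 ≠ 0 := mul_ne_zero hb0 (by positivity)
  refine ⟨cosIntegral t (resonance α β (x + y) z), ?_, ?_⟩
  · have h1 : 25 / t ≤ |resonance α β x y| := by
      rw [hres, abs_mul, abs_neg, abs_mul, abs_mul, abs_of_nonneg (by positivity : 0 ≤ N ^ 4),
        div_le_iff₀ ht]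
      calc (25 : ℝ) ≤ 4 * (t * γ * |b| * N ^ 4) := hlarge
        _ = γ * (|b| * N ^ 4 * 4) * t := by ring
        _ ≤ _ := by gcongr
    have h2 : |Ψ| ≤ 1 / t := by rw [le_div_iff₀ ht]; linarith
    have h3 : |resonance α β x y| ≤ |Ψ| + |resonance α β (x + y) z| := by
      have : resonance α β x y = Ψ - resonance α β (x + y) z := by rw [hΨ]; ring
      rw [this]; exact abs_sub _ _
    have h4 : 24 / t ≤ |resonance α β (x + y) z| := by
      have : 25 / t = 24 / t + 1 / t := by ring
      linarith
    refine (abs_cosIntegral_le t (by positivity) h4).trans_eq ?_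
    rw [one_div_div]
  · rw [interactionKernel, im_mul_timeKernel t k0 (mul_ne_zero hN4 hQ0) hres, ← hΨ]
    field_simp

/-- The sum over the cyclic permutations of the kernel at frequencies `N`, `N`, `-N`, up to
perturbations of size `γ`, has a sign. -/
theorem cyclic_interactionKernel_le {t N γ b x y z : ℝ} (hb : b = (2 * Real.pi) ^ 5 * β)
    (hb0 : b ≠ 0) (ht : 0 < t) (hN : 0 < N) (hγ : 0 < γ) (hγN : 1000 * γ ≤ N)
    (hκ : |(2 * Real.pi) ^ 3 * α / (b * N ^ 2)| ≤ 1 / 100)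
    (hlarge : 25 ≤ 4 * (t * γ * |b| * N ^ 4)) (hNγ : N ^ 3 * γ ^ 2 ≤ 1) (hbt : 100 * |b| * t ≤ 1)
    (hx : x ∈ Icc (N - γ) (N - γ / 2)) (hy : y ∈ Icc (N - γ) (N - γ / 2))
    (hz : -z ∈ Icc (N + γ / 2) (N + γ)) :
    b * N ^ 4 * (interactionKernel α β t x y z + interactionKernel α β t y z x +
      interactionKernel α β t z x y) ≤ -(t / 16) := by
  set κ := (2 * Real.pi) ^ 3 * α / (b * N ^ 2) with hκd
  have hxN : |x / N - 1| ≤ 1 / 1000 := by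
    rw [div_sub_one hN.ne', abs_div, abs_of_pos hN, div_le_iff₀ hN, abs_le]
    constructor <;> linarith [hx.1, hx.2]
  have hyN : |y / N - 1| ≤ 1 / 1000 := by
    rw [div_sub_one hN.ne', abs_div, abs_of_pos hN, div_le_iff₀ hN, abs_le]
    constructor <;> linarith [hy.1, hy.2]
  have hzN : |z / N + 1| ≤ 1 / 1000 := by
    rw [div_add_one hN.ne', abs_div, abs_of_pos hN, div_le_iff₀ hN, abs_le]
    constructor <;> linarith [hz.1, hz.2]
  have q1 := le_cofactor hκ hxN hyN
  have q2 := cofactor_mem hκ hyN hzN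
  have q3 : cofactor κ 1 (z / N) (x / N) ∈ Icc (-6 : ℝ) (-4) := by
    have : cofactor κ 1 (z / N) (x / N) = cofactor κ 1 (x / N) (z / N) := by unfold cofactor; ring
    rw [this]; exact cofactor_mem hκ hxN hzN
  set Ψ := resonance α β x y + resonance α β (x + y) z with hΨ
  have hΨ2 : Ψ = resonance α β y z + resonance α β (y + z) x := by
    rw [hΨ, resonance_add_resonance, resonance_add_resonance]; ring
  have hΨ3 : Ψ = resonance α β z x + resonance α β (z + x) y := by
    rw [hΨ, resonance_add_resonance, resonance_add_resonance]; ring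
  have xy1 : |x + y| ≤ 2 * N := by rw [abs_le]; constructor <;> linarith [hx.1, hx.2, hy.1, hy.2]
  -- The offsets place `y + z` and `z + x` in `[-2γ, -γ]`. The upper bound on their size keeps the
  -- total resonance small; the lower bound keeps the intermediate resonances large.
  have yz1 : |y + z| ≤ 2 * γ := by rw [abs_le]; constructor <;> linarith [hy.1, hy.2, hz.1, hz.2]
  have zx1 : |z + x| ≤ 2 * γ := by rw [abs_le]; constructor <;> linarith [hx.1, hx.2, hz.1, hz.2]
  have xy2 : γ ≤ |x + y| := le_abs.2 (Or.inl (by linarith [hx.1, hy.1]))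
  have yz2 : γ ≤ |y + z| := le_abs.2 (Or.inr (by linarith [hy.2, hz.1]))
  have zx2 : γ ≤ |z + x| := le_abs.2 (Or.inr (by linarith [hx.2, hz.1]))
  have ha : |(2 * Real.pi) ^ 3 * α| ≤ |b| * N ^ 2 / 100 := by
    rw [hκd, abs_div, abs_mul b, abs_of_nonneg (sq_nonneg N), div_le_iff₀ (by positivity)] at hκ
    linarith
  have sq : ∀ w : ℝ, |w| ≤ 11 / 10 * N → w ^ 2 ≤ 121 / 100 * N ^ 2 := by
    intro w hw
    have := pow_le_pow_left₀ (abs_nonneg w) hw 2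
    rw [sq_abs] at this
    linarith
  have hm : |5 / 2 * ((2 * Real.pi) ^ 5 * β) * (x ^ 2 + y ^ 2 + z ^ 2 + (x + y + z) ^ 2) -
        3 * ((2 * Real.pi) ^ 3 * α)| ≤ |b| * (12.5 * N ^ 2) := by
    have s1 := sq x (by rw [abs_le]; constructor <;> linarith [hx.1, hx.2])
    have s2 := sq y (by rw [abs_le]; constructor <;> linarith [hy.1, hy.2])
    have s3 := sq z (by rw [abs_le]; constructor <;> linarith [hz.1, hz.2])
    have s4 := sq (x + y + z) (by
      rw [abs_le]; constructor <;> linarith [hx.1, hx.2, hy.1, hy.2, hz.1, hz.2])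
    refine (abs_sub _ _).trans ?_
    rw [← hb, abs_mul, abs_mul, abs_mul, abs_of_nonneg (by positivity :
      0 ≤ x ^ 2 + y ^ 2 + z ^ 2 + (x + y + z) ^ 2), abs_of_pos (by norm_num : (0 : ℝ) < 5 / 2),
      abs_of_pos (by norm_num : (0 : ℝ) < 3)]
    have : 5 / 2 * |b| * (x ^ 2 + y ^ 2 + z ^ 2 + (x + y + z) ^ 2) ≤
        5 / 2 * |b| * (4 * (121 / 100 * N ^ 2)) := by gcongr; linarith
    have n2 : 0 ≤ |b| * N ^ 2 := by positivity
    linarith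
  -- The three linear factors and the last one multiply to at most `2N · (2γ)² · 12.5 |b| N² = 100
  -- |b| N³γ²`, which explains `hbt` and `hNγ`.
  have hsmall : t * |Ψ| ≤ 1 := by
    rw [hΨ, resonance_add_resonance, abs_mul, abs_neg, abs_mul, abs_mul]
    calc _ ≤ t * (2 * N * (2 * γ) * (2 * γ) * (|b| * (12.5 * N ^ 2))) := by gcongr
      _ = (100 * |b| * t) * (N ^ 3 * γ ^ 2) := by ring
      _ ≤ 1 * 1 := by gcongr
      _ = 1 := one_mul 1
  have hS := half_le_cosIntegral ht.le hsmall
  obtain ⟨e1, he1, k1⟩ := interactionKernel_eq hb hb0 ht hN hγ hlarge xy2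
    (le_abs.2 (Or.inl (by linarith))) hΨ hsmall
  obtain ⟨e2, he2, k2⟩ := interactionKernel_eq hb hb0 ht hN hγ hlarge yz2
    (le_abs.2 (Or.inr (by linarith [q2.2]))) hΨ2 hsmall
  obtain ⟨e3, he3, k3⟩ := interactionKernel_eq hb hb0 ht hN hγ hlarge zx2
    (le_abs.2 (Or.inr (by linarith [q3.2]))) hΨ3 hsmall
  rw [mul_add, mul_add, k1, k2, k3, ← hκd]
  rw [abs_le] at he1 he2 he3
  set S := cosIntegral t Ψ
  -- Since `S ≥ t/2`, the main part `S (1/14 - 2/6)` is at most `-11t/84`; the errors, each at most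
  -- `t/24`, cannot bring the sum above `-t/16`.
  have b1 : (S - e1) / cofactor κ 1 (x / N) (y / N) ≤ (S - e1) / 14 := by
    gcongr; linarith
  have neg : ∀ e q : ℝ, |e| ≤ t / 24 → q ∈ Icc (-6 : ℝ) (-4) → (S - e) / q ≤ -((S - e) / 6) := by
    intro e q he hq
    rw [abs_le] at he
    have h1 : (S - e) / 6 ≤ (S - e) / (-q) :=
      div_le_div_of_nonneg_left (by linarith) (by linarith [hq.2]) (by linarith [hq.1])
    rw [div_neg] at h1
    linarith
  have b2 := neg e2 _ (abs_le.2 he2) q2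
  have b3 := neg e3 _ (abs_le.2 he3) q3
  linarith

end

/-! ### Symmetrization and the lower bound for the cubic interaction. -/

section

variable {α β : ℝ} {F H : ℝ → ℂ}

theorem measurePreserving_cyclic :
    MeasurePreserving (fun z : ℝ × ℝ × ℝ => (z.2.1, z.2.2, z.1)) :=
  (measurePreserving_prodAssoc volume volume volume).comp
    (Measure.measurePreserving_swap (μ := (volume : Measure ℝ)) (ν := (volume : Measure (ℝ × ℝ))))

theorem measurableEmbedding_cyclic :
    MeasurableEmbedding (fun z : ℝ × ℝ × ℝ => (z.2.1, z.2.2, z.1)) :=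
  (MeasurableEquiv.prodComm.trans MeasurableEquiv.prodAssoc :
    ℝ × ℝ × ℝ ≃ᵐ ℝ × ℝ × ℝ).measurableEmbedding

/-- Symmetrization of an integral with respect to the cyclic permutations of three variables. -/
theorem integral_add_cyclic {G : ℝ × ℝ × ℝ → ℝ} (hG : Integrable G) :
    (Integrable fun z : ℝ × ℝ × ℝ => G z + G (z.2.1, z.2.2, z.1) + G (z.2.2, z.1, z.2.1)) ∧
    ∫ z : ℝ × ℝ × ℝ, (G z + G (z.2.1, z.2.2, z.1) + G (z.2.2, z.1, z.2.1)) = 3 * ∫ z, G z := by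
  have i1 : Integrable fun z : ℝ × ℝ × ℝ => G (z.2.1, z.2.2, z.1) :=
    measurePreserving_cyclic.integrable_comp_of_integrable hG
  have i2 : Integrable fun z : ℝ × ℝ × ℝ => G (z.2.2, z.1, z.2.1) :=
    measurePreserving_cyclic.integrable_comp_of_integrable i1
  have e1 : ∫ z : ℝ × ℝ × ℝ, G (z.2.1, z.2.2, z.1) = ∫ z, G z :=
    measurePreserving_cyclic.integral_comp measurableEmbedding_cyclic G
  have e2 : ∫ z : ℝ × ℝ × ℝ, G (z.2.2, z.1, z.2.1) = ∫ z, G z :=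
    (measurePreserving_cyclic.integral_comp measurableEmbedding_cyclic
      fun z : ℝ × ℝ × ℝ => G (z.2.1, z.2.2, z.1)).trans e1
  have i3 : Integrable fun z : ℝ × ℝ × ℝ => G z + G (z.2.1, z.2.2, z.1) := hG.add i1
  refine ⟨i3.add i2, ?_⟩
  rw [integral_add i3 i2, integral_add hG i1, e1, e2]
  ring

theorem weightedNorm_le {s w c : ℝ} {S : Set ℝ} (hS : MeasurableSet S) (hw : 0 ≤ w) (hc : 0 ≤ c)
    (hvol : volume S ≤ ENNReal.ofReal c) (h0 : ∀ ξ, ξ ∉ S → H ξ = 0)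
    (hle : ∀ ξ ∈ S, weight s ξ * ‖H ξ‖ ≤ w) : weightedNorm s H ≤ w * Real.sqrt c := by
  have hfin : volume S < ⊤ := hvol.trans_lt ENNReal.ofReal_lt_top
  rw [weightedNorm, Real.sqrt_le_left (by positivity), mul_pow, Real.sq_sqrt hc]
  have h1 : ∫ ξ, (weight s ξ * ‖H ξ‖) ^ 2 ≤ ∫ ξ, S.indicator (fun _ => w ^ 2) ξ := by
    refine integral_mono_of_nonneg (Eventually.of_forall fun ξ => sq_nonneg _)
      ((integrable_indicator_iff hS).2 (integrableOn_const hfin.ne)) (Eventually.of_forall fun ξ => ?_)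
    by_cases h : ξ ∈ S
    · simp only [indicator_of_mem h]
      exact pow_le_pow_left₀ (mul_nonneg (weight_nonneg s ξ) (norm_nonneg _)) (hle ξ h) 2
    · simp [h0 ξ h, h]
  refine h1.trans ?_
  rw [integral_indicator hS, setIntegral_const, smul_eq_mul, mul_comm]
  gcongr
  exact ENNReal.toReal_le_of_le_ofReal hc hvol

theorem weight_le_of_nonpos {s m ξ : ℝ} (hs : s ≤ 0) (hm : 0 < m) (h : m ≤ |ξ|) :
    weight s ξ ≤ m ^ s := by
  have h1 : m ^ 2 ≤ 1 + ‖ξ‖ ^ 2 := by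
    have := pow_le_pow_left₀ hm.le h 2
    rw [Real.norm_eq_abs]; linarith
  refine (Real.rpow_le_rpow_of_nonpos (by positivity) h1 (by linarith)).trans_eq ?_
  rw [← Real.rpow_natCast, ← Real.rpow_mul hm.le]
  congr 1; push_cast; ring

theorem weight_le_of_nonneg {s m ξ : ℝ} (hs : 0 ≤ s) (hm : 0 ≤ m) (h : 1 + |ξ| ≤ m) :
    weight s ξ ≤ m ^ s := by
  have h1 : 1 + ‖ξ‖ ^ 2 ≤ m ^ 2 := by
    rw [Real.norm_eq_abs]
    nlinarith [abs_nonneg ξ]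
  refine (Real.rpow_le_rpow (by positivity) h1 (by linarith)).trans_eq ?_
  rw [← Real.rpow_natCast, ← Real.rpow_mul hm]
  congr 1; push_cast; ring

/-- The Fourier transform of the initial value: bumps at the frequencies `±N`. -/
def evenBump {N : ℝ} (f : ContDiffBump N) (ξ : ℝ) : ℝ := f ξ + f (-ξ)

theorem _root_.ContDiffBump.abs_sub_lt {c : ℝ} (f : ContDiffBump c) {ξ : ℝ} (h : f ξ ≠ 0) :
    |ξ - c| < f.rOut := by
  have : ξ ∈ Function.support f := h
  rwa [f.support_eq, Metric.mem_ball, Real.dist_eq] at this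

theorem _root_.ContDiffBump.eq_one_of_abs_sub_le {c : ℝ} (f : ContDiffBump c) {ξ : ℝ}
    (h : |ξ - c| ≤ f.rIn) : f ξ = 1 :=
  f.one_of_mem_closedBall (by rwa [Metric.mem_closedBall, Real.dist_eq])

theorem isTest_bump {c : ℝ} (f : ContDiffBump c) : IsTest fun ξ => ((f ξ : ℝ) : ℂ) :=
  ⟨Complex.ofRealCLM.contDiff.comp f.contDiff,
    f.hasCompactSupport.comp_left (g := fun x : ℝ => (x : ℂ)) Complex.ofReal_zero⟩

theorem IsTest.comp_neg (hH : IsTest H) : IsTest fun ξ => H (-ξ) :=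
  ⟨hH.smooth.comp contDiff_neg, hH.supp.comp_homeomorph (Homeomorph.neg ℝ)⟩

theorem isTest_evenBump {N : ℝ} (f : ContDiffBump N) : IsTest fun ξ => ((evenBump f ξ : ℝ) : ℂ) := by
  have := (isTest_bump f).add (isTest_bump f).comp_neg
  simp only [evenBump, Complex.ofReal_add]
  exact this

theorem isHermitian_evenBump {N : ℝ} (f : ContDiffBump N) :
    IsHermitian fun ξ => ((evenBump f ξ : ℝ) : ℂ) := by
  intro ξ
  simp only [Complex.conj_ofReal, evenBump, neg_neg, add_comm]

theorem evenBump_nonneg {N : ℝ} (f : ContDiffBump N) (ξ : ℝ) : 0 ≤ evenBump f ξ :=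
  add_nonneg f.nonneg f.nonneg

theorem evenBump_le_two {N : ℝ} (f : ContDiffBump N) (ξ : ℝ) : evenBump f ξ ≤ 2 :=
  (add_le_add f.le_one f.le_one).trans_eq one_add_one_eq_two

theorem abs_sub_lt_or_of_evenBump_ne_zero {N : ℝ} (f : ContDiffBump N) {ξ : ℝ}
    (h : evenBump f ξ ≠ 0) : |ξ - N| < f.rOut ∨ |ξ + N| < f.rOut := by
  by_contra! h'
  refine h ?_
  have h1 : f ξ = 0 := by
    by_contra h0; exact absurd (f.abs_sub_lt h0) (not_lt.2 h'.1)
  have h2 : f (-ξ) = 0 := by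
    by_contra h0
    have := f.abs_sub_lt h0
    rw [← abs_neg] at this
    ring_nf at this
    exact absurd this (not_lt.2 h'.2)
  rw [evenBump, h1, h2, add_zero]

theorem one_le_evenBump {N : ℝ} (f : ContDiffBump N) {ξ : ℝ}
    (h : |ξ - N| ≤ f.rIn ∨ |-ξ - N| ≤ f.rIn) : 1 ≤ evenBump f ξ := by
  rcases h with h | h
  · rw [evenBump, f.eq_one_of_abs_sub_le h]; linarith [f.nonneg' (-ξ)]
  · rw [evenBump, f.eq_one_of_abs_sub_le h]; linarith [f.nonneg' ξ]

/-- Near a resonance, the cubic interaction is large compared to its formal size. -/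
theorem le_norm_cubicInteraction {t N γ b : ℝ} (hb : b = (2 * Real.pi) ^ 5 * β)
    (hb0 : b ≠ 0) (ht : 0 < t) (hN : 0 < N) (hγ : 0 < γ) (hγN : 1000 * γ ≤ N)
    (hκ : |(2 * Real.pi) ^ 3 * α / (b * N ^ 2)| ≤ 1 / 100)
    (hlarge : 25 ≤ 4 * (t * γ * |b| * N ^ 4)) (hNγ : N ^ 3 * γ ^ 2 ≤ 1) (hbt : 100 * |b| * t ≤ 1)
    (f : ContDiffBump N) (hf : f.rIn = 19 / 20 * γ) (hf' : f.rOut = γ)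
    (g : ContDiffBump (N - 11 / 4 * γ)) (hg : γ / 10 ≤ g.rIn) (hg' : g.rOut = γ / 4) :
    t * N * γ ^ 3 ≤ 1000000 * (|b| * N ^ 4) *
      ‖∫ z : ℝ × ℝ × ℝ, cubicWeight (fun ξ => ((evenBump f ξ : ℝ) : ℂ))
        (fun ξ => ((g (-ξ) : ℝ) : ℂ)) z *
        timeKernel t (resonance α β z.1 z.2.1) (resonance α β (z.1 + z.2.1) z.2.2)‖ := by
  have hint := integrable_cubicWeight_mul_timeKernel (α := α) (β := β) (isTest_evenBump f)
    (isTest_bump g).comp_neg ht.le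
  set J := ∫ z : ℝ × ℝ × ℝ, cubicWeight (fun ξ => ((evenBump f ξ : ℝ) : ℂ))
        (fun ξ => ((g (-ξ) : ℝ) : ℂ)) z *
        timeKernel t (resonance α β z.1 z.2.1) (resonance α β (z.1 + z.2.1) z.2.2) with hJ
  set P : ℝ → ℝ → ℝ → ℝ := fun x y z => evenBump f x * evenBump f y * evenBump f z *
    g (x + y + z) * (x + y + z) with hP
  set D : ℝ → ℝ → ℝ → ℝ := fun x y z => interactionKernel α β t x y z +
    interactionKernel α β t y z x + interactionKernel α β t z x y with hD
  set G : ℝ × ℝ × ℝ → ℝ := fun z => -(4 * Real.pi ^ 2) *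
    (P z.1 z.2.1 z.2.2 * interactionKernel α β t z.1 z.2.1 z.2.2) with hG
  -- All profiles are real, so once `x + y` is attached to the time kernel the remaining weight is
  -- real and the imaginary part falls on `interactionKernel`.
  have hGim : ∀ z : ℝ × ℝ × ℝ, (cubicWeight (fun ξ => ((evenBump f ξ : ℝ) : ℂ))
        (fun ξ => ((g (-ξ) : ℝ) : ℂ)) z *
        timeKernel t (resonance α β z.1 z.2.1) (resonance α β (z.1 + z.2.1) z.2.2)).im = G z := by
    intro z
    have : cubicWeight (fun ξ => ((evenBump f ξ : ℝ) : ℂ)) (fun ξ => ((g (-ξ) : ℝ) : ℂ)) z *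
        timeKernel t (resonance α β z.1 z.2.1) (resonance α β (z.1 + z.2.1) z.2.2) =
        ((-(4 * Real.pi ^ 2) * P z.1 z.2.1 z.2.2 : ℝ) : ℂ) * (((z.1 + z.2.1 : ℝ) : ℂ) *
        timeKernel t (resonance α β z.1 z.2.1) (resonance α β (z.1 + z.2.1) z.2.2)) := by
      simp only [cubicWeight, hP, neg_neg]
      push_cast
      ring
    rw [this, Complex.im_ofReal_mul, mul_assoc]
    rfl
  have Gi : Integrable G := by
    exact hint.im.congr (Eventually.of_forall hGim)
  have GJ : ∫ z, G z = J.im := by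
    have := integral_im hint
    simp only [RCLike.im_to_complex, hGim] at this
    exact this
  obtain ⟨i3, e3⟩ := integral_add_cyclic Gi
  have sym : ∀ z : ℝ × ℝ × ℝ, G z + G (z.2.1, z.2.2, z.1) + G (z.2.2, z.1, z.2.1) =
      -(4 * Real.pi ^ 2) * (P z.1 z.2.1 z.2.2 * D z.1 z.2.1 z.2.2) := by
    intro z
    have p1 : P z.2.1 z.2.2 z.1 = P z.1 z.2.1 z.2.2 := by
      simp only [hP]; rw [show z.2.1 + z.2.2 + z.1 = z.1 + z.2.1 + z.2.2 by ring]; ring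
    have p2 : P z.2.2 z.1 z.2.1 = P z.1 z.2.1 z.2.2 := by
      simp only [hP]; rw [show z.2.2 + z.1 + z.2.1 = z.1 + z.2.1 + z.2.2 by ring]; ring
    simp only [hG, hD, p1, p2]
    ring
  -- The profile `g` confines `x + y + z` to `(N - 3γ, N - 5γ/2)`. This excludes every sign pattern
  -- except two positive frequencies and one negative. The three offsets from `±N` exceed `-γ` and
  -- sum to less than `-5γ/2`, so each lies below `-γ/2`, as `cyclic_interactionKernel_le` requires.
  have bound : ∀ x y z : ℝ, P x y z ≠ 0 → 0 ≤ P x y z ∧ b * N ^ 4 * D x y z ≤ -(t / 16) := by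
    intro x y z h
    simp only [hP, mul_ne_zero_iff] at h
    obtain ⟨⟨⟨⟨hx, hy⟩, hz⟩, hxyz⟩, -⟩ := h
    have h4 := g.abs_sub_lt hxyz
    rw [hg', abs_lt] at h4
    refine ⟨mul_nonneg (mul_nonneg (mul_nonneg (mul_nonneg (evenBump_nonneg f x)
      (evenBump_nonneg f y)) (evenBump_nonneg f z)) g.nonneg) (by linarith), ?_⟩
    have base := fun {x y z : ℝ} => cyclic_interactionKernel_le (x := x) (y := y) (z := z)
      hb hb0 ht hN hγ hγN hκ hlarge hNγ hbt
    have h1 := abs_sub_lt_or_of_evenBump_ne_zero f hx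
    have h2 := abs_sub_lt_or_of_evenBump_ne_zero f hy
    have h3 := abs_sub_lt_or_of_evenBump_ne_zero f hz
    simp only [hf', abs_lt] at h1 h2 h3
    simp only [hD]
    rcases h1 with h1 | h1 <;> rcases h2 with h2 | h2 <;> rcases h3 with h3 | h3
    · exfalso; linarith
    · exact base ⟨by linarith, by linarith⟩ ⟨by linarith, by linarith⟩ ⟨by linarith, by linarith⟩
    · have := base (x := z) (y := x) (z := y) ⟨by linarith, by linarith⟩
        ⟨by linarith, by linarith⟩ ⟨by linarith, by linarith⟩
      linarith
    · exfalso; linarith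
    · have := base (x := y) (y := z) (z := x) ⟨by linarith, by linarith⟩
        ⟨by linarith, by linarith⟩ ⟨by linarith, by linarith⟩
      linarith
    all_goals exfalso; linarith
  -- On this box all bumps equal `1`: the offsets are at most `19γ/20` in size, and their sum is
  -- within `γ/10` of `-11γ/4`.
  set S : Set (ℝ × ℝ × ℝ) := Icc (N - 19 / 20 * γ) (N - 18 / 20 * γ) ×ˢ
    Icc (N - 19 / 20 * γ) (N - 18 / 20 * γ) ×ˢ Icc (-N - 19 / 20 * γ) (-N - 18 / 20 * γ) with hS
  have Sm : MeasurableSet S := measurableSet_Icc.prod (measurableSet_Icc.prod measurableSet_Icc)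
  have Sv : volume.real S = (γ / 20) ^ 3 := by
    rw [hS, Measure.volume_eq_prod, measureReal_prod_prod, Measure.volume_eq_prod,
      measureReal_prod_prod, Real.volume_real_Icc_of_le (by linarith),
      Real.volume_real_Icc_of_le (by linarith)]
    ring
  have Sf : volume S ≠ ⊤ := by
    intro h
    rw [Measure.real, h, ENNReal.toReal_top] at Sv
    have : 0 < (γ / 20) ^ 3 := by positivity
    linarith
  have low : ∀ z ∈ S, N / 2 ≤ P z.1 z.2.1 z.2.2 := by
    rintro ⟨x, y, z⟩ ⟨hx, hy, hz⟩
    simp only [mem_Icc] at hx hy hz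
    have h1 := one_le_evenBump f (ξ := x) (Or.inl (by
      rw [hf, abs_le]; constructor <;> linarith))
    have h2 := one_le_evenBump f (ξ := y) (Or.inl (by
      rw [hf, abs_le]; constructor <;> linarith))
    have h3 := one_le_evenBump f (ξ := z) (Or.inr (by
      rw [hf, abs_le]; constructor <;> linarith))
    have h4 : g (x + y + z) = 1 := g.eq_one_of_abs_sub_le (by
      refine le_trans ?_ hg
      rw [abs_le]; constructor <;> linarith)
    simp only [hP, h4]
    calc N / 2 = 1 * 1 * 1 * 1 * (N / 2) := by ring
      _ ≤ _ := by gcongr; linarith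
  -- Multiplied by `b N⁴`, the symmetrized integrand is nonnegative everywhere, so it can be bounded
  -- below by its part on the box.
  have mono : ∫ z, S.indicator (fun _ => t / 16 * (N / 2)) z ≤
      ∫ z : ℝ × ℝ × ℝ, b * N ^ 4 * (G z + G (z.2.1, z.2.2, z.1) + G (z.2.2, z.1, z.2.1)) := by
    refine integral_mono ((integrable_indicator_iff Sm).2 (integrableOn_const Sf))
      (i3.const_mul _) fun z => ?_
    simp only [sym]
    have e : b * N ^ 4 * (-(4 * Real.pi ^ 2) * (P z.1 z.2.1 z.2.2 * D z.1 z.2.1 z.2.2)) =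
        4 * Real.pi ^ 2 * (P z.1 z.2.1 z.2.2 * -(b * N ^ 4 * D z.1 z.2.1 z.2.2)) := by ring
    rw [e]
    have pi1 : 1 ≤ 4 * Real.pi ^ 2 := by nlinarith [Real.pi_gt_three]
    by_cases h : P z.1 z.2.1 z.2.2 = 0
    · have : z ∉ S := fun hz => by have := low z hz; linarith
      simp [this, h]
    · obtain ⟨h1, h2⟩ := bound _ _ _ h
      have h3 : t / 16 ≤ -(b * N ^ 4 * D z.1 z.2.1 z.2.2) := by linarith
      by_cases hz : z ∈ S
      · rw [indicator_of_mem hz]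
        have h4 := low z hz
        calc t / 16 * (N / 2) = 1 * (N / 2 * (t / 16)) := by ring
          _ ≤ _ := by gcongr
      · rw [indicator_of_notMem hz]
        exact mul_nonneg (by linarith) (mul_nonneg h1 (by linarith))
  rw [integral_const_mul, e3, GJ, integral_indicator Sm, setIntegral_const,
    Sv, smul_eq_mul] at mono
  have fin : b * N ^ 4 * (3 * J.im) ≤ 3 * (|b| * N ^ 4 * ‖J‖) := by
    calc _ ≤ |b * N ^ 4 * (3 * J.im)| := le_abs_self _
      _ = 3 * (|b| * N ^ 4 * |J.im|) := by
        rw [abs_mul, abs_mul, abs_mul, abs_of_nonneg (by positivity : 0 ≤ N ^ 4),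
          abs_of_pos (by norm_num : (0 : ℝ) < 3)]
        ring
      _ ≤ _ := by gcongr; exact Complex.abs_im_le_norm J
  -- The constants multiply to `16 · 2 · 20³ · 3 = 768000`, rounded up to `1000000`.
  have n0 : 0 ≤ |b| * N ^ 4 * ‖J‖ := by positivity
  nlinarith

end

/-! ### Norms of the profiles and the contradiction as `N` tends to infinity. -/

section

variable {α β : ℝ} {F H : ℝ → ℂ}

theorem weightedNorm_evenBump_le {s N γ : ℝ} (hs : s ≤ 0) (hγ : 0 < γ) (hγN : 1000 * γ ≤ N)
    (f : ContDiffBump N) (hf : f.rOut = γ) :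
    weightedNorm s (fun ξ => ((evenBump f ξ : ℝ) : ℂ)) ≤ 2 * (N / 2) ^ s * Real.sqrt (4 * γ) := by
  have hN : 0 < N := by linarith
  refine weightedNorm_le (S := Icc (N - γ) (N + γ) ∪ Icc (-N - γ) (-N + γ))
    (measurableSet_Icc.union measurableSet_Icc) (by positivity) (by positivity) ?_ ?_ ?_
  · refine (measure_union_le _ _).trans ?_
    rw [Real.volume_Icc, Real.volume_Icc, ← ENNReal.ofReal_add (by linarith) (by linarith)]
    exact ENNReal.ofReal_le_ofReal (by linarith)
  · intro ξ hξ
    by_contra h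
    refine hξ ?_
    have := abs_sub_lt_or_of_evenBump_ne_zero f (Complex.ofReal_ne_zero.1 h)
    simp only [hf, abs_lt] at this
    rcases this with h | h
    · left; constructor <;> linarith
    · right; constructor <;> linarith
  · intro ξ hξ
    have h1 : N / 2 ≤ |ξ| := by
      rcases hξ with h | h
      · exact le_abs.2 (Or.inl (by linarith [h.1]))
      · exact le_abs.2 (Or.inr (by linarith [h.2]))
    have h2 := weight_le_of_nonpos hs (by positivity : 0 < N / 2) h1
    rw [Complex.norm_real, Real.norm_eq_abs, abs_of_nonneg (evenBump_nonneg f ξ), mul_comm]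
    exact mul_le_mul (evenBump_le_two f ξ) h2 (weight_nonneg _ _) (by norm_num)

theorem weightedNorm_bump_le {s N γ c : ℝ} (hs : 0 ≤ s) (hγ : 0 < γ) (hcN : |c| + γ + 1 ≤ 2 * N)
    (g : ContDiffBump c) (hg : g.rOut ≤ γ) :
    weightedNorm s (fun ξ => ((g (-ξ) : ℝ) : ℂ)) ≤ (2 * N) ^ s * Real.sqrt (4 * γ) := by
  have hN : 0 < 2 * N := by linarith [abs_nonneg c]
  refine weightedNorm_le (S := Icc (-c - γ) (-c + γ)) measurableSet_Icc (by positivity)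
    (by positivity) ?_ ?_ ?_
  · rw [Real.volume_Icc]
    exact ENNReal.ofReal_le_ofReal (by linarith)
  · intro ξ hξ
    by_contra h
    have := (abs_lt.1 ((g.abs_sub_lt (Complex.ofReal_ne_zero.1 h)).trans_le hg))
    exact hξ ⟨by linarith, by linarith⟩
  · intro ξ hξ
    have h1 : 1 + |ξ| ≤ 2 * N := by
      have : |ξ| ≤ |c| + γ := by
        rw [abs_le]
        constructor <;> linarith [hξ.1, hξ.2, le_abs_self c, neg_abs_le c]
      linarith
    have h2 := weight_le_of_nonneg hs hN.le h1
    rw [Complex.norm_real, Real.norm_eq_abs, abs_of_nonneg (g.nonneg' _)]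
    exact (mul_le_mul h2 g.le_one (g.nonneg' _) (by positivity)).trans_eq (mul_one _)

/-- Upper and lower bounds for the cubic interaction are compared at one fixed time `t` while `N`
grows; the ratio decays like `N^{2s+9/2}`. -/
theorem not_contDiffAt_solutionMap (hβ : β ≠ 0) {s T : ℝ} (hs : s < -9 / 4) (hT : 0 < T)
    {Φ : Sobolev s → C(Icc (0 : ℝ) T, Sobolev s)} (hΦ : IsSolutionMap α β s T Φ) :
    ¬ ContDiffAt ℝ 3 Φ 0 := by
  intro hd
  obtain ⟨C, hC⟩ := exists_cubicInteraction_le hΦ hd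
  set b := (2 * Real.pi) ^ 5 * β with hb
  set a := (2 * Real.pi) ^ 3 * α with ha
  have hb0 : b ≠ 0 := mul_ne_zero (by positivity) hβ
  have hbp : 0 < |b| := abs_pos.2 hb0
  -- The time is capped independently of `N`, so that the total resonance stays harmless up to `t`.
  set t := min T (1 / (100 * |b|)) with htd
  have ht : 0 < t := by positivity
  have hbt : 100 * |b| * t ≤ 1 := by
    have : t ≤ 1 / (100 * |b|) := min_le_right _ _
    rw [le_div_iff₀ (by positivity)] at this
    linarith
  set K := 1000000 * |b| * |C| * 128 * (2 : ℝ) ^ (-4 * s) with hK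
  have key : ∀ᶠ N : ℝ in atTop, t ≤ K * N ^ (-(-(2 * s + 9 / 2))) := by
    filter_upwards [eventually_ge_atTop (1000 : ℝ), eventually_ge_atTop (100 * |a| / |b|),
      eventually_ge_atTop (25 / (4 * (t * |b|)))] with N h1 h2 h3
    have hN : 0 < N := by linarith
    -- This is the largest width allowed by `N³γ² ≤ 1`. Wide bumps are best, since the lower bound
    -- carries `γ³` and the product of norms only `γ²`.
    set γ := N ^ (-(3 / 2) : ℝ) with hγd
    have hγ : 0 < γ := Real.rpow_pos_of_pos hN _
    have hγ1 : γ ≤ 1 := Real.rpow_le_one_of_one_le_of_nonpos (by linarith) (by norm_num)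
    have hNγ : N ^ 3 * γ ^ 2 = 1 := by
      rw [hγd, ← Real.rpow_natCast, ← Real.rpow_natCast, ← Real.rpow_mul hN.le,
        ← Real.rpow_add hN]
      norm_num
    have hγN4 : N ≤ γ * N ^ 4 := by
      have : γ ^ 2 ≤ γ := by nlinarith
      calc N = N * (N ^ 3 * γ ^ 2) := by rw [hNγ, mul_one]
        _ = γ ^ 2 * N ^ 4 := by ring
        _ ≤ _ := by gcongr
    have hκ : |a / (b * N ^ 2)| ≤ 1 / 100 := by
      rw [abs_div, abs_mul b, abs_of_nonneg (sq_nonneg N), div_le_iff₀ (by positivity)]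
      rw [div_le_iff₀ hbp] at h2
      have : N * |b| ≤ N ^ 2 * |b| := by gcongr; nlinarith
      linarith
    have hlarge : 25 ≤ 4 * (t * γ * |b| * N ^ 4) := by
      rw [div_le_iff₀ (by positivity)] at h3
      calc 25 ≤ N * (4 * (t * |b|)) := h3
        _ ≤ γ * N ^ 4 * (4 * (t * |b|)) := by gcongr
        _ = _ := by ring
    set f : ContDiffBump N := ⟨19 / 20 * γ, γ, by positivity, by linarith⟩ with hf
    set g : ContDiffBump (N - 11 / 4 * γ) := ⟨γ / 10, γ / 4, by positivity, by linarith⟩ with hg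
    have lower := le_norm_cubicInteraction hb hb0 ht hN hγ (by linarith) hκ hlarge hNγ.le hbt
      f rfl rfl g le_rfl rfl
    have upper := hC _ _ (isTest_evenBump f) (isHermitian_evenBump f) (isTest_bump g).comp_neg t
      ⟨ht.le, min_le_left _ _⟩
    have nF := weightedNorm_evenBump_le (s := s) (by linarith) hγ (by linarith) f rfl
    have nH := weightedNorm_bump_le (s := -s) (N := N) (γ := γ) (by linarith) hγ
      (by rw [abs_of_nonneg (by linarith)]; linarith) g (by change γ / 4 ≤ γ; linarith)
    set nf := weightedNorm s fun ξ => ((evenBump f ξ : ℝ) : ℂ)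
    set nh := weightedNorm (-s) fun ξ => ((g (-ξ) : ℝ) : ℂ)
    have nf0 : 0 ≤ nf := Real.sqrt_nonneg _
    have nh0 : 0 ≤ nh := Real.sqrt_nonneg _
    have prod : nf ^ 3 * nh ≤ 128 * (2 : ℝ) ^ (-4 * s) * N ^ (2 * s) * γ ^ 2 := by
      calc nf ^ 3 * nh ≤ (2 * (N / 2) ^ s * Real.sqrt (4 * γ)) ^ 3 *
            ((2 * N) ^ (-s) * Real.sqrt (4 * γ)) := by gcongr
        _ = 8 * (((N / 2) ^ s) ^ 3 * (2 * N) ^ (-s)) * (Real.sqrt (4 * γ) ^ 2) ^ 2 := by ring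
        _ = 8 * ((2 : ℝ) ^ (-4 * s) * N ^ (2 * s)) * (4 * γ) ^ 2 := by
          rw [Real.sq_sqrt (by positivity), Real.div_rpow hN.le (by norm_num),
            Real.mul_rpow (by norm_num) hN.le, div_eq_mul_inv, ← Real.rpow_neg (by norm_num),
            mul_pow, ← Real.rpow_natCast (N ^ s), ← Real.rpow_natCast ((2 : ℝ) ^ (-s)),
            ← Real.rpow_mul hN.le, ← Real.rpow_mul (by norm_num)]
          have e1 : (2 : ℝ) ^ (-4 * s) = 2 ^ (-s * ((3 : ℕ) : ℝ)) * 2 ^ (-s) := by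
            rw [← Real.rpow_add (by norm_num)]; congr 1; push_cast; ring
          have e2 : N ^ (2 * s) = N ^ (s * ((3 : ℕ) : ℝ)) * N ^ (-s) := by
            rw [← Real.rpow_add hN]; congr 1; push_cast; ring
          rw [e1, e2]
          ring
        _ = _ := by ring
    have all : t * N * γ ^ 3 ≤ K * N ^ (2 * s) * N ^ 4 * γ ^ 2 := by
      refine lower.trans ?_
      calc _ ≤ 1000000 * (|b| * N ^ 4) *
            (|C| * (128 * (2 : ℝ) ^ (-4 * s) * N ^ (2 * s) * γ ^ 2)) := by
            gcongr
            refine upper.trans ?_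
            exact mul_le_mul (le_abs_self C) prod (by positivity) (abs_nonneg C)
        _ = _ := by rw [hK]; ring
    -- After division by `Nγ³` the power left is `N^{2s+3}/γ = N^{2s+9/2}`. The double negation in
    -- the exponent fits `tendsto_rpow_neg_atTop`.
    have e3 : N ^ (2 * s) * N ^ 4 = N ^ (-(-(2 * s + 9 / 2))) * (N * γ) := by
      have e4 : N * γ = N ^ (-(1 / 2) : ℝ) := by
        rw [hγd, ← Real.rpow_one_add' hN.le (by norm_num)]; norm_num
      rw [e4, ← Real.rpow_natCast, ← Real.rpow_add hN, ← Real.rpow_add hN]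
      congr 1; push_cast; ring
    rw [mul_assoc K, e3] at all
    have pos : 0 < N * γ ^ 3 := by positivity
    refine le_of_mul_le_mul_right ?_ pos
    calc t * (N * γ ^ 3) = t * N * γ ^ 3 := by ring
      _ ≤ _ := all
      _ = _ := by ring
  have lim : Tendsto (fun N : ℝ => K * N ^ (-(-(2 * s + 9 / 2)))) atTop (𝓝 (K * 0)) :=
    (tendsto_rpow_neg_atTop (by linarith)).const_mul K
  rw [mul_zero] at lim
  exact absurd (ge_of_tendsto lim key) (not_le.2 ht)

end

end Kawahara

end

theorem theorem5p1 (α β : ℝ) (hβ : β ≠ 0) (s : ℝ) (hs : s < -9 / 4) :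
    ¬ ∃ T : ℝ, 0 < T ∧ ∃ Φ : Kawahara.Sobolev s → C(Set.Icc (0 : ℝ) T, Kawahara.Sobolev s),
      Kawahara.IsSolutionMap α β s T Φ ∧ ContDiffAt ℝ 3 Φ 0 := by
  rintro ⟨T, hT, Φ, hΦ, hd⟩
  exact Kawahara.not_contDiffAt_solutionMap hβ hs hT hΦ hd
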